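/- \textbf{Setting.} Fix $T>0$, $q>0$, $\phi,\varrho\ge 0$. Let $A,M$ be càdlàg processes on $[0,T]$, on a filtered probability space satisfying the usual conditions, such that $A$ is predictable with $\mathbb E[A_0^2]+\mathbb E[(\int_0^T|dA_s|)^2]<\infty$, and $M$ is a square-integrable martingale, independent of $A$, with $\mathbb E[M_0]=0$. Let $\theta^\star=(\lambda^\star,G^\star)\in\mathbb R\times L^2([0,T])$ satisfy, for some $L>0$, $L^{-1}<\lambda^\star<L$, $\|G^\star\|_{L^2}<L$ and $\int_0^T\!\int_0^T G^\star(|t-s|)f(s)f(t)\,ds\,dt\ge 0$ for all $f\in L^2([0,T])$. For a control $u$ put $S^u_t=A_t+M_t-\lambda^\star u_t-\int_0^tG^\star(t-s)u_s\,ds$, $Q^u_t=q-\int_0^tu_s\,ds$, and let $$J^{\theta^\star}(u)=\mathbb E\Big[\int_0^T S^u_tu_t\,dt+Q^u_T(A_T+M_T)-\phi\int_0^T(Q^u_t)^2dt-\varrho (Q^u_T)^2\Big].$$ \textbf{Greedy strategy.} For $\theta=(\lambda,G)$ let $\tilde G(t,s)=(2\varrho+G(t-s))1_{\{s<t\}}$,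 let $\tilde{\boldsymbol G}_t$ and $\boldsymbol 1_t$ be the integral operators on $L^2([0,T])$ with kernels $\tilde G(s,u)1_{\{u\ge t\}}$ and $1_{\{u\ge s\}}1_{\{s\ge t\}}$ (the latter in the variables $(u,s)$), let $\boldsymbol D_t=2\lambda\,\mathrm{id}+\tilde{\boldsymbol G}_t+\tilde{\boldsymbol G}_t^*+2\phi\boldsymbol 1_t^*\boldsymbol 1_t$, $$\boldsymbol\Gamma_t^{-1}=\begin{pmatrix}\boldsymbol D_t^{-1}&-2\phi\boldsymbol D_t^{-1}\boldsymbol 1_t^*\\-2\phi\boldsymbol 1_t\boldsymbol D_t^{-1}&-2\phi\,\mathrm{id}+4\phi^2\boldsymbol 1_t\boldsymbol D_t^{-1}\boldsymbol 1_t^*\end{pmatrix},\qquad K_t(s)=(\tilde G(s,t),-1_{\{t\le s\}})^\top ,$$ and $1_t(s)=1_{\{s\ge t\}}$. Given an information flow $(\mathcal G_t)$, $u=\mathsf{Greedy}(A,\theta)$ is the square-integrable progressive solution of $u_t=a_t+\int_0^tB(t,s)u_s\,ds$, where, with $e_1=(1,0)^\top$ and $\Theta_t=-\boldsymbol\Gamma_t^{-1}\big(1_t\,\mathbb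 E[A_\cdot-A_T\mid\mathcal G_t]\,e_1\big)$, $$a_t=\tfrac1{2\lambda}\big(\mathbb E[A_t-A_T\mid\mathcal G_t]+2\varrho q+\langle\Theta_t,K_t\rangle_{L^2}+\langle\boldsymbol\Gamma_t^{-1}K_t,1_t(-2\varrho q,q)^\top\rangle_{L^2}\big),$$ $$B(t,s)=1_{\{s<t\}}\tfrac1{2\lambda}\big(\langle\boldsymbol\Gamma_t^{-1}K_t,1_t(\tilde G(\cdot,s),-1)^\top\rangle_{L^2}-\tilde G(t,s)\big).$$ Let $u^{\theta^\star}=\mathsf{Greedy}(A,\theta^\star)$, where $\mathcal G_t$ is generated by $(A_s)_{s\le t}$ and the null events. \textbf{Learning.} Let $(A^m)_{m\ge1},(M^m)_{m\ge1}$ be mutually independent càdlàg copies of $A$ and $M$ on a probability space $(\Omega,\mathcal F,\mathbb P)$. In episode $m\ge1$ a square-integrable control $u^m$ is executed, progressive for $\mathcal G^m_t=\mathcal F_{m-1}\vee\sigma(A^m_s:s\le t)$, and $S^m_t=A^m_t+M^m_t-\lambda^\star u^m_t-\int_0^tG^\star(t-s)u^m_s\,ds$ is observed; here $\mathcal F_0$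 is generated by the null events and $\mathcal F_m=\mathcal F_{m-1}\vee\sigma(S^m_t,A^m_t:t\in[0,T])$. With $J^{\theta^\star}(u^m)=\mathbb E\big[\int_0^TS^m_tu^m_t\,dt+Q^{u^m}_T(A^m_T+M^m_T)-\phi\int_0^T(Q_t^{u^m})^2dt-\varrho(Q_T^{u^m})^2\,\big|\,\mathcal F_{m-1}\big]$, the regret is $R(N)=\sum_{m=1}^N\big(J^{\theta^\star}(u^{\theta^\star})-J^{\theta^\star}(u^m)\big)$. \textbf{Estimator.} Fix $u^e\in H^1([0,T])$ with $u^e(0)\ne0$. For a finite set $E$ of episodes with $|E|=N$, a weight $\tau>0$ and a partition $\pi$ of $[0,T]$ into $N$ intervals, $\mathsf{LSE}((S^m,A^m)_{m\in E},\tau,\pi)=(\hat\lambda,\hat G)$, where $\hat\lambda=-\frac1{Nu^e(0)}\sum_{m\in E}(S^m_0-A^m_0)$ and $\hat G$ is the unique minimiser, over functions that are piecewise constant on $\pi$, of $$G\mapsto\frac1N\sum_{m\in E}\Big\|S^m-A^m+\hat\lambda u^e+\int_0^{\cdot}u^e(\cdot-s)G(s)\,ds\Big\|_{L^2}^2+\tau\|G\|_{L^2}^2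 .$$ \textbf{Assumption on the estimator.} There are weights $\tau_N>0$ and partitions $\pi_N$ of $[0,T]$ into $N$ intervals ($N\ge1$; both may depend on $\eta$), and constants $\tilde C>0$, $\kappa\in(0,1)$, such that for every $\eta\in(0,1)$, with probability at least $1-\eta$, the estimators $(\lambda^N,G^N)=\mathsf{LSE}((S^m,A^m)_{1\le m\le N},\tau_N,\pi_N)$, computed from trajectories under $u^m\equiv u^e$ for all $m$, satisfy for all integers $N\ge2$ $$|\lambda^N-\lambda^\star|\le\tilde C\,\frac{\log(\eta^{-1})+\log N}{\sqrt N},\qquad\|G^N-G^\star\|_{L^2}\le\tilde C\Big(\frac{\log(\eta^{-1})+\log N}{\sqrt N}\Big)^{\kappa}.$$ \textbf{Algorithm.} Let $\varepsilon\in(0,L^{-1}/2)$ and let $\Xi_\varepsilon$ be the set of $(\lambda,G)\in\mathbb R\times L^2([0,T])$ with $L^{-1}\le\lambda\le L$, $\|G\|_{L^2}\le L$ and $\int_0^T\!\int_0^TG(|t-s|)f(s)f(t)\,ds\,dt\ge-\varepsilon\|f\|_{L^2}^2$ for all $f\in L^2([0,T])$. Given $\mathfrak m_0\in\mathbb N$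 and $\mathfrak n:\mathbb N\to\mathbb N$, let $\mathfrak L(k)=\mathfrak m_0+\sum_{i=1}^k\mathfrak n(i)+k$. The phased algorithm executes $u^e$ in the exploration episodes $1,\dots,\mathfrak m_0$ and $\mathfrak L(k)$, $k\ge1$; it sets $\theta^k=\mathsf{LSE}((S^m,A^m)_{m\in\mathcal E_k},\tau_{\mathfrak m_0+k},\pi_{\mathfrak m_0+k})$ with $\mathcal E_k=\{1,\dots,\mathfrak m_0\}\cup\{\mathfrak L(j):1\le j\le k\}$, $k\ge0$; and in the episodes $m$ with $\mathfrak L(k-1)<m\le\mathfrak L(k-1)+\mathfrak n(k)$ it executes $u^m=\mathsf{Greedy}(A^m,\theta^{k-1})$ (with information $(\mathcal G^m_t)$) if $\theta^{k-1}\in\Xi_\varepsilon$, and any admissible control otherwise. \textbf{Theorem.} There exists $C_0>0$ such that for every $C\ge C_0$ there is a constant $C'>0$ such that for every $\eta\in(0,1)$: if $\mathfrak m_0=\lceil C(\log(\eta^{-1})^2+1)\rceil$ and $\mathfrak n(k)=\lfloor k^\kappa\rfloor$ for all $k$, then with probability at least $1-\eta$ the regret of the phased algorithm satisfies, for all integers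 $N\ge2$, $$R(N)\le C'\Big(N^{\frac1{1+\kappa}}\big(\log(\eta^{-1})+\log N\big)^{2\kappa}+\log(\eta^{-1})^2\Big).$$ In particular, $C'$ does not depend on $\eta$ and $N$. -/

import Mathlib

open MeasureTheory ProbabilityTheory Set Filter Topology
open scoped NNReal ENNReal

noncomputable section

namespace Liquidation

/-! ### The space `L²([0,T])` and integral operators on it -/

/-- Lebesgue measure on `[0,T]`. -/
abbrev leb (T : ℝ) : Measure ℝ := volume.restrict (Icc 0 T)

/-- The Hilbert space `L²([0,T], ℝ)`. -/
abbrev L2 (T : ℝ) : Type := Lp ℝ 2 (leb T)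

open Classical in
/-- The class in `L²([0,T])` of a square-integrable function (and `0` for any other function). -/
def toL2 (T : ℝ) (f : ℝ → ℝ) : L2 T :=
  if h : MemLp f 2 (leb T) then h.toLp f else 0

open Classical in
/-- The bounded operator on `L²([0,T])` induced by the kernel `k`, that is
`(K f)(s) = ∫₀ᵀ k(s,u) f(u) du`. The lemma `integralOp_apply` shows that this formula holds
for every square-integrable kernel. -/
def integralOp (T : ℝ) (k : ℝ → ℝ → ℝ) : L2 T →L[ℝ] L2 T :=
  if h : ∃ K : L2 T →L[ℝ] L2 T, ∀ f : L2 T, K f =ᵐ[leb T] fun s => ∫ u, k s u * f u ∂(leb T)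
  then h.choose else 0

/-- A square-integrable kernel induces a bounded operator on `L²([0,T])`. -/
theorem exists_integralOp (T : ℝ) (k : ℝ → ℝ → ℝ)
    (hk : MemLp (Function.uncurry k) 2 ((leb T).prod (leb T))) :
    ∃ K : L2 T →L[ℝ] L2 T, ∀ f : L2 T, K f =ᵐ[leb T] fun s => ∫ u, k s u * f u ∂(leb T) := by
  have hm : AEStronglyMeasurable (Function.uncurry k) ((leb T).prod (leb T)) := hk.1
  have hsq : Integrable (fun z : ℝ × ℝ => k z.1 z.2 ^ 2) ((leb T).prod (leb T)) :=
    (memLp_two_iff_integrable_sq hm).1 hk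
  have hrow : ∀ᵐ s ∂(leb T), MemLp (k s) 2 (leb T) := by
    filter_upwards [hm.prodMk_left, hsq.prod_right_ae] with s h1 h2
    exact (memLp_two_iff_integrable_sq h1).2 h2
  have hint : Integrable (fun s => ∫ u, k s u ^ 2 ∂(leb T)) (leb T) := hsq.integral_prod_left
  have hNmem : MemLp (fun s => √(∫ u, k s u ^ 2 ∂(leb T))) 2 (leb T) := by
    refine (memLp_two_iff_integrable_sq
      (Real.continuous_sqrt.comp_aestronglyMeasurable hint.1)).2 (hint.congr ?_)
    filter_upwards with s
    rw [Real.sq_sqrt (integral_nonneg fun u => sq_nonneg _)]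
  have hbound : ∀ f : L2 T, ∀ᵐ s ∂(leb T),
      ‖∫ u, k s u * f u ∂(leb T)‖ ≤ ‖f‖ * ‖√(∫ u, k s u ^ 2 ∂(leb T))‖ := by
    intro f
    filter_upwards [hrow] with s hs
    have h1 : ∫ u, k s u * f u ∂(leb T) = inner ℝ (hs.toLp (k s)) f := by
      rw [L2.inner_def]
      refine integral_congr_ae ?_
      filter_upwards [hs.coeFn_toLp] with u hu
      rw [hu]; simp [mul_comm]
    have h2 : ‖hs.toLp (k s)‖ = √(∫ u, k s u ^ 2 ∂(leb T)) := by
      rw [norm_eq_sqrt_real_inner, L2.inner_def]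
      congr 1
      refine integral_congr_ae ?_
      filter_upwards [hs.coeFn_toLp] with u hu
      rw [hu]; simp [sq]
    rw [h1, Real.norm_of_nonneg (Real.sqrt_nonneg _), ← h2, mul_comm]
    exact norm_inner_le_norm _ _
  have hmeas : ∀ f : L2 T,
      AEStronglyMeasurable (fun s => ∫ u, k s u * f u ∂(leb T)) (leb T) := fun f =>
    (hm.mul ((Lp.aestronglyMeasurable f).comp_snd)).integral_prod_right'
  have hmem : ∀ f : L2 T, MemLp (fun s => ∫ u, k s u * f u ∂(leb T)) 2 (leb T) := fun f =>
    (hNmem.const_mul ‖f‖).of_le (hmeas f) <| by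
      filter_upwards [hbound f] with s hs
      rw [norm_mul, norm_norm]; exact hs
  have hprod : ∀ f : L2 T, ∀ᵐ s ∂(leb T), Integrable (fun u => k s u * f u) (leb T) := by
    intro f
    filter_upwards [hrow] with s hs
    exact hs.integrable_mul (Lp.memLp f)
  let K₀ : L2 T →ₗ[ℝ] L2 T :=
    { toFun := fun f => (hmem f).toLp _
      map_add' := by
        intro f g
        refine Lp.ext ?_
        filter_upwards [(hmem (f + g)).coeFn_toLp, (hmem f).coeFn_toLp, (hmem g).coeFn_toLp,
          Lp.coeFn_add ((hmem f).toLp _) ((hmem g).toLp _), hprod f, hprod g]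
          with s h1 h2 h3 h4 h5 h6
        rw [h1, h4, Pi.add_apply, h2, h3, ← integral_add h5 h6]
        refine integral_congr_ae ?_
        filter_upwards [Lp.coeFn_add f g] with u hu
        rw [hu, Pi.add_apply]; ring
      map_smul' := by
        intro a f
        refine Lp.ext ?_
        filter_upwards [(hmem (a • f)).coeFn_toLp, (hmem f).coeFn_toLp,
          Lp.coeFn_smul a ((hmem f).toLp _)] with s h1 h2 h3
        rw [h1, RingHom.id_apply, h3, Pi.smul_apply, h2, smul_eq_mul, ← integral_const_mul]
        refine integral_congr_ae ?_
        filter_upwards [Lp.coeFn_smul a f] with u hu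
        rw [hu, Pi.smul_apply, smul_eq_mul]; ring }
  refine ⟨K₀.mkContinuous ‖hNmem.toLp _‖ fun f => ?_, fun f => ?_⟩
  · rw [mul_comm]
    refine Lp.norm_le_mul_norm_of_ae_le_mul ?_
    filter_upwards [(hmem f).coeFn_toLp, hNmem.coeFn_toLp, hbound f] with s h1 h2 h3
    change ‖((hmem f).toLp _ : L2 T) s‖ ≤ _
    rw [h1, h2]; exact h3
  · exact (hmem f).coeFn_toLp

theorem integralOp_apply (T : ℝ) (k : ℝ → ℝ → ℝ)
    (hk : MemLp (Function.uncurry k) 2 ((leb T).prod (leb T))) (f : L2 T) :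
    integralOp T k f =ᵐ[leb T] fun s => ∫ u, k s u * f u ∂(leb T) := by
  have h := exists_integralOp T k hk
  unfold integralOp
  rw [dif_pos h]
  exact h.choose_spec f

/-! ### The constants of the problem, price impact parameters -/

/-- Horizon `T`, initial position `q`, running penalty `φ` and terminal penalty `ϱ`. -/
structure Constants where
  T : ℝ
  q : ℝ
  φ : ℝ
  ϱ : ℝ
  T_pos : 0 < T
  q_pos : 0 < q
  φ_nonneg : 0 ≤ φ
  ϱ_nonneg : 0 ≤ ϱ

/-- A price impact parameter `θ = (λ, G)`: temporary impact coefficient and propagator. -/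
abbrev Param (T : ℝ) : Type := ℝ × L2 T

/-- `∫₀ᵀ ∫₀ᵀ G(|t-s|) f(s) f(t) ds dt`. -/
def quadForm (T : ℝ) (G f : L2 T) : ℝ :=
  ∫ t, (∫ s, G |t - s| * f s * f t ∂(leb T)) ∂(leb T)

/-- The class `Ξ_ε` of admissible parameters (with bound `L`). -/
def admissibleParams (T L ε : ℝ) : Set (Param T) :=
  {θ | L⁻¹ ≤ θ.1 ∧ θ.1 ≤ L ∧ ‖θ.2‖ ≤ L ∧ ∀ f : L2 T, -ε * ‖f‖ ^ 2 ≤ quadForm T θ.2 f}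

/-! ### The explicit feedback form of the greedy strategy -/

section Greedy

variable (c : Constants) (θ : Param c.T)

/-- `G̃(t,s) = (2ϱ + G(t-s)) 1_{s<t}`. -/
def Gtilde (t s : ℝ) : ℝ := if s < t then 2 * c.ϱ + θ.2 (t - s) else 0

/-- The operator `G̃_t`, induced by the kernel `G̃(s,u) 1_{u ≥ t}`. -/
def GtildeOp (t : ℝ) : L2 c.T →L[ℝ] L2 c.T :=
  integralOp c.T fun s u => if t ≤ u then Gtilde c θ s u else 0

/-- The operator `1_t`, induced by the kernel `1_{u ≥ s} 1_{s ≥ t}` in the variables `(u,s)`. -/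
def oneOp (t : ℝ) : L2 c.T →L[ℝ] L2 c.T :=
  integralOp c.T fun u s => if s ≤ u ∧ t ≤ s then 1 else 0

/-- `D_t = 2λ id + (G̃_t + G̃_t^*) + 2φ 1_t^* 1_t`. -/
def Dop (t : ℝ) : L2 c.T →L[ℝ] L2 c.T :=
  (2 * θ.1) • ContinuousLinearMap.id ℝ (L2 c.T)
    + (GtildeOp c θ t + ContinuousLinearMap.adjoint (GtildeOp c θ t))
    + (2 * c.φ) • (ContinuousLinearMap.adjoint (oneOp c t) ∘L oneOp c t)

/-- The inverse of `D_t`. -/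
def Dinv (t : ℝ) : L2 c.T →L[ℝ] L2 c.T := Ring.inverse (Dop c θ t)

/-- The block operator `Γ_t⁻¹` on `L²([0,T], ℝ²)`, whose elements are written as pairs. -/
def gammaInv (t : ℝ) (x : L2 c.T × L2 c.T) : L2 c.T × L2 c.T :=
  let D := Dinv c θ t
  let I := oneOp c t
  let I' := ContinuousLinearMap.adjoint (oneOp c t)
  (D x.1 - (2 * c.φ) • D (I' x.2),
    -(2 * c.φ) • I (D x.1) - (2 * c.φ) • x.2 + (4 * c.φ ^ 2) • I (D (I' x.2)))

/-- The inner product of `L²([0,T], ℝ²)`. -/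
def pairInner {T : ℝ} (x y : L2 T × L2 T) : ℝ := inner ℝ x.1 y.1 + inner ℝ x.2 y.2

/-- The element `1_{[t,T]} · (f, g)ᵀ` of `L²([0,T], ℝ²)`. -/
def tailPair (T t : ℝ) (f g : ℝ → ℝ) : L2 T × L2 T :=
  (toL2 T ((Ici t).indicator f), toL2 T ((Ici t).indicator g))

/-- `K_t(s) = (G̃(s,t), -1_{t ≤ s})ᵀ`. -/
def Kvec (t : ℝ) : L2 c.T × L2 c.T :=
  tailPair c.T t (fun s => Gtilde c θ s t) (fun _ => -1)

/-- `Θ_t = -Γ_t⁻¹ (1_{[t,T]} z e₁)`, where `z` is the value of `E[A_· - A_T | 𝒢_t] ∈ L²([0,T])`. -/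
def ThetaVec (t : ℝ) (z : L2 c.T) : L2 c.T × L2 c.T :=
  -gammaInv c θ t (tailPair c.T t z (fun _ => 0))

/-- The inhomogeneity `a_t`, where `x` and `z` are the values of `E[A_t - A_T | 𝒢_t] ∈ ℝ` and of
`E[A_· - A_T | 𝒢_t] ∈ L²([0,T])`. -/
def aCoef (t x : ℝ) (z : L2 c.T) : ℝ :=
  1 / (2 * θ.1) * (x + 2 * c.ϱ * c.q + pairInner (ThetaVec c θ t z) (Kvec c θ t)
    + pairInner (gammaInv c θ t (Kvec c θ t))
        (tailPair c.T t (fun _ => -(2 * c.ϱ * c.q)) (fun _ => c.q)))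

/-- The Volterra kernel `B(t,s)`. -/
def Bcoef (t s : ℝ) : ℝ :=
  if s < t then
    1 / (2 * θ.1) * (pairInner (gammaInv c θ t (Kvec c θ t))
        (tailPair c.T t (fun r => Gtilde c θ r s) (fun _ => -1)) - Gtilde c θ t s)
  else 0

end Greedy

/-! ### Information and controls -/

section Information

variable {Ω : Type*} [MeasurableSpace Ω]

/-- The `σ`-algebra generated by the null events. -/
def nullSigma (P : Measure Ω) : MeasurableSpace Ω :=
  MeasurableSpace.generateFrom {s | MeasurableSet s ∧ P s = 0}

/-- `ℋ ∨ σ{A_s : s ∈ [0,t]}`. -/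
def withSignal (ℋ : MeasurableSpace Ω) (A : ℝ → Ω → ℝ) (t : ℝ) : MeasurableSpace Ω :=
  ℋ ⊔ ⨆ s ∈ Icc (0 : ℝ) t, MeasurableSpace.comap (A s) inferInstance

/-- Square-integrable controls on `[0,T]` that are progressively measurable for `(𝒢_t)`. -/
structure IsControl (T : ℝ) (P : Measure Ω) (𝒢 : ℝ → MeasurableSpace Ω) (u : ℝ → Ω → ℝ) :
    Prop where
  progressive : ∀ t ∈ Icc 0 T,
    @Measurable (Icc 0 t × Ω) ℝ (@Prod.instMeasurableSpace _ _ inferInstance (𝒢 t)) _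
      fun p => u p.1 p.2
  sq_integrable : ∫⁻ ω, ∫⁻ t, ‖u t ω‖ₑ ^ 2 ∂(leb T) ∂P < ∞

/-- On the event `E`, the control `u` is the greedy strategy `Greedy(A, θ)` of the (possibly
random) parameter `θ`: `u_t = a_t^θ + ∫₀ᵗ B^θ(t,s) u_s ds`, the conditional expectations in `a^θ`
being taken with respect to the information `(𝒢_t)`. As `u` is a process in `L²(dt ⊗ P)`, this is
required for almost every `t`, almost surely. -/
def IsGreedyOn (c : Constants) (P : Measure Ω) (𝒢 : ℝ → MeasurableSpace Ω) (A : ℝ → Ω → ℝ)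
    (θ : Ω → Param c.T) (E : Set Ω) (u : ℝ → Ω → ℝ) : Prop :=
  ∀ᵐ t ∂(leb c.T), ∀ᵐ ω ∂P, ω ∈ E →
    u t ω = aCoef c (θ ω) t
        ((P[fun ω' => A t ω' - A c.T ω' | 𝒢 t]) ω)
        ((P[fun ω' => toL2 c.T (fun s => A s ω' - A c.T ω') | 𝒢 t]) ω)
      + ∫ s in (0 : ℝ)..t, Bcoef c (θ ω) t s * u s ω

end Information

/-! ### Prices and the objective -/

section Objective

variable {Ω : Type*}

/-- The price `S_t = A_t + M_t - λ u_t - ∫₀ᵗ G(t-s) u_s ds`. -/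
def price {T : ℝ} (θ : Param T) (A M u : ℝ → Ω → ℝ) (t : ℝ) (ω : Ω) : ℝ :=
  A t ω + M t ω - θ.1 * u t ω - ∫ s in (0 : ℝ)..t, θ.2 (t - s) * u s ω

/-- The inventory `Q_t = q - ∫₀ᵗ u_s ds`. -/
def inventory (q : ℝ) (u : ℝ → Ω → ℝ) (t : ℝ) (ω : Ω) : ℝ :=
  q - ∫ s in (0 : ℝ)..t, u s ω

/-- The random payoff
`∫₀ᵀ S_t u_t dt + Q_T P_T - φ ∫₀ᵀ Q_t² dt - ϱ Q_T²`, with `P = A + M`. -/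
def payoff (c : Constants) (θ : Param c.T) (A M u : ℝ → Ω → ℝ) (ω : Ω) : ℝ :=
  (∫ t in (0 : ℝ)..c.T, price θ A M u t ω * u t ω)
    + inventory c.q u c.T ω * (A c.T ω + M c.T ω)
    - c.φ * (∫ t in (0 : ℝ)..c.T, inventory c.q u t ω ^ 2)
    - c.ϱ * inventory c.q u c.T ω ^ 2

end Objective

/-! ### The unaffected price and its independent copies -/

/-- Right-continuous with left limits on `[0,T]`. -/
def IsCadlagOn (T : ℝ) (x : ℝ → ℝ) : Prop :=
  (∀ t ∈ Ico 0 T, ContinuousWithinAt x (Ici t) t) ∧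
    ∀ t ∈ Ioc 0 T, ∃ l : ℝ, Tendsto x (𝓝[<] t) (𝓝 l)

/-- The unaffected price `P = A + M` on `[0,T]`, over a filtration satisfying the usual conditions
(processes on `[0,T]` are stopped at `T` to index them by `[0,∞)`): `A` is a predictable process of
square-integrable total variation, and `M` is an independent square-integrable martingale with
`E[M_0] = 0`. -/
structure IsPriceModel {Ω : Type*} [mΩ : MeasurableSpace Ω] (T : ℝ) (P : Measure Ω)
    (𝓕 : Filtration ℝ≥0 mΩ) (A M : ℝ → Ω → ℝ) : Prop where
  rightCont : 𝓕.IsRightContinuous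
  complete : ∀ s : Set Ω, P s = 0 → MeasurableSet[𝓕 0] s
  predictable : IsStronglyPredictable 𝓕 fun (t : ℝ≥0) ω => A (min (t : ℝ) T) ω
  martingale : Martingale (fun (t : ℝ≥0) ω => M (min (t : ℝ) T) ω) 𝓕 P
  cadlag_A : ∀ ω, IsCadlagOn T fun t => A t ω
  cadlag_M : ∀ ω, IsCadlagOn T fun t => M t ω
  indep : IndepFun (fun ω (t : Icc (0 : ℝ) T) => A t ω) (fun ω (t : Icc (0 : ℝ) T) => M t ω) P
  mean_M : ∫ ω, M 0 ω ∂P = 0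
  sq_M : MemLp (M T) 2 P
  sq_A : MemLp (A 0) 2 P
  variation_A : ∫⁻ ω, eVariationOn (fun t => A t ω) (Icc 0 T) ^ 2 ∂P < ∞

/-- `(A^m)_{m ≥ 1}` and `(M^m)_{m ≥ 1}` are mutually independent copies of the (independent)
processes `A₀` and `M₀`. (The processes with index `0` play no role.) -/
structure AreCopies {Ω₀ Ω : Type*} [MeasurableSpace Ω₀] [MeasurableSpace Ω] (T : ℝ)
    (P₀ : Measure Ω₀) (A₀ M₀ : ℝ → Ω₀ → ℝ) (P : Measure Ω) (A M : ℕ → ℝ → Ω → ℝ) : Prop where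
  meas_A : ∀ m, 1 ≤ m → ∀ t ∈ Icc 0 T, Measurable (A m t)
  meas_M : ∀ m, 1 ≤ m → ∀ t ∈ Icc 0 T, Measurable (M m t)
  cadlag_A : ∀ m, 1 ≤ m → ∀ ω, IsCadlagOn T fun t => A m t ω
  cadlag_M : ∀ m, 1 ≤ m → ∀ ω, IsCadlagOn T fun t => M m t ω
  law : ∀ m, 1 ≤ m → IdentDistrib (fun ω (t : Icc (0 : ℝ) T) => (A m t ω, M m t ω))
    (fun ω (t : Icc (0 : ℝ) T) => (A₀ t ω, M₀ t ω)) P P₀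
  indep : iIndepFun (fun (m : ℕ+) ω (t : Icc (0 : ℝ) T) => (A m t ω, M m t ω)) P

/-! ### The regularised least-squares estimator -/

/-- The exploration strategy: `u^e ∈ H¹([0,T])` and `u^e(0) ≠ 0`. -/
def IsExploration (T : ℝ) (ue : ℝ → ℝ) : Prop :=
  AbsolutelyContinuousOnInterval ue 0 T ∧ MemLp (deriv ue) 2 (leb T) ∧ ue 0 ≠ 0

/-- `p 0 < ⋯ < p N` is a partition of `[0,T]` into `N` intervals. -/
def IsPartition (T : ℝ) (N : ℕ) (p : ℕ → ℝ) : Prop :=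
  p 0 = 0 ∧ p N = T ∧ ∀ i < N, p i < p (i + 1)

/-- Functions that are piecewise constant on the partition `p 0 < ⋯ < p N`. -/
def piecewiseConst (T : ℝ) (N : ℕ) (p : ℕ → ℝ) : Set (L2 T) :=
  {f | ∃ v : ℕ → ℝ, f =ᵐ[leb T] fun t =>
    ∑ i ∈ Finset.range N, (Ico (p i) (p (i + 1))).indicator (fun _ => v i) t}

section LSE

variable (T : ℝ) (ue : ℝ → ℝ) (E : Finset ℕ) (S A : ℕ → ℝ → ℝ)

/-- The estimator of `λ` from the trajectories `(S^m, A^m)`, `m ∈ E`. -/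
def lseLambda : ℝ := -(1 / (E.card * ue 0)) * ∑ m ∈ E, (S m 0 - A m 0)

/-- The regularised empirical loss
`(1/|E|) ∑_{m ∈ E} ‖S^m - A^m + λ u^e + 𝐮^e G‖² + τ ‖G‖²`, where `λ` is the estimated one. -/
def lseLoss (τ : ℝ) (G : L2 T) : ℝ :=
  1 / (E.card : ℝ) * ∑ m ∈ E, (∫ t in (0 : ℝ)..T,
      (S m t - A m t + lseLambda ue E S A * ue t
        + ∫ s in (0 : ℝ)..t, ue (t - s) * G s) ^ 2)
    + τ * ‖G‖ ^ 2

/-- The estimator of `G`: the (unique) minimiser of the loss over the functions that are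
piecewise constant on the partition `p 0 < ⋯ < p |E|`. -/
def lseKernel (τ : ℝ) (p : ℕ → ℝ) : L2 T :=
  Classical.epsilon fun G => G ∈ piecewiseConst T E.card p ∧
    ∀ G' ∈ piecewiseConst T E.card p, lseLoss T ue E S A τ G ≤ lseLoss T ue E S A τ G'

/-- The least-squares estimator `LSE((S^m, A^m)_{m ∈ E}, τ, p)` of `(λ, G)`. -/
def lse (τ : ℝ) (p : ℕ → ℝ) : Param T := (lseLambda ue E S A, lseKernel T ue E S A τ p)

end LSE

/-! ### Episodic learning, the phased algorithm and its regret -/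

section Learning

variable {Ω : Type*} [MeasurableSpace Ω]

/-- The price of episode `m` under the controls `u`. -/
def episodePrice {T : ℝ} (θ : Param T) (A M u : ℕ → ℝ → Ω → ℝ) (m : ℕ) : ℝ → Ω → ℝ :=
  price θ (A m) (M m) (u m)

/-- The information `𝓕_m` available after `m` episodes. -/
def obsSigma {T : ℝ} (P : Measure Ω) (θ : Param T) (A M u : ℕ → ℝ → Ω → ℝ) :
    ℕ → MeasurableSpace Ω
  | 0 => nullSigma P
  | m + 1 => obsSigma P θ A M u m ⊔ ⨆ t ∈ Icc 0 T,
      (MeasurableSpace.comap (episodePrice θ A M u (m + 1) t) inferInstance ⊔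
        MeasurableSpace.comap (A (m + 1) t) inferInstance)

/-- The information `𝒢^m_t = 𝓕_{m-1} ∨ σ{A^m_s : s ∈ [0,t]}` available at time `t` of episode
`m ≥ 1`. -/
def episodeSigma {T : ℝ} (P : Measure Ω) (θ : Param T) (A M u : ℕ → ℝ → Ω → ℝ) (m : ℕ) (t : ℝ) :
    MeasurableSpace Ω :=
  withSignal (obsSigma P θ A M u (m - 1)) (A m) t

/-- `m₀ + ∑_{i=1}^k n(i) + k`, the last episode of the `k`-th cycle. -/
def cycleEnd (m₀ : ℕ) (n : ℕ → ℕ) (k : ℕ) : ℕ := m₀ + ∑ i ∈ Finset.Icc 1 k, n i + k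

/-- The exploration episodes up to the `k`-th cycle. -/
def explorationEpisodes (m₀ : ℕ) (n : ℕ → ℕ) (k : ℕ) : Finset ℕ :=
  Finset.Icc 1 m₀ ∪ (Finset.Icc 1 k).image (cycleEnd m₀ n)

/-- The estimate `θ^k` after the `k`-th cycle, computed from the exploration episodes. -/
def cycleEstimate {T : ℝ} (θ : Param T) (ue : ℝ → ℝ) (A M u : ℕ → ℝ → Ω → ℝ)
    (τ : ℕ → ℝ) (p : ℕ → ℕ → ℝ) (m₀ : ℕ) (n : ℕ → ℕ) (k : ℕ) (ω : Ω) : Param T :=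
  lse T ue (explorationEpisodes m₀ n k) (fun m t => episodePrice θ A M u m t ω)
    (fun m t => A m t ω) (τ (m₀ + k)) (p (m₀ + k))

/-- `u = (u^m)_{m ≥ 1}` are the controls executed by the phased algorithm when the true parameter
is `θ`: `u^e` in the exploration episodes, and `Greedy(A^m, θ^{k-1})` in the exploitation episodes
`m` of the `k`-th cycle. The greedy strategy is prescribed when the estimate lies in `Ξ_ε`;
otherwise the agent may use any admissible control. -/
structure IsPhasedRun (c : Constants) (P : Measure Ω) (θ : Param c.T) (L ε : ℝ) (ue : ℝ → ℝ)
    (A M : ℕ → ℝ → Ω → ℝ) (τ : ℕ → ℝ) (p : ℕ → ℕ → ℝ) (m₀ : ℕ) (n : ℕ → ℕ)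
    (u : ℕ → ℝ → Ω → ℝ) : Prop where
  control : ∀ m, 1 ≤ m → IsControl c.T P (episodeSigma P θ A M u m) (u m)
  explore : ∀ k, ∀ m ∈ explorationEpisodes m₀ n k, ∀ t ∈ Icc 0 c.T, ∀ ω, u m t ω = ue t
  exploit : ∀ k, 1 ≤ k → ∀ m, cycleEnd m₀ n (k - 1) < m → m ≤ cycleEnd m₀ n (k - 1) + n k →
    IsGreedyOn c P (episodeSigma P θ A M u m) (A m)
      (cycleEstimate θ ue A M u τ p m₀ n (k - 1))
      {ω | cycleEstimate θ ue A M u τ p m₀ n (k - 1) ω ∈ admissibleParams c.T L ε} (u m)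

/-- The regret `R(N) = ∑_{m=1}^N (Jopt - E[payoff of episode m | 𝓕_{m-1}])`. -/
def regret (c : Constants) (P : Measure Ω) (θ : Param c.T) (A M u : ℕ → ℝ → Ω → ℝ)
    (Jopt : ℝ) (N : ℕ) (ω : Ω) : ℝ :=
  ∑ m ∈ Finset.Icc 1 N,
    (Jopt - (P[payoff c θ (A m) (M m) (u m) | obsSigma P θ A M u (m - 1)]) ω)

end Learning

end Liquidation

end

open Liquidation

set_option linter.unusedSectionVars false

noncomputable section

namespace Liquidation

/-! ### Measurability in `L²([0,T])` -/

/-! Quadratic structure. Pathwise, the payoff of a trajectory `U` in `L²([0,T])` is, up to terms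
free of `U`, `⟨z + driftVec, U⟩ - ½⟨D U, U⟩`, where `z` is the path of the increments of the
unaffected price up to `T` and `D = Dop c θ 0` (`payoff_eq`). The operator `D` is symmetric,
Lipschitz in the parameter (`norm_Dop_sub_le`) and uniformly coercive on `Ξ_ε` (`Dop_coercive`), so
everything can be read off from a first-order condition.

First-order condition. The greedy strategy is given by a feedback formula and not as a maximiser, so
the condition has to be derived. Let `g = z_A + driftVec - D U` be the gradient without the noise.
The formula at time `t` says that the current gradient vanishes when the conditional expectation of
the future trajectory is replaced by a certain prediction. The prediction error is `-D_t⁻¹` applied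
to the restriction of `E[g | 𝒢_t]` to `[t,T]`. Hence `|E[g_t | 𝒢_t]|` is at most a constant times
the norm of that restriction (`abs_condGradient_le`), and a backward Gronwall argument gives `E[g_t
| 𝒢_t] = 0` for almost every `t` (`condExp_ev_eq_zero`).

Quadratic gap. Expand the payoff under the true parameter `θs` around the greedy trajectory `U` of
an estimate `θ`, in the direction of an adapted `V`. The noise and the gradient `g` drop out in
expectation, which leaves `⟨(D^θ - D^θs) U, V - U⟩ - ½⟨D^θs (V - U), V - U⟩`, and completing the
square bounds this by a constant times `‖θ - θs‖² ‖U‖²`. Testing the first-order condition with `U`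
itself bounds the second moment of `U`. The loss of an exploitation episode is therefore of second
order in the estimation error (`Setting.sub_condExp_payoff_le`, `AreCopies.exploitation_gap`).

Estimation. Under `u^e` the difference `S - A` is the noise minus a deterministic drift, so the
estimator is a measurable function of noise paths alone. These are i.i.d., so the estimates along
the exploration episodes have the same joint law as those from the episodes `1, …, N`, and the
assumed bound, simultaneous in `N`, carries over (`AreCopies.le_measure_cycleEstimate`). Taking `m₀`
of order `log(η⁻¹)² + 1` keeps every estimate inside a small ball around `θs` contained in `Ξ_ε`.

Summation. An exploitation episode that uses `m₀ + k` exploration episodes costs at most a multiple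
of `(log η⁻¹ + log N)^{2κ} (m₀ + k)^{-κ}`, and its cycle has `⌊(k+1)^κ⌋` of them. So a cycle costs a
multiple of `(log η⁻¹ + log N)^{2κ}` plus one exploration episode, and about `N^{1/(1+κ)}` cycles
are needed to reach episode `N` (`sum_regret_le`). -/

instance (T : ℝ) : MeasurableSpace (L2 T) := borel _

instance (T : ℝ) : BorelSpace (L2 T) := ⟨rfl⟩

instance (T : ℝ) : SecondCountableTopology (L2 T) :=
  haveI : Fact ((2 : ℝ≥0∞) ≠ ∞) := ⟨by norm_num⟩
  inferInstanceAs (SecondCountableTopology (Lp ℝ 2 (leb T)))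

theorem integrable_coe_L2 {T : ℝ} (x : L2 T) : Integrable x (leb T) :=
  (Lp.memLp x).integrable (by norm_num)

theorem toL2_of_memLp {T : ℝ} {f : ℝ → ℝ} (h : MemLp f 2 (leb T)) : toL2 T f = h.toLp f :=
  dif_pos h

theorem coeFn_toL2 {T : ℝ} {f : ℝ → ℝ} (h : MemLp f 2 (leb T)) : toL2 T f =ᵐ[leb T] f := by
  rw [toL2_of_memLp h]; exact h.coeFn_toLp

theorem toL2_congr {T : ℝ} {f g : ℝ → ℝ} (h : f =ᵐ[leb T] g) : toL2 T f = toL2 T g := by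
  by_cases hf : MemLp f 2 (leb T)
  · rw [toL2_of_memLp hf, toL2_of_memLp (hf.ae_eq h), MemLp.toLp_eq_toLp_iff]; exact h
  · rw [toL2, toL2, dif_neg hf, dif_neg fun hg => hf (hg.ae_eq h.symm)]

theorem toL2_coe {T : ℝ} (x : L2 T) : toL2 T x = x := by
  rw [toL2_of_memLp (Lp.memLp x), Lp.toLp_coeFn]

theorem ae_leb {T : ℝ} {q : ℝ → Prop} (h : ∀ t ∈ Icc 0 T, q t) : ∀ᵐ t ∂(leb T), q t :=
  (ae_restrict_iff' measurableSet_Icc).2 (Eventually.of_forall h)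

theorem ae_leb_mem (T : ℝ) : ∀ᵐ t ∂(leb T), t ∈ Icc 0 T := ae_restrict_mem measurableSet_Icc

theorem inner_L2_eq {T : ℝ} (x y : L2 T) : inner ℝ x y = ∫ t, x t * y t ∂(leb T) := by
  rw [L2.inner_def]
  exact integral_congr_ae (Eventually.of_forall fun t => by simp [mul_comm])

theorem integrable_mul_L2 {T : ℝ} (x y : L2 T) : Integrable (fun t => x t * y t) (leb T) :=
  (Lp.memLp x).integrable_mul (Lp.memLp y)

theorem norm_sq_L2_eq {T : ℝ} (x : L2 T) : ‖x‖ ^ 2 = ∫ t, x t ^ 2 ∂(leb T) := by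
  rw [← real_inner_self_eq_norm_sq, inner_L2_eq]
  simp only [sq]

/-- In a second countable space an open set is a countable union of balls, and preimages of balls
are sublevel sets of the distance functions. -/
theorem measurable_of_measurable_dist {α X : Type*} [MeasurableSpace α] [PseudoMetricSpace X]
    [SecondCountableTopology X] [MeasurableSpace X] [BorelSpace X] {f : α → X}
    (h : ∀ y, Measurable fun a => dist (f a) y) : Measurable f := by
  refine measurable_of_isOpen fun U hU => ?_
  have hr : ∀ y : U, ∃ r > 0, Metric.ball (y : X) r ⊆ U := fun y =>
    Metric.isOpen_iff.1 hU y y.2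
  choose r hr0 hr using hr
  obtain ⟨S, hS, hSU⟩ := TopologicalSpace.isOpen_iUnion_countable
    (fun y : U => Metric.ball (y : X) (r y)) fun _ => Metric.isOpen_ball
  have hU' : U = ⋃ y ∈ S, Metric.ball (y : X) (r y) := by
    rw [hSU]
    refine Subset.antisymm (fun y hy => mem_iUnion.2 ⟨⟨y, hy⟩, Metric.mem_ball_self (hr0 _)⟩) ?_
    exact iUnion_subset hr
  rw [hU', preimage_iUnion₂]
  exact MeasurableSet.biUnion hS fun y _ => measurableSet_lt (h y) measurable_const

theorem memLp_two_iff_lintegral {T : ℝ} {f : ℝ → ℝ} (hf : AEStronglyMeasurable f (leb T)) :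
    MemLp f 2 (leb T) ↔ ∫⁻ t, ‖f t‖ₑ ^ 2 ∂(leb T) < ∞ := by
  rw [MemLp, and_iff_right hf, eLpNorm_lt_top_iff_lintegral_rpow_enorm_lt_top (by norm_num)
    (by norm_num)]
  simp

/-- The distance to a fixed `y` is the `L²` norm of `f a - y`, measurable in `a` by Tonelli. Where
`f a` is not square integrable the class is the default value `0`, so the set of such `a` has to be
measurable as well. -/
theorem measurable_toL2 {T : ℝ} {α : Type*} [MeasurableSpace α] {f : α → ℝ → ℝ}
    (hf : Measurable (Function.uncurry f)) : Measurable fun a => toL2 T (f a) := by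
  have hfa : ∀ a, Measurable (f a) := fun a => hf.of_uncurry_left
  have hS : MeasurableSet {a | MemLp (f a) 2 (leb T)} := by
    simp_rw [memLp_two_iff_lintegral (hfa _).aestronglyMeasurable]
    refine measurableSet_lt ?_ measurable_const
    exact Measurable.lintegral_prod_right' (f := fun z : α × ℝ => ‖f z.1 z.2‖ₑ ^ 2)
      (hf.enorm.pow_const 2)
  refine measurable_of_measurable_dist fun y => ?_
  classical
  have : (fun a => dist (toL2 T (f a)) y) = fun a => if MemLp (f a) 2 (leb T) then
      ((∫⁻ t, ‖f a t - y t‖ₑ ^ (2 : ℝ) ∂(leb T)) ^ (1 / (2 : ℝ))).toReal else dist 0 y := by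
    ext a
    split_ifs with h
    · rw [toL2_of_memLp h, Lp.dist_def, eLpNorm_eq_lintegral_rpow_enorm_toReal (by norm_num)
        (by norm_num)]
      simp only [ENNReal.toReal_ofNat]
      congr 2
      refine lintegral_congr_ae ?_
      filter_upwards [h.coeFn_toLp] with t ht
      rw [Pi.sub_apply, ht]
    · rw [toL2, dif_neg h]
  rw [this]
  refine Measurable.ite hS ?_ measurable_const
  refine ((Measurable.lintegral_prod_right'
    (f := fun z : α × ℝ => ‖f z.1 z.2 - y z.2‖ₑ ^ (2 : ℝ)) ?_).pow_const _).ennreal_toReal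
  exact (hf.sub ((Lp.stronglyMeasurable y).measurable.comp measurable_snd)).enorm.pow_const _

/-- A Carathéodory function: continuous in the upper limit, and for a fixed limit a difference of
inner products with indicators, hence continuous in `x`. -/
theorem measurable_primitive_L2 (T : ℝ) :
    Measurable fun z : L2 T × ℝ => ∫ s in (0 : ℝ)..z.2, z.1 s ∂(leb T) := by
  have h := measurable_uncurry_of_continuous_of_measurable (m := inferInstanceAs (MeasurableSpace (L2 T)))
    (u := fun (t : ℝ) (x : L2 T) => ∫ s in (0 : ℝ)..t, x s ∂(leb T)) (fun x => ?_) (fun t => ?_)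
  · exact h.comp measurable_swap
  · exact intervalIntegral.continuous_primitive
      (fun a b => (integrable_coe_L2 x).intervalIntegrable) 0
  · have hset : ∀ s : Set ℝ, MeasurableSet s → Measurable fun x : L2 T => ∫ r in s, x r ∂(leb T) := by
      intro s hs
      have : (fun x : L2 T => ∫ r in s, x r ∂(leb T)) = fun x =>
          inner ℝ (indicatorConstLp 2 hs (measure_ne_top (leb T) s) (1 : ℝ)) x := by
        ext x; rw [L2.inner_indicatorConstLp_one]
      rw [this]
      exact (continuous_const.inner continuous_id).measurable
    simp only [intervalIntegral]
    exact (hset _ measurableSet_Ioc).sub (hset _ measurableSet_Ioc)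

/-- A jointly measurable evaluation map on `L²([0,T])`. -/
@[irreducible] def ev {T : ℝ} (x : L2 T) (t : ℝ) : ℝ :=
  limsup (fun n : ℕ => ((n : ℝ) + 1) * ((∫ s in (0 : ℝ)..(t + 1 / ((n : ℝ) + 1)), x s ∂(leb T)) -
    ∫ s in (0 : ℝ)..t, x s ∂(leb T))) atTop

theorem measurable_ev (T : ℝ) : Measurable fun z : L2 T × ℝ => ev z.1 z.2 := by
  unfold ev
  refine Measurable.limsup fun n => ?_
  refine Measurable.const_mul (Measurable.sub ?_ (measurable_primitive_L2 T)) _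
  exact (measurable_primitive_L2 T).comp
    (measurable_fst.prodMk (measurable_snd.add_const _))

theorem measurable_ev_comp {T : ℝ} {α : Type*} [MeasurableSpace α] {x : α → L2 T} {t : α → ℝ}
    (hx : Measurable x) (ht : Measurable t) : Measurable fun a => ev (x a) (t a) :=
  (measurable_ev T).comp (hx.prodMk ht)

/-- Lebesgue differentiation: the difference quotients of the primitive with step `1/(n+1)` converge
almost everywhere. The point of `ev` is joint measurability, which arbitrary representatives of
classes lack and which is needed to exchange "for almost every `t`" with "almost surely". -/
theorem ev_ae_eq {T : ℝ} (x : L2 T) : ev x =ᵐ[leb T] x := by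
  have hint : Integrable ((Icc 0 T).indicator x) :=
    (integrable_indicator_iff measurableSet_Icc).2 (integrable_coe_L2 x)
  have hd := LocallyIntegrable.ae_hasDerivAt_integral hint.locallyIntegrable
  filter_upwards [ae_restrict_of_ae hd, ae_leb_mem T] with t ht htm
  have h1 : ∀ b, ∫ s in (0 : ℝ)..b, x s ∂(leb T) = ∫ s in (0 : ℝ)..b, (Icc 0 T).indicator x s := by
    intro b
    simp only [intervalIntegral, leb]
    rw [Measure.restrict_restrict measurableSet_Ioc, Measure.restrict_restrict measurableSet_Ioc,
      setIntegral_indicator measurableSet_Icc, setIntegral_indicator measurableSet_Icc]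
  have h2 := ht 0
  rw [indicator_of_mem htm] at h2
  have h3 := h2.tendsto_slope_zero_right
  have h4 : Tendsto (fun n : ℕ => 1 / ((n : ℝ) + 1)) atTop (𝓝[>] 0) :=
    tendsto_nhdsWithin_iff.2 ⟨tendsto_one_div_add_atTop_nhds_zero_nat,
      Eventually.of_forall fun n => by simp only [mem_Ioi]; positivity⟩
  have h5 := h3.comp h4
  rw [ev]
  simp_rw [h1]
  refine Tendsto.limsup_eq (h5.congr fun n => ?_)
  simp

theorem ev_ae_eq_of_eq {T : ℝ} {f : ℝ → ℝ} (h : MemLp f 2 (leb T)) :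
    ev (toL2 T f) =ᵐ[leb T] f := (ev_ae_eq _).trans (coeFn_toL2 h)

theorem memLp_ev {T : ℝ} (x : L2 T) : MemLp (ev x) 2 (leb T) :=
  (Lp.memLp x).ae_eq (ev_ae_eq x).symm

theorem measurable_ev_left {T : ℝ} (x : L2 T) : Measurable (ev x) :=
  measurable_ev_comp measurable_const measurable_id

end Liquidation

namespace Liquidation

/-! ### Integral operators -/

theorem sq_integral_mul_le {α : Type*} [MeasurableSpace α] {μ : Measure α} {f g : α → ℝ}
    (hf : MemLp f 2 μ) (hg : MemLp g 2 μ) :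
    (∫ a, f a * g a ∂μ) ^ 2 ≤ (∫ a, f a ^ 2 ∂μ) * ∫ a, g a ^ 2 ∂μ := by
  have key : ∀ {f g : α → ℝ} (hf : MemLp f 2 μ) (hg : MemLp g 2 μ),
      ∫ a, f a * g a ∂μ = inner ℝ (hf.toLp f) (hg.toLp g) := by
    intro f g hf hg
    rw [L2.inner_def]
    refine integral_congr_ae ?_
    filter_upwards [hf.coeFn_toLp, hg.coeFn_toLp] with a h1 h2
    rw [h1, h2]; simp [mul_comm]
  simp_rw [sq (f _), sq (g _)]
  rw [key hf hg, key hf hf, key hg hg, sq]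
  exact real_inner_mul_inner_self_le _ _

theorem memLp_two_of_lintegral {α : Type*} [MeasurableSpace α] {μ : Measure α} {f : α → ℝ}
    (hf : AEStronglyMeasurable f μ) (h : ∫⁻ t, ‖f t‖ₑ ^ 2 ∂μ < ∞) : MemLp f 2 μ := by
  rw [MemLp, and_iff_right hf, eLpNorm_lt_top_iff_lintegral_rpow_enorm_lt_top (by norm_num)
    (by norm_num)]
  simpa using h

theorem lintegral_sq_lt_top {α : Type*} [MeasurableSpace α] {μ : Measure α} {f : α → ℝ}
    (h : MemLp f 2 μ) : ∫⁻ t, ‖f t‖ₑ ^ 2 ∂μ < ∞ := by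
  have := (eLpNorm_lt_top_iff_lintegral_rpow_enorm_lt_top (f := f) (μ := μ) (p := 2) (by norm_num)
    (by norm_num)).1 h.2
  simpa using this

theorem integral_sq_eq_toReal_lintegral {α : Type*} [MeasurableSpace α] {μ : Measure α} {f : α → ℝ}
    (h : AEStronglyMeasurable f μ) : ∫ t, f t ^ 2 ∂μ = (∫⁻ t, ‖f t‖ₑ ^ 2 ∂μ).toReal := by
  rw [integral_eq_lintegral_of_nonneg_ae (Eventually.of_forall fun t => sq_nonneg _)
    ((continuous_pow 2).comp_aestronglyMeasurable h)]
  congr 2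
  ext t
  rw [Real.enorm_eq_ofReal_abs, ← ENNReal.ofReal_pow (abs_nonneg _), sq_abs]

variable {T : ℝ}

theorem memLp_kernel_row {k : ℝ → ℝ → ℝ}
    (hk : MemLp (Function.uncurry k) 2 ((leb T).prod (leb T))) :
    ∀ᵐ s ∂(leb T), MemLp (k s) 2 (leb T) := by
  have hsq : Integrable (fun z : ℝ × ℝ => k z.1 z.2 ^ 2) ((leb T).prod (leb T)) :=
    (memLp_two_iff_integrable_sq hk.1).1 hk
  filter_upwards [hk.1.prodMk_left, hsq.prod_right_ae] with s h1 h2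
  exact (memLp_two_iff_integrable_sq h1).2 h2

/-- The Hilbert–Schmidt bound: Cauchy–Schwarz in each row of the kernel. -/
theorem norm_le_of_kernel {k : ℝ → ℝ → ℝ}
    (hk : MemLp (Function.uncurry k) 2 ((leb T).prod (leb T))) {K : L2 T →L[ℝ] L2 T}
    (hK : ∀ f : L2 T, K f =ᵐ[leb T] fun s => ∫ u, k s u * f u ∂(leb T)) {M : ℝ} (hM : 0 ≤ M)
    (hkM : ∫ z, (k z.1 z.2) ^ 2 ∂((leb T).prod (leb T)) ≤ M ^ 2) : ‖K‖ ≤ M := by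
  refine K.opNorm_le_bound hM fun f => ?_
  refine abs_le_of_sq_le_sq' ?_ (by positivity) |>.2
  have hsq : Integrable (fun z : ℝ × ℝ => k z.1 z.2 ^ 2) ((leb T).prod (leb T)) :=
    (memLp_two_iff_integrable_sq hk.1).1 hk
  calc ‖K f‖ ^ 2 = ∫ s, (K f s) ^ 2 ∂(leb T) := norm_sq_L2_eq _
    _ ≤ ∫ s, (∫ u, k s u ^ 2 ∂(leb T)) * ‖f‖ ^ 2 ∂(leb T) := by
        refine integral_mono_ae ((memLp_two_iff_integrable_sq (Lp.aestronglyMeasurable _)).1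
          (Lp.memLp _)) (hsq.integral_prod_left.mul_const _) ?_
        filter_upwards [hK f, memLp_kernel_row hk] with s h1 h2
        rw [h1, norm_sq_L2_eq]
        exact sq_integral_mul_le h2 (Lp.memLp f)
    _ = (∫ z, (k z.1 z.2) ^ 2 ∂((leb T).prod (leb T))) * ‖f‖ ^ 2 := by
        rw [integral_mul_const, integral_prod _ hsq]
    _ ≤ (M * ‖f‖) ^ 2 := by rw [mul_pow]; gcongr

theorem memLp_tensor (x y : L2 T) :
    MemLp (fun z : ℝ × ℝ => x z.1 * y z.2) 2 ((leb T).prod (leb T)) := by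
  have hx := (memLp_two_iff_integrable_sq (Lp.aestronglyMeasurable x)).1 (Lp.memLp x)
  have hy := (memLp_two_iff_integrable_sq (Lp.aestronglyMeasurable y)).1 (Lp.memLp y)
  refine (memLp_two_iff_integrable_sq ?_).2 ?_
  · exact (Lp.aestronglyMeasurable x).comp_fst.mul (Lp.aestronglyMeasurable y).comp_snd
  · refine (hx.mul_prod hy).congr (Eventually.of_forall fun z => ?_)
    ring

theorem integrable_kernel_mul {k : ℝ → ℝ → ℝ}
    (hk : MemLp (Function.uncurry k) 2 ((leb T).prod (leb T))) (x y : L2 T) :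
    Integrable (fun z : ℝ × ℝ => k z.1 z.2 * y z.2 * x z.1) ((leb T).prod (leb T)) := by
  refine (hk.integrable_mul (memLp_tensor x y)).congr (Eventually.of_forall fun z => ?_)
  simp only [Pi.mul_apply, Function.uncurry]; ring

theorem inner_integralOp {k : ℝ → ℝ → ℝ}
    (hk : MemLp (Function.uncurry k) 2 ((leb T).prod (leb T))) (x y : L2 T) :
    inner ℝ (integralOp T k y) x = ∫ s, ∫ u, k s u * y u * x s ∂(leb T) ∂(leb T) := by
  rw [inner_L2_eq]
  refine integral_congr_ae ?_
  filter_upwards [integralOp_apply T k hk y] with s hs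
  rw [hs, integral_mul_const]

theorem memLp_swap {k : ℝ → ℝ → ℝ}
    (hk : MemLp (Function.uncurry k) 2 ((leb T).prod (leb T))) :
    MemLp (Function.uncurry fun s u => k u s) 2 ((leb T).prod (leb T)) :=
  hk.comp_measurePreserving Measure.measurePreserving_swap

theorem adjoint_integralOp {k : ℝ → ℝ → ℝ}
    (hk : MemLp (Function.uncurry k) 2 ((leb T).prod (leb T))) :
    ContinuousLinearMap.adjoint (integralOp T k) = integralOp T fun s u => k u s := by
  symm
  rw [ContinuousLinearMap.eq_adjoint_iff]
  intro x y
  rw [inner_integralOp (memLp_swap hk), real_inner_comm, inner_integralOp hk,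
    integral_integral_swap (integrable_kernel_mul (memLp_swap hk) y x)]
  refine integral_congr_ae (Eventually.of_forall fun s => ?_)
  refine integral_congr_ae (Eventually.of_forall fun u => ?_)
  ring

theorem lintegral_translate_left_le {f : ℝ → ℝ≥0∞} {s : ℝ} (hs : s ≤ T) :
    ∫⁻ u, (if u < s then f (s - u) else 0) ∂(leb T) ≤ ∫⁻ t, f t ∂(leb T) := by
  rw [← lintegral_indicator measurableSet_Icc, ← lintegral_indicator measurableSet_Icc,
    ← lintegral_sub_left_eq_self ((Icc 0 T).indicator fun t => f t) s]
  refine lintegral_mono fun u => ?_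
  by_cases hu : u ∈ Icc 0 T
  · rw [indicator_of_mem hu]
    split_ifs with h
    · rw [indicator_of_mem]
      constructor <;> linarith [hu.1]
    · exact zero_le
  · rw [indicator_of_notMem hu]; exact zero_le

theorem lintegral_translate_right_le {f : ℝ → ℝ≥0∞} {s : ℝ} (hs : 0 ≤ s) :
    ∫⁻ u, (if s < u then f (u - s) else 0) ∂(leb T) ≤ ∫⁻ t, f t ∂(leb T) := by
  rw [← lintegral_indicator measurableSet_Icc, ← lintegral_indicator measurableSet_Icc,
    ← lintegral_sub_right_eq_self ((Icc 0 T).indicator fun t => f t) s]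
  refine lintegral_mono fun u => ?_
  by_cases hu : u ∈ Icc 0 T
  · rw [indicator_of_mem hu]
    split_ifs with h
    · rw [indicator_of_mem]
      constructor <;> linarith [hu.2]
    · exact zero_le
  · rw [indicator_of_notMem hu]; exact zero_le

theorem enorm_ite_sq {q : Prop} [Decidable q] (a : ℝ) :
    ‖if q then a else 0‖ₑ ^ 2 = if q then ‖a‖ₑ ^ 2 else 0 := by
  split_ifs <;> simp

theorem measurable_convKernel {f : ℝ → ℝ} (hf : Measurable f) :
    Measurable (Function.uncurry fun s u : ℝ => if u < s then f (s - u) else 0) :=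
  Measurable.ite (measurableSet_lt measurable_snd measurable_fst)
    (hf.comp (measurable_fst.sub measurable_snd)) measurable_const

/-- Each row is a reflected translate of `f` cut to a subinterval of `[0,T]`, so its norm is at most
that of `f`. Integrating over the rows produces the factor `T`. -/
theorem lintegral_convKernel_le {f : ℝ → ℝ} (hf : Measurable f) :
    ∫⁻ z : ℝ × ℝ, ‖if z.2 < z.1 then f (z.1 - z.2) else 0‖ₑ ^ 2 ∂((leb T).prod (leb T)) ≤
      ENNReal.ofReal T * ∫⁻ t, ‖f t‖ₑ ^ 2 ∂(leb T) := by
  have hm := ((measurable_convKernel hf).enorm.pow_const 2).aemeasurable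
    (μ := (leb T).prod (leb T))
  simp only [Function.uncurry] at hm
  rw [lintegral_prod _ hm]
  calc _ ≤ ∫⁻ _, (∫⁻ t, ‖f t‖ₑ ^ 2 ∂(leb T)) ∂(leb T) := by
        refine lintegral_mono_ae ?_
        filter_upwards [ae_leb_mem T] with s hs
        simp_rw [enorm_ite_sq]
        exact lintegral_translate_left_le (f := fun t => ‖f t‖ₑ ^ 2) hs.2
    _ = _ := by
        rw [lintegral_const, mul_comm]
        simp [leb]

theorem memLp_convKernel {f : ℝ → ℝ} (hf : Measurable f) (hf2 : MemLp f 2 (leb T)) :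
    MemLp (Function.uncurry fun s u => if u < s then f (s - u) else 0) 2
        ((leb T).prod (leb T)) :=
  memLp_two_of_lintegral (measurable_convKernel hf).aestronglyMeasurable
    ((lintegral_convKernel_le hf).trans_lt
      (ENNReal.mul_lt_top ENNReal.ofReal_lt_top (lintegral_sq_lt_top hf2)))

theorem integral_sq_convKernel_le {f : ℝ → ℝ} (hf : Measurable f) (hf2 : MemLp f 2 (leb T))
    (hT : 0 ≤ T) :
    ∫ z : ℝ × ℝ, (if z.2 < z.1 then f (z.1 - z.2) else 0) ^ 2 ∂((leb T).prod (leb T)) ≤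
      T * ∫ t, f t ^ 2 ∂(leb T) := by
  have h1 := integral_sq_eq_toReal_lintegral (μ := (leb T).prod (leb T))
    (measurable_convKernel hf).aestronglyMeasurable
  simp only [Function.uncurry] at h1
  rw [h1, integral_sq_eq_toReal_lintegral hf.aestronglyMeasurable]
  refine (ENNReal.toReal_mono ?_ (lintegral_convKernel_le hf)).trans ?_
  · exact ENNReal.mul_ne_top ENNReal.ofReal_ne_top (lintegral_sq_lt_top hf2).ne
  · rw [ENNReal.toReal_mul, ENNReal.toReal_ofReal hT]

theorem memLp_translate_right {f : ℝ → ℝ} (hf : Measurable f) (hf2 : MemLp f 2 (leb T)) {s : ℝ}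
    (hs : 0 ≤ s) : MemLp (fun u => if s < u then f (u - s) else 0) 2 (leb T) := by
  refine memLp_two_of_lintegral ?_ (lt_of_le_of_lt ?_ (lintegral_sq_lt_top hf2))
  · exact (Measurable.ite (measurableSet_lt measurable_const measurable_id)
      (hf.comp (measurable_id.sub_const s)) measurable_const).aestronglyMeasurable
  · simp_rw [enorm_ite_sq]
    exact lintegral_translate_right_le (f := fun t => ‖f t‖ₑ ^ 2) hs

theorem memLp_translate_left {f : ℝ → ℝ} (hf : Measurable f) (hf2 : MemLp f 2 (leb T)) {s : ℝ}
    (hs : s ≤ T) : MemLp (fun u => if u < s then f (s - u) else 0) 2 (leb T) := by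
  refine memLp_two_of_lintegral ?_ (lt_of_le_of_lt ?_ (lintegral_sq_lt_top hf2))
  · exact (Measurable.ite (measurableSet_lt measurable_id measurable_const)
      (hf.comp (measurable_const.sub measurable_id)) measurable_const).aestronglyMeasurable
  · simp_rw [enorm_ite_sq]
    exact lintegral_translate_left_le (f := fun t => ‖f t‖ₑ ^ 2) hs

theorem integral_sq_translate_right_le {f : ℝ → ℝ} (hf : Measurable f) (hf2 : MemLp f 2 (leb T))
    {s : ℝ} (hs : 0 ≤ s) :
    ∫ u, (if s < u then f (u - s) else 0) ^ 2 ∂(leb T) ≤ ∫ t, f t ^ 2 ∂(leb T) := by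
  rw [integral_sq_eq_toReal_lintegral (memLp_translate_right hf hf2 hs).1,
    integral_sq_eq_toReal_lintegral hf.aestronglyMeasurable]
  refine ENNReal.toReal_mono (lintegral_sq_lt_top hf2).ne ?_
  simp_rw [enorm_ite_sq]
  exact lintegral_translate_right_le (f := fun t => ‖f t‖ₑ ^ 2) hs

/-! ### Truncation to `[t,T]` -/

theorem exists_chi (T t : ℝ) : ∃ K : L2 T →L[ℝ] L2 T, ∀ x : L2 T,
    K x =ᵐ[leb T] (Ici t).indicator x := by
  have hm : ∀ x : L2 T, MemLp ((Ici t).indicator x) 2 (leb T) := fun x =>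
    (Lp.memLp x).indicator measurableSet_Ici
  let K₀ : L2 T →ₗ[ℝ] L2 T :=
    { toFun := fun x => toL2 T ((Ici t).indicator x)
      map_add' := fun x y => by
        refine Lp.ext ?_
        filter_upwards [coeFn_toL2 (hm x), coeFn_toL2 (hm y), coeFn_toL2 (hm (x + y)),
          Lp.coeFn_add x y, Lp.coeFn_add (toL2 T ((Ici t).indicator x))
            (toL2 T ((Ici t).indicator y))] with s h1 h2 h3 h4 h5
        rw [h5, Pi.add_apply, h1, h2, h3, indicator, indicator, indicator, h4, Pi.add_apply]
        split_ifs <;> simp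
      map_smul' := fun a x => by
        refine Lp.ext ?_
        filter_upwards [coeFn_toL2 (hm x), coeFn_toL2 (hm (a • x)),
          Lp.coeFn_smul a x, Lp.coeFn_smul a (toL2 T ((Ici t).indicator x))] with s h1 h2 h3 h4
        rw [RingHom.id_apply, h4, Pi.smul_apply, h1, h2, indicator, indicator, h3, Pi.smul_apply]
        split_ifs <;> simp }
  refine ⟨K₀.mkContinuous 1 fun x => ?_, fun x => coeFn_toL2 (hm x)⟩
  rw [one_mul]
  refine Lp.norm_le_norm_of_ae_le ?_
  filter_upwards [coeFn_toL2 (hm x)] with s hs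
  change ‖(toL2 T ((Ici t).indicator x)) s‖ ≤ _
  rw [hs]
  exact norm_indicator_le_norm_self _ _

/-- Multiplication by the indicator of `[t,∞)` on `L²([0,T])`. -/
def chi (T t : ℝ) : L2 T →L[ℝ] L2 T := (exists_chi T t).choose

theorem chi_coe (t : ℝ) (x : L2 T) : chi T t x =ᵐ[leb T] (Ici t).indicator x :=
  (exists_chi T t).choose_spec x

theorem chi_norm_le (t : ℝ) (x : L2 T) : ‖chi T t x‖ ≤ ‖x‖ := by
  refine Lp.norm_le_norm_of_ae_le ?_
  filter_upwards [chi_coe t x] with s hs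
  rw [hs]
  exact norm_indicator_le_norm_self _ _

theorem toL2_indicator_Ici {f : ℝ → ℝ} (hf : MemLp f 2 (leb T)) (t : ℝ) :
    toL2 T ((Ici t).indicator f) = chi T t (toL2 T f) := by
  refine Lp.ext ?_
  filter_upwards [coeFn_toL2 (hf.indicator (measurableSet_Ici (a := t))), chi_coe t (toL2 T f),
    coeFn_toL2 hf] with s h1 h2 h3
  rw [h1, h2, indicator, indicator, h3]

theorem inner_chi_left (t : ℝ) (x y : L2 T) : inner ℝ (chi T t x) y = inner ℝ x (chi T t y) := by
  rw [inner_L2_eq, inner_L2_eq]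
  refine integral_congr_ae ?_
  filter_upwards [chi_coe t x, chi_coe t y] with s h1 h2
  rw [h1, h2, indicator, indicator]
  split_ifs <;> simp

theorem chi_chi_of_le {s t : ℝ} (h : s ≤ t) (x : L2 T) : chi T s (chi T t x) = chi T t x := by
  refine Lp.ext ?_
  filter_upwards [chi_coe s (chi T t x), chi_coe t x] with r h1 h2
  rw [h1, h2, indicator, indicator, h2, indicator]
  split_ifs with h3 h4 h4
  · rfl
  · rfl
  · exact absurd (h.trans h4) h3
  · rfl

theorem chi_idem (t : ℝ) (x : L2 T) : chi T t (chi T t x) = chi T t x := chi_chi_of_le le_rfl x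

theorem coe_sub_chi (t : ℝ) (x : L2 T) :
    (x - chi T t x : L2 T) =ᵐ[leb T] fun s => if s < t then x s else 0 := by
  filter_upwards [Lp.coeFn_sub x (chi T t x), chi_coe t x] with s h1 h2
  rw [h1, Pi.sub_apply, h2, indicator]
  by_cases h : s < t
  · simp [h, not_le.2 h]
  · simp [h, not_lt.1 h]

theorem eq_chi_of_ae {t : ℝ} {x : L2 T} (h : ∀ᵐ s ∂(leb T), s < t → x s = 0) :
    chi T t x = x := by
  refine Lp.ext ?_
  filter_upwards [chi_coe t x, h] with s h1 h2
  rw [h1, indicator]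
  split_ifs with h3
  · rfl
  · exact (h2 (not_le.1 h3)).symm

end Liquidation

namespace Liquidation

/-! ### The operators of the liquidation problem -/

theorem ae_ne_leb (T t : ℝ) : ∀ᵐ s ∂(leb T), s ≠ t := by
  rw [ae_iff]; simp

/-- Symmetrisation: a causal kernel and its transpose cover the two triangles of the square, and the
diagonal is null. The quadratic form of a causal kernel thus sees only `G(|t - s|)`. -/
theorem two_mul_integral_convKernel {T : ℝ} {f : ℝ → ℝ} (hf : Measurable f)
    (hf2 : MemLp f 2 (leb T)) (y : L2 T) :
    2 * ∫ s, ∫ u, (if u < s then f (s - u) else 0) * y u * y s ∂(leb T) ∂(leb T) =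
      ∫ t, ∫ s, f |t - s| * y s * y t ∂(leb T) ∂(leb T) := by
  have hk := memLp_convKernel hf hf2
  have h1 := integrable_kernel_mul hk y y
  have h2 := integrable_kernel_mul (memLp_swap hk) y y
  have h3 : ∫ s, ∫ u, (if u < s then f (s - u) else 0) * y u * y s ∂(leb T) ∂(leb T) =
      ∫ t, ∫ s, (if t < s then f (s - t) else 0) * y s * y t ∂(leb T) ∂(leb T) := by
    rw [integral_integral_swap (by exact h1)]
    refine integral_congr_ae (Eventually.of_forall fun s => ?_)
    refine integral_congr_ae (Eventually.of_forall fun u => ?_)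
    ring
  rw [two_mul]
  nth_rewrite 2 [h3]
  rw [← integral_add h1.integral_prod_left h2.integral_prod_left]
  refine integral_congr_ae ?_
  filter_upwards [h1.prod_right_ae, h2.prod_right_ae] with t h4 h5
  rw [← integral_add h4 h5]
  refine integral_congr_ae ?_
  filter_upwards [ae_ne_leb T t] with s hs
  rcases lt_or_gt_of_ne hs with h | h
  · rw [if_pos h, if_neg h.le.not_gt, abs_of_pos (sub_pos.2 h)]; ring
  · rw [if_neg h.le.not_gt, if_pos h, abs_of_neg (sub_neg.2 h), neg_sub]; ring

theorem memLp_const_leb (T a : ℝ) : MemLp (fun _ : ℝ => a) 2 (leb T) := memLp_const a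

/-- The constant function `1` in `L²([0,T])`. -/
def oneL2 (T : ℝ) : L2 T := toL2 T fun _ => 1

theorem oneL2_coe (T : ℝ) : oneL2 T =ᵐ[leb T] fun _ => 1 := coeFn_toL2 (memLp_const_leb T 1)

theorem inner_oneL2 {T : ℝ} (x : L2 T) : inner ℝ (oneL2 T) x = ∫ t, x t ∂(leb T) := by
  rw [inner_L2_eq]
  refine integral_congr_ae ?_
  filter_upwards [oneL2_coe T] with t ht
  rw [ht, one_mul]

section Operators

variable (c : Constants) (θ : Param c.T)

/-- The function `2ϱ + G`. -/
def impactFun (r : ℝ) : ℝ := 2 * c.ϱ + θ.2 r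

theorem measurable_impactFun : Measurable (impactFun c θ) :=
  measurable_const.add (Lp.stronglyMeasurable θ.2).measurable

theorem memLp_impactFun : MemLp (impactFun c θ) 2 (leb c.T) :=
  (memLp_const_leb c.T _).add (Lp.memLp θ.2)

theorem Gtilde_eq (s u : ℝ) :
    Gtilde c θ s u = if u < s then impactFun c θ (s - u) else 0 := rfl

theorem memLp_Gtilde : MemLp (Function.uncurry (Gtilde c θ)) 2 ((leb c.T).prod (leb c.T)) :=
  memLp_convKernel (measurable_impactFun c θ) (memLp_impactFun c θ)

theorem memLp_Gtilde_trunc (t : ℝ) :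
    MemLp (Function.uncurry fun s u => if t ≤ u then Gtilde c θ s u else 0) 2
      ((leb c.T).prod (leb c.T)) :=
  (memLp_Gtilde c θ).indicator (s := {z : ℝ × ℝ | t ≤ z.2})
    (measurableSet_le measurable_const measurable_snd)

theorem memLp_one_trunc (t : ℝ) :
    MemLp (Function.uncurry fun u s : ℝ => if s ≤ u ∧ t ≤ s then (1 : ℝ) else 0) 2
      ((leb c.T).prod (leb c.T)) := by
  have h := (memLp_const (1 : ℝ) (μ := (leb c.T).prod (leb c.T)) (p := 2)).indicator
    (s := {z : ℝ × ℝ | z.2 ≤ z.1 ∧ t ≤ z.2})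
    ((measurableSet_le measurable_snd measurable_fst).inter
      (measurableSet_le measurable_const measurable_snd))
  convert h using 1
  ext z
  simp [indicator, Function.uncurry]

theorem GtildeOp_zero_apply (x : L2 c.T) : GtildeOp c θ 0 x =ᵐ[leb c.T] fun s =>
    ∫ u, Gtilde c θ s u * x u ∂(leb c.T) := by
  filter_upwards [integralOp_apply c.T _ (memLp_Gtilde_trunc c θ 0) x] with s hs
  rw [GtildeOp, hs]
  refine integral_congr_ae ?_
  filter_upwards [ae_leb_mem c.T] with u hu
  rw [if_pos hu.1]

/-- The truncation acts on the input variable of the kernel, so every time-`t` operator is the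
time-`0` operator after restriction to `[t,T]`. -/
theorem GtildeOp_apply (t : ℝ) (x : L2 c.T) :
    GtildeOp c θ t x = GtildeOp c θ 0 (chi c.T t x) := by
  refine Lp.ext ?_
  filter_upwards [integralOp_apply c.T _ (memLp_Gtilde_trunc c θ t) x,
    GtildeOp_zero_apply c θ (chi c.T t x)] with s h1 h2
  rw [h2, GtildeOp, h1]
  refine integral_congr_ae ?_
  filter_upwards [chi_coe t x] with u hu
  rw [hu, indicator]
  by_cases h : t ≤ u <;> simp [h]

/-- Causality: an input supported on `[t,T]` has no effect before `t`. -/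
theorem chi_GtildeOp_chi (t : ℝ) (x : L2 c.T) :
    chi c.T t (GtildeOp c θ 0 (chi c.T t x)) = GtildeOp c θ 0 (chi c.T t x) := by
  refine eq_chi_of_ae ?_
  filter_upwards [GtildeOp_zero_apply c θ (chi c.T t x)] with s hs hst
  rw [hs]
  refine integral_eq_zero_of_ae ?_
  filter_upwards [chi_coe t x] with u hu
  rw [hu, indicator, Gtilde]
  by_cases h : t ≤ u
  · rw [if_neg (not_lt.2 (hst.le.trans h))]; simp
  · rw [if_neg (show u ∉ Ici t from h)]; simp

theorem oneOp_zero_apply (x : L2 c.T) : oneOp c 0 x =ᵐ[leb c.T] fun u =>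
    ∫ s, (if s ≤ u then 1 else 0) * x s ∂(leb c.T) := by
  filter_upwards [integralOp_apply c.T _ (memLp_one_trunc c 0) x] with s hs
  rw [oneOp, hs]
  refine integral_congr_ae ?_
  filter_upwards [ae_leb_mem c.T] with u hu
  simp [hu.1]

theorem oneOp_apply (t : ℝ) (x : L2 c.T) : oneOp c t x = oneOp c 0 (chi c.T t x) := by
  refine Lp.ext ?_
  filter_upwards [integralOp_apply c.T _ (memLp_one_trunc c t) x,
    oneOp_zero_apply c (chi c.T t x)] with s h1 h2
  rw [h2, oneOp, h1]
  refine integral_congr_ae ?_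
  filter_upwards [chi_coe t x] with u hu
  rw [hu, indicator]
  by_cases h : t ≤ u <;> simp [h]

theorem chi_oneOp_chi (t : ℝ) (x : L2 c.T) :
    chi c.T t (oneOp c 0 (chi c.T t x)) = oneOp c 0 (chi c.T t x) := by
  refine eq_chi_of_ae ?_
  filter_upwards [oneOp_zero_apply c (chi c.T t x)] with s hs hst
  rw [hs]
  refine integral_eq_zero_of_ae ?_
  filter_upwards [chi_coe t x] with u hu
  rw [hu, indicator]
  by_cases h : t ≤ u
  · rw [if_neg (not_le.2 (hst.trans_le h))]; simp
  · rw [if_neg (show u ∉ Ici t from h)]; simp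

/-- After time `t` the past enters the cumulated trade only through its total. -/
theorem chi_oneOp_sub_chi (t : ℝ) (x : L2 c.T) :
    chi c.T t (oneOp c 0 (x - chi c.T t x)) =
      (∫ s, (if s < t then x s else 0) ∂(leb c.T)) • chi c.T t (oneL2 c.T) := by
  refine Lp.ext ?_
  filter_upwards [oneOp_zero_apply c (x - chi c.T t x), chi_coe t (oneOp c 0 (x - chi c.T t x)),
    Lp.coeFn_smul (∫ s, (if s < t then x s else 0) ∂(leb c.T)) (chi c.T t (oneL2 c.T)),
    chi_coe t (oneL2 c.T), oneL2_coe c.T] with s h1 h2 h3 h4 h5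
  rw [h2, h3, Pi.smul_apply, h4, indicator, indicator, h1, h5]
  by_cases h : t ≤ s
  · rw [if_pos (show s ∈ Ici t from h), if_pos (show s ∈ Ici t from h), smul_eq_mul, mul_one]
    refine integral_congr_ae ?_
    filter_upwards [coe_sub_chi t x] with u hu
    rw [hu]
    by_cases h' : u < t
    · simp [h', (h'.trans_le h).le]
    · simp [h']
  · rw [if_neg (show s ∉ Ici t from h), if_neg (show s ∉ Ici t from h), smul_zero]

theorem adjoint_GtildeOp_zero_apply (x : L2 c.T) :
    ContinuousLinearMap.adjoint (GtildeOp c θ 0) x =ᵐ[leb c.T] fun s =>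
      ∫ u, Gtilde c θ u s * x u ∂(leb c.T) := by
  rw [GtildeOp, adjoint_integralOp (memLp_Gtilde_trunc c θ 0)]
  filter_upwards [integralOp_apply c.T _ (memLp_swap (memLp_Gtilde_trunc c θ 0)) x,
    ae_leb_mem c.T] with s hs hs'
  rw [hs]
  simp only [if_pos hs'.1]

theorem adjoint_oneOp_zero_apply (x : L2 c.T) :
    ContinuousLinearMap.adjoint (oneOp c 0) x =ᵐ[leb c.T] fun s =>
      ∫ u, (if s ≤ u then 1 else 0) * x u ∂(leb c.T) := by
  rw [oneOp, adjoint_integralOp (memLp_one_trunc c 0)]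
  filter_upwards [integralOp_apply c.T _ (memLp_swap (memLp_one_trunc c 0)) x,
    ae_leb_mem c.T] with s hs hs'
  rw [hs]
  simp only [hs'.1, and_true]

theorem adjoint_eq_chi_adjoint {T t : ℝ} {K K₀ : L2 T →L[ℝ] L2 T} (h : ∀ x, K x = K₀ (chi T t x))
    (x : L2 T) :
    ContinuousLinearMap.adjoint K x = chi T t (ContinuousLinearMap.adjoint K₀ x) := by
  refine ext_inner_right ℝ fun y => ?_
  rw [ContinuousLinearMap.adjoint_inner_left, h, inner_chi_left,
    ContinuousLinearMap.adjoint_inner_left]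

/-- If `K` maps functions supported on `[t,T]` to such functions, then its adjoint maps functions
supported on `[0,t)` to such functions. -/
theorem chi_adjoint_sub_chi {T t : ℝ} {K : L2 T →L[ℝ] L2 T}
    (h : ∀ x, chi T t (K (chi T t x)) = K (chi T t x)) (x : L2 T) :
    chi T t (ContinuousLinearMap.adjoint K (x - chi T t x)) = 0 := by
  refine ext_inner_right ℝ fun y => ?_
  rw [inner_chi_left, ContinuousLinearMap.adjoint_inner_left, inner_sub_left, inner_chi_left, h,
    sub_self, inner_zero_left]

theorem inner_Dop (t : ℝ) (x y : L2 c.T) : inner ℝ (Dop c θ t x) y = 2 * θ.1 * inner ℝ x y +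
    (inner ℝ (GtildeOp c θ t x) y + inner ℝ x (GtildeOp c θ t y)) +
    2 * c.φ * inner ℝ (oneOp c t x) (oneOp c t y) := by
  simp only [Dop, add_apply, smul_apply,
    ContinuousLinearMap.id_apply, ContinuousLinearMap.comp_apply, inner_add_left,
    real_inner_smul_left, ContinuousLinearMap.adjoint_inner_left]

theorem inner_Dop_comm (t : ℝ) (x y : L2 c.T) :
    inner ℝ (Dop c θ t x) y = inner ℝ x (Dop c θ t y) := by
  rw [inner_Dop, ← real_inner_comm x (Dop c θ t y), inner_Dop, real_inner_comm x y,
    real_inner_comm (GtildeOp c θ t y) x, real_inner_comm y (GtildeOp c θ t x),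
    real_inner_comm (oneOp c t x)]
  ring

theorem inner_GtildeOp_zero (y : L2 c.T) : inner ℝ (GtildeOp c θ 0 y) y =
    ∫ s, ∫ u, (if u < s then impactFun c θ (s - u) else 0) * y u * y s ∂(leb c.T) ∂(leb c.T) := by
  rw [inner_L2_eq]
  refine integral_congr_ae ?_
  filter_upwards [GtildeOp_zero_apply c θ y] with s hs
  rw [hs, integral_mul_const]
  rfl

theorem two_mul_integral_lt (T : ℝ) (y : L2 T) :
    2 * ∫ s, ∫ u, (if u < s then (1 : ℝ) else 0) * y u * y s ∂(leb T) ∂(leb T) =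
      (∫ t, y t ∂(leb T)) ^ 2 := by
  rw [two_mul_integral_convKernel (f := fun _ => 1) measurable_const (memLp_const_leb T 1)]
  simp_rw [one_mul, integral_mul_const, integral_const_mul, sq]

theorem inner_GtildeOp_eq (y : L2 c.T) : inner ℝ (GtildeOp c θ 0 y) y =
    (∫ s, ∫ u, (if u < s then θ.2 (s - u) else 0) * y u * y s ∂(leb c.T) ∂(leb c.T)) +
      c.ϱ * (∫ t, y t ∂(leb c.T)) ^ 2 := by
  rw [inner_GtildeOp_zero, ← two_mul_integral_lt]
  have h1 := integrable_kernel_mul (memLp_convKernel (Lp.stronglyMeasurable θ.2).measurable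
    (Lp.memLp θ.2)) y y
  have h2 := integrable_kernel_mul (memLp_convKernel (f := fun _ => (1 : ℝ)) measurable_const
    (memLp_const_leb c.T 1)) y y
  have h3 := integrable_kernel_mul (memLp_Gtilde c θ) y y
  simp only [Gtilde_eq] at h3
  have h4 : (∫ z : ℝ × ℝ, (if z.2 < z.1 then impactFun c θ (z.1 - z.2) else 0) * y z.2 * y z.1
      ∂((leb c.T).prod (leb c.T))) = (∫ z : ℝ × ℝ, (if z.2 < z.1 then θ.2 (z.1 - z.2) else 0) *
        y z.2 * y z.1 ∂((leb c.T).prod (leb c.T))) + 2 * c.ϱ * ∫ z : ℝ × ℝ,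
        (if z.2 < z.1 then 1 else 0) * y z.2 * y z.1 ∂((leb c.T).prod (leb c.T)) := by
    rw [← integral_const_mul, ← integral_add h1 (h2.const_mul _)]
    refine integral_congr_ae (Eventually.of_forall fun z => ?_)
    simp only [impactFun]
    split_ifs <;> ring
  rw [integral_prod _ h1, integral_prod _ h2, integral_prod _ h3] at h4
  rw [h4]
  ring

/-- This turns the lower bound on `quadForm` in `Ξ_ε` into one for the operator. The constant part
`2ϱ` of the kernel contributes a multiple of a square. -/
theorem two_inner_GtildeOp (y : L2 c.T) : 2 * inner ℝ (GtildeOp c θ 0 y) y =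
    quadForm c.T θ.2 y + 2 * c.ϱ * (∫ t, y t ∂(leb c.T)) ^ 2 := by
  rw [inner_GtildeOp_eq, quadForm, ← two_mul_integral_convKernel
    (Lp.stronglyMeasurable θ.2).measurable (Lp.memLp θ.2)]
  ring

/-- The constant `2ϱ` cancels and the difference is a convolution kernel, whose Hilbert–Schmidt norm
carries the factor `√T`. Restricting the input to `[t,T]` only decreases the norm. -/
theorem norm_GtildeOp_sub_le (θ' : Param c.T) (t : ℝ) :
    ‖GtildeOp c θ t - GtildeOp c θ' t‖ ≤ √c.T * ‖θ.2 - θ'.2‖ := by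
  have key : ‖GtildeOp c θ 0 - GtildeOp c θ' 0‖ ≤ √c.T * ‖θ.2 - θ'.2‖ := by
    have hm := measurable_impactFun c θ
    have hm' := measurable_impactFun c θ'
    have hk := memLp_convKernel (hm.sub hm') ((memLp_impactFun c θ).sub (memLp_impactFun c θ'))
    refine norm_le_of_kernel hk (fun f => ?_) (by positivity) ?_
    · filter_upwards [Lp.coeFn_sub (GtildeOp c θ 0 f) (GtildeOp c θ' 0 f),
        GtildeOp_zero_apply c θ f, GtildeOp_zero_apply c θ' f, memLp_kernel_row (memLp_Gtilde c θ),
        memLp_kernel_row (memLp_Gtilde c θ')] with s h1 h2 h3 h4 h5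
      have h6 : Integrable (fun u => Gtilde c θ s u * f u) (leb c.T) :=
        h4.integrable_mul (Lp.memLp f)
      have h7 : Integrable (fun u => Gtilde c θ' s u * f u) (leb c.T) :=
        h5.integrable_mul (Lp.memLp f)
      rw [sub_apply, h1, Pi.sub_apply, h2, h3, ← integral_sub h6 h7]
      refine integral_congr_ae (Eventually.of_forall fun u => ?_)
      simp only [Gtilde_eq, Pi.sub_apply]
      split_ifs <;> ring
    · refine (integral_sq_convKernel_le (hm.sub hm')
        ((memLp_impactFun c θ).sub (memLp_impactFun c θ')) c.T_pos.le).trans ?_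
      rw [mul_pow, Real.sq_sqrt c.T_pos.le, norm_sq_L2_eq]
      refine mul_le_mul_of_nonneg_left (le_of_eq ?_) c.T_pos.le
      refine integral_congr_ae ?_
      filter_upwards [Lp.coeFn_sub θ.2 θ'.2] with s hs
      rw [hs, Pi.sub_apply, Pi.sub_apply, impactFun, impactFun]
      ring
  refine ContinuousLinearMap.opNorm_le_bound _ (by positivity) fun x => ?_
  rw [sub_apply, GtildeOp_apply, GtildeOp_apply c θ',
    ← sub_apply]
  exact (ContinuousLinearMap.le_of_opNorm_le _ key _).trans
    (mul_le_mul_of_nonneg_left (chi_norm_le t x) (by positivity))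

theorem norm_Dop_sub_le (θ' : Param c.T) (t : ℝ) :
    ‖Dop c θ t - Dop c θ' t‖ ≤ 2 * |θ.1 - θ'.1| + 2 * (√c.T * ‖θ.2 - θ'.2‖) := by
  have h : Dop c θ t - Dop c θ' t = (2 * (θ.1 - θ'.1)) • ContinuousLinearMap.id ℝ (L2 c.T) +
      ((GtildeOp c θ t - GtildeOp c θ' t) +
        ContinuousLinearMap.adjoint (GtildeOp c θ t - GtildeOp c θ' t)) := by
    rw [map_sub, Dop, Dop]
    module
  rw [h]
  refine (norm_add_le _ _).trans (add_le_add ?_ ?_)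
  · rw [norm_smul]
    refine (mul_le_of_le_one_right (norm_nonneg _) ContinuousLinearMap.norm_id_le).trans ?_
    rw [Real.norm_eq_abs, abs_mul, abs_two]
  · refine (norm_add_le _ _).trans ?_
    rw [LinearIsometryEquiv.norm_map, ← two_mul]
    exact mul_le_mul_of_nonneg_left (norm_GtildeOp_sub_le c θ θ' t) zero_le_two

/-- Read off from the operators with parameters `(0, G)` and `(0, G')`, since `GtildeOp` ignores the
first component. -/
theorem abs_quadForm_sub_le (G G' y : L2 c.T) :
    |quadForm c.T G y - quadForm c.T G' y| ≤ 2 * √c.T * ‖G - G'‖ * ‖y‖ ^ 2 := by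
  have h1 := two_inner_GtildeOp c (0, G) y
  have h2 := two_inner_GtildeOp c (0, G') y
  have h3 := norm_GtildeOp_sub_le c (0, G) (0, G') 0
  have h4 : quadForm c.T G y - quadForm c.T G' y =
      2 * inner ℝ ((GtildeOp c (0, G) 0 - GtildeOp c (0, G') 0) y) y := by
    rw [sub_apply, inner_sub_left]
    simp only at h1 h2
    linarith
  rw [h4, abs_mul, abs_two]
  have h5 := (abs_real_inner_le_norm ((GtildeOp c (0, G) 0 - GtildeOp c (0, G') 0) y) y).trans
    (mul_le_mul_of_nonneg_right (ContinuousLinearMap.le_of_opNorm_le _ h3 y) (norm_nonneg y))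
  simp only at h5
  nlinarith [h5]

theorem continuous_Dop (t : ℝ) : Continuous fun θ : Param c.T => Dop c θ t := by
  rw [continuous_iff_continuousAt]
  intro θ₀
  rw [ContinuousAt, tendsto_iff_norm_sub_tendsto_zero]
  refine squeeze_zero (fun _ => norm_nonneg _) (fun θ => norm_Dop_sub_le c θ θ₀ t) ?_
  have : Continuous fun θ : Param c.T => 2 * |θ.1 - θ₀.1| + 2 * (√c.T * ‖θ.2 - θ₀.2‖) := by
    fun_prop
  simpa using this.tendsto θ₀

/-- Ensures that the event that a measurable estimate is admissible belongs to the information on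
which the estimate is based. -/
theorem isClosed_admissibleParams (L ε : ℝ) : IsClosed (admissibleParams c.T L ε) := by
  have hq : ∀ f : L2 c.T, Continuous fun θ : Param c.T => quadForm c.T θ.2 f := by
    intro f
    rw [continuous_iff_continuousAt]
    intro θ₀
    rw [ContinuousAt, tendsto_iff_norm_sub_tendsto_zero]
    refine squeeze_zero (fun _ => norm_nonneg _) (fun θ => abs_quadForm_sub_le c θ.2 θ₀.2 f) ?_
    have : Continuous fun θ : Param c.T => 2 * √c.T * ‖θ.2 - θ₀.2‖ * ‖f‖ ^ 2 := by fun_prop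
    simpa using this.tendsto θ₀
  simp only [admissibleParams, ofPred_and, ofPred_forall]
  refine (isClosed_le continuous_const continuous_fst).inter
    ((isClosed_le continuous_fst continuous_const).inter
      ((isClosed_le continuous_snd.norm continuous_const).inter (isClosed_iInter fun f => ?_)))
  exact isClosed_le continuous_const (hq f)

variable {c θ} {L ε : ℝ}

/-- By causality the form of `GtildeOp c θ t` at `x` equals the time-`0` form at the restriction of
`x` to `[t,T]`, which costs at most `ε ‖x‖²`. The contributions of `ϱ` and `φ` are nonnegative. -/
theorem Dop_coercive (hθ : θ ∈ admissibleParams c.T L ε) (hε : 0 ≤ ε) (t : ℝ) (x : L2 c.T) :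
    (2 * L⁻¹ - ε) * ‖x‖ ^ 2 ≤ inner ℝ (Dop c θ t x) x := by
  have h1 : inner ℝ (GtildeOp c θ t x) x =
      inner ℝ (GtildeOp c θ 0 (chi c.T t x)) (chi c.T t x) := by
    rw [GtildeOp_apply, ← inner_chi_left, chi_GtildeOp_chi]
  have h2 := two_inner_GtildeOp c θ (chi c.T t x)
  have h3 := hθ.2.2.2 (chi c.T t x)
  have h4 : ‖chi c.T t x‖ ^ 2 ≤ ‖x‖ ^ 2 := by gcongr; exact chi_norm_le t x
  rw [inner_Dop, real_inner_comm (GtildeOp c θ t x) x, h1, real_inner_self_eq_norm_sq,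
    real_inner_self_eq_norm_sq]
  have h5 : 0 ≤ 2 * c.φ * ‖oneOp c t x‖ ^ 2 := by have := c.φ_nonneg; positivity
  have h6 : 0 ≤ 2 * c.ϱ * (∫ s, chi c.T t x s ∂(leb c.T)) ^ 2 := by
    have := c.ϱ_nonneg; positivity
  have h7 : L⁻¹ * ‖x‖ ^ 2 ≤ θ.1 * ‖x‖ ^ 2 := by gcongr; exact hθ.1
  nlinarith

theorem isUnit_Dop (hθ : θ ∈ admissibleParams c.T L ε) (hε : 0 ≤ ε) (hLε : 0 < 2 * L⁻¹ - ε)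
    (t : ℝ) : IsUnit (Dop c θ t) := by
  refine ContinuousLinearMap.isUnit_of_forall_le_norm_inner_map _ (c := ⟨2 * L⁻¹ - ε, hLε.le⟩)
    hLε fun x => ?_
  rw [mul_comm]
  exact (Dop_coercive hθ hε t x).trans (le_abs_self _)

theorem Dop_Dinv (hθ : θ ∈ admissibleParams c.T L ε) (hε : 0 ≤ ε) (hLε : 0 < 2 * L⁻¹ - ε)
    (t : ℝ) (x : L2 c.T) : Dop c θ t (Dinv c θ t x) = x := by
  rw [Dinv, ← mul_apply_eq_comp,
    Ring.mul_inverse_cancel _ (isUnit_Dop hθ hε hLε t), one_apply_eq_self]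

theorem inner_Dinv_comm (hθ : θ ∈ admissibleParams c.T L ε) (hε : 0 ≤ ε)
    (hLε : 0 < 2 * L⁻¹ - ε) (t : ℝ) (x y : L2 c.T) :
    inner ℝ (Dinv c θ t x) y = inner ℝ x (Dinv c θ t y) := by
  conv_lhs => rw [← Dop_Dinv hθ hε hLε t y]
  rw [← inner_Dop_comm, Dop_Dinv hθ hε hLε]

theorem norm_le_of_Dop (hθ : θ ∈ admissibleParams c.T L ε) (hε : 0 ≤ ε) (t : ℝ) (x : L2 c.T) :
    (2 * L⁻¹ - ε) * ‖x‖ ≤ ‖Dop c θ t x‖ := by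
  rcases (norm_nonneg x).eq_or_lt with h | h
  · rw [← h, mul_zero]; exact norm_nonneg _
  · refine le_of_mul_le_mul_right ?_ h
    calc (2 * L⁻¹ - ε) * ‖x‖ * ‖x‖ = (2 * L⁻¹ - ε) * ‖x‖ ^ 2 := by ring
      _ ≤ inner ℝ (Dop c θ t x) x := Dop_coercive hθ hε t x
      _ ≤ _ := real_inner_le_norm _ _

end Operators

end Liquidation

namespace Liquidation

/-! ### The greedy feedback form and the first-order condition, pathwise -/

theorem intervalIntegral_eq_integral_leb {T t : ℝ} (ht : t ∈ Icc 0 T) (f : ℝ → ℝ) :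
    ∫ s in (0 : ℝ)..t, f s = ∫ s, (if s < t then f s else 0) ∂(leb T) := by
  rw [intervalIntegral.integral_of_le ht.1, ← integral_Ico_eq_integral_Ioc]
  have h1 : (fun s => if s < t then f s else 0) = (Iio t).indicator f := by
    ext s; simp [indicator]
  rw [h1, integral_indicator measurableSet_Iio, leb, Measure.restrict_restrict measurableSet_Iio]
  have h2 : Iio t ∩ Icc 0 T = Ico 0 t := by
    ext s
    simp only [mem_inter_iff, mem_Iio, mem_Icc, mem_Ico]
    constructor
    · rintro ⟨h1, h2, -⟩; exact ⟨h2, h1⟩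
    · rintro ⟨h1, h2⟩; exact ⟨h2, h1, h2.le.trans ht.2⟩
  rw [h2]

theorem inner_chi_one {T t : ℝ} (ht : t ∈ Icc 0 T) :
    inner ℝ (chi T t (oneL2 T)) (chi T t (oneL2 T)) = T - t := by
  rw [inner_chi_left, chi_idem, inner_oneL2]
  have : ∫ s, (chi T t (oneL2 T)) s ∂(leb T) = ∫ _ in Icc t T, (1 : ℝ) := by
    rw [integral_congr_ae (g := (Ici t).indicator fun _ => (1 : ℝ)) ?_,
      integral_indicator measurableSet_Ici, leb, Measure.restrict_restrict measurableSet_Ici]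
    · congr 2
      ext s
      simp only [mem_inter_iff, mem_Ici, mem_Icc]
      exact ⟨fun h => ⟨h.1, h.2.2⟩, fun h => ⟨h.1, ht.1.trans h.1, h.2⟩⟩
    · filter_upwards [chi_coe t (oneL2 T), oneL2_coe T] with s h1 h2
      rw [h1, indicator, indicator, h2]
  rw [this]
  simp [ht.2]

section Greedy

variable (c : Constants) (θ : Param c.T)

/-- The first component of `K_t`. -/
def kvec (t : ℝ) : L2 c.T := toL2 c.T ((Ici t).indicator fun s => Gtilde c θ s t)

theorem memLp_Gtilde_left {t : ℝ} (ht : 0 ≤ t) :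
    MemLp (fun s => Gtilde c θ s t) 2 (leb c.T) :=
  memLp_translate_right (measurable_impactFun c θ) (memLp_impactFun c θ) ht

theorem memLp_Gtilde_right {t : ℝ} (ht : t ≤ c.T) :
    MemLp (fun s => Gtilde c θ t s) 2 (leb c.T) :=
  memLp_translate_left (measurable_impactFun c θ) (memLp_impactFun c θ) ht

theorem chi_kvec {t : ℝ} (ht : 0 ≤ t) : chi c.T t (kvec c θ t) = kvec c θ t := by
  rw [kvec, toL2_indicator_Ici (memLp_Gtilde_left c θ ht), chi_idem]

theorem inner_kvec {t : ℝ} (ht : 0 ≤ t) (x : L2 c.T) :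
    inner ℝ (kvec c θ t) x = ∫ s, Gtilde c θ s t * x s ∂(leb c.T) := by
  rw [inner_L2_eq]
  refine integral_congr_ae ?_
  filter_upwards [coeFn_toL2 ((memLp_Gtilde_left c θ ht).indicator (measurableSet_Ici (a := t)))]
    with s hs
  rw [kvec, hs, indicator]
  split_ifs with h
  · rfl
  · rw [Gtilde, if_neg (fun h' => h (le_of_lt h'))]

theorem norm_kvec_le {t : ℝ} (ht : 0 ≤ t) :
    ‖kvec c θ t‖ ≤ 2 * c.ϱ * ‖oneL2 c.T‖ + ‖θ.2‖ := by
  have h1 : ‖kvec c θ t‖ ≤ ‖(2 * c.ϱ) • oneL2 c.T + θ.2‖ := by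
    refine abs_le_of_sq_le_sq' ?_ (norm_nonneg _) |>.2
    have h2 : kvec c θ t = toL2 c.T fun s => Gtilde c θ s t := by
      refine toL2_congr (Eventually.of_forall fun s => ?_)
      simp only [indicator]
      split_ifs with h
      · rfl
      · rw [Gtilde, if_neg (fun h' => h (le_of_lt h'))]
    rw [norm_sq_L2_eq, norm_sq_L2_eq, h2]
    calc _ = ∫ s, (Gtilde c θ s t) ^ 2 ∂(leb c.T) := by
          refine integral_congr_ae ?_
          filter_upwards [coeFn_toL2 (memLp_Gtilde_left c θ ht)] with s hs
          rw [hs]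
      _ ≤ ∫ s, (impactFun c θ s) ^ 2 ∂(leb c.T) :=
          integral_sq_translate_right_le (measurable_impactFun c θ) (memLp_impactFun c θ) ht
      _ = _ := by
          refine integral_congr_ae ?_
          filter_upwards [Lp.coeFn_add ((2 * c.ϱ) • oneL2 c.T) θ.2,
            Lp.coeFn_smul (2 * c.ϱ) (oneL2 c.T), oneL2_coe c.T] with s h3 h4 h5
          rw [h3, Pi.add_apply, h4, Pi.smul_apply, h5, impactFun, smul_eq_mul, mul_one]
  refine h1.trans ((norm_add_le _ _).trans ?_)
  rw [norm_smul, Real.norm_of_nonneg (by have := c.ϱ_nonneg; positivity)]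

/-- The conditional expectation of the future trajectory prescribed by the feedback form, where `z`
is the conditional expectation of `A - A_T` and `U` is the executed strategy. -/
def predicted (t : ℝ) (z U : L2 c.T) : L2 c.T :=
  Dinv c θ t (chi c.T t (z + (2 * c.ϱ * c.q) • oneL2 c.T - GtildeOp c θ 0 (U - chi c.T t U)) +
    (2 * c.φ * (c.q - ∫ s, (if s < t then U s else 0) ∂(leb c.T))) •
      chi c.T t (ContinuousLinearMap.adjoint (oneOp c 0) (chi c.T t (oneL2 c.T))))

theorem toL2_const (a : ℝ) (T : ℝ) : toL2 T (fun _ => a) = a • oneL2 T := by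
  refine Lp.ext ?_
  filter_upwards [coeFn_toL2 (memLp_const_leb T a), Lp.coeFn_smul a (oneL2 T), oneL2_coe T]
    with s h1 h2 h3
  rw [h1, h2, Pi.smul_apply, h3, smul_eq_mul, mul_one]

theorem toL2_indicator_const (a t T : ℝ) :
    toL2 T ((Ici t).indicator fun _ => a) = a • chi T t (oneL2 T) := by
  rw [toL2_indicator_Ici (memLp_const_leb T a), toL2_const, map_smul]

variable {c θ} {L ε : ℝ}

/-- The inverse of the symmetric `D_t` is symmetric, and the off-diagonal blocks are adjoint to each
other. This lets the formula for the strategy be rewritten with `Γ_t⁻¹` acting on the data instead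
of on `K_t`. -/
theorem pairInner_gammaInv_comm (hθ : θ ∈ admissibleParams c.T L ε) (hε : 0 ≤ ε)
    (hLε : 0 < 2 * L⁻¹ - ε) (t : ℝ) (x y : L2 c.T × L2 c.T) :
    pairInner (gammaInv c θ t x) y = pairInner x (gammaInv c θ t y) := by
  have hD := inner_Dinv_comm hθ hε hLε t
  simp only [pairInner, gammaInv, inner_add_left, inner_add_right, inner_sub_left,
    inner_sub_right, real_inner_smul_left, real_inner_smul_right]
  simp only [hD, ← ContinuousLinearMap.adjoint_inner_right (oneOp c t)]
  simp only [ContinuousLinearMap.adjoint_inner_left]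
  ring

/-- Integrating the Volterra kernel against the executed strategy moves the integral inside the
pairing with `Γ_t⁻¹ K_t`. What remains of the past is its impact on `[t,T]`, its total volume and
its current impact at `t`. -/
theorem integral_Bcoef (hθ : θ ∈ admissibleParams c.T L ε) (hLε : 0 < L) {t : ℝ}
    (ht : t ∈ Icc 0 c.T) {u : ℝ → ℝ} {U : L2 c.T} (hu : u =ᵐ[leb c.T] U) :
    2 * θ.1 * ∫ s in (0 : ℝ)..t, Bcoef c θ t s * u s =
      inner ℝ (gammaInv c θ t (Kvec c θ t)).1
        (chi c.T t (GtildeOp c θ 0 (U - chi c.T t U))) -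
      (∫ s, (if s < t then U s else 0) ∂(leb c.T)) *
        inner ℝ (gammaInv c θ t (Kvec c θ t)).2 (chi c.T t (oneL2 c.T)) -
      ∫ s, Gtilde c θ t s * U s ∂(leb c.T) := by
  set p := gammaInv c θ t (Kvec c θ t) with hp
  have hlam : θ.1 ≠ 0 := ((inv_pos.2 hLε).trans_le hθ.1).ne'
  -- The pairing of the first component of `Γ_t⁻¹ K_t` with `G̃(·,s)` on `[t,T]` is the value of `a`
  -- at `s`, so integration in `s` becomes an inner product.
  set a := ContinuousLinearMap.adjoint (GtildeOp c θ 0) (chi c.T t p.1) with ha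
  have h1 : ∀ᵐ s ∂(leb c.T), (if s < t then Bcoef c θ t s * u s else 0) = 1 / (2 * θ.1) *
      (a s * (U - chi c.T t U : L2 c.T) s
        - inner ℝ p.2 (chi c.T t (oneL2 c.T)) * (if s < t then U s else 0)
        - Gtilde c θ t s * U s) := by
    filter_upwards [adjoint_GtildeOp_zero_apply c θ (chi c.T t p.1), coe_sub_chi t U, hu,
      ae_leb_mem c.T] with s h2 h3 h4 h5
    rw [h3]
    by_cases h : s < t
    · simp only [if_pos h, Bcoef, pairInner, tailPair]
      rw [toL2_indicator_const, h4, ← hp, real_inner_smul_right]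
      have h6 : inner ℝ p.1 (toL2 c.T ((Ici t).indicator fun r => Gtilde c θ r s)) = a s := by
        rw [toL2_indicator_Ici (memLp_Gtilde_left c θ h5.1), ← inner_chi_left, inner_L2_eq, ha, h2]
        refine integral_congr_ae ?_
        filter_upwards [coeFn_toL2 (memLp_Gtilde_left c θ h5.1)] with r hr
        rw [hr, mul_comm]
      rw [h6]
      ring
    · simp only [if_neg h, Gtilde]
      ring
  have i1 : Integrable (fun s => a s * (U - chi c.T t U : L2 c.T) s) (leb c.T) :=
    integrable_mul_L2 _ _
  have i2 : Integrable (fun s => if s < t then U s else 0) (leb c.T) :=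
    (integrable_coe_L2 (U - chi c.T t U)).congr (coe_sub_chi t U)
  have i3 : Integrable (fun s => Gtilde c θ t s * U s) (leb c.T) :=
    (memLp_Gtilde_right c θ ht.2).integrable_mul (Lp.memLp U)
  have i4 := i2.const_mul (inner ℝ p.2 (chi c.T t (oneL2 c.T)))
  have i5 : Integrable (fun s => a s * (U - chi c.T t U : L2 c.T) s
      - inner ℝ p.2 (chi c.T t (oneL2 c.T)) * (if s < t then U s else 0)) (leb c.T) := i1.sub i4
  rw [intervalIntegral_eq_integral_leb ht, integral_congr_ae h1, integral_const_mul,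
    integral_sub i5 i3, integral_sub i1 i4, integral_const_mul, ← inner_L2_eq, ha,
    ContinuousLinearMap.adjoint_inner_left, inner_chi_left, ← mul_assoc,
    mul_one_div_cancel (mul_ne_zero two_ne_zero hlam)]
  ring

/-- All terms of `aCoef` and `Bcoef` containing `Γ_t⁻¹ K_t` pair it with parts of one vector `Y`. By
symmetry their sum is the pairing of `K_t` with `Γ_t⁻¹ Y`, and the first component of `Γ_t⁻¹ Y` is
`predicted`. -/
theorem two_lambda_greedy (hθ : θ ∈ admissibleParams c.T L ε) (hL : 0 < L) (hε : 0 ≤ ε)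
    (hLε : 0 < 2 * L⁻¹ - ε) {t : ℝ}
    (ht : t ∈ Icc 0 c.T) (x : ℝ) (z : L2 c.T) {u : ℝ → ℝ} {U : L2 c.T} (hu : u =ᵐ[leb c.T] U) :
    2 * θ.1 * (aCoef c θ t x z + ∫ s in (0 : ℝ)..t, Bcoef c θ t s * u s) =
      x + 2 * c.ϱ * c.q - ∫ s, Gtilde c θ t s * U s ∂(leb c.T)
        - inner ℝ (kvec c θ t) (predicted c θ t z U)
        + 2 * c.φ * ((c.q - ∫ s, (if s < t then U s else 0) ∂(leb c.T)) * (c.T - t)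
          - inner ℝ (chi c.T t (oneL2 c.T))
            (oneOp c 0 (chi c.T t (predicted c θ t z U)))) := by
  have hlam : θ.1 ≠ 0 := ((inv_pos.2 hL).trans_le hθ.1).ne'
  set m := ∫ s, (if s < t then U s else 0) ∂(leb c.T) with hm
  rw [mul_add, integral_Bcoef hθ hL ht hu, aCoef, ← mul_assoc,
    mul_one_div_cancel (mul_ne_zero two_ne_zero hlam), one_mul, ← hm]
  have hK : Kvec c θ t = (kvec c θ t, -chi c.T t (oneL2 c.T)) := by
    rw [Kvec, tailPair, toL2_indicator_const, neg_one_smul]; rfl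
  -- The data at time `t`: the expected marginal revenue net of the impact of past trades, and minus
  -- the current inventory `q - m`.
  set Y : L2 c.T × L2 c.T := (chi c.T t (z + (2 * c.ϱ * c.q) • oneL2 c.T -
    GtildeOp c θ 0 (U - chi c.T t U)), (m - c.q) • chi c.T t (oneL2 c.T)) with hY
  have h1 : pairInner (ThetaVec c θ t z) (Kvec c θ t) =
      -pairInner (gammaInv c θ t (Kvec c θ t)) (chi c.T t z, 0) := by
    have h0 : tailPair c.T t z (fun _ => 0) = (chi c.T t z, 0) := by
      rw [tailPair, toL2_indicator_const, zero_smul, toL2_indicator_Ici (Lp.memLp z), toL2_coe]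
    rw [ThetaVec, h0, pairInner_gammaInv_comm hθ hε hLε]
    simp only [pairInner, Prod.fst_neg, Prod.snd_neg, inner_neg_left]
    rw [real_inner_comm (gammaInv c θ t (chi c.T t z, 0)).1,
      real_inner_comm (gammaInv c θ t (chi c.T t z, 0)).2]
    ring
  have h2 : pairInner (gammaInv c θ t (Kvec c θ t)) Y =
      inner ℝ (kvec c θ t) (predicted c θ t z U) - 2 * c.φ * ((c.q - m) * (c.T - t)
          - inner ℝ (chi c.T t (oneL2 c.T))
            (oneOp c 0 (chi c.T t (predicted c θ t z U)))) := by
    have h3 : (gammaInv c θ t Y).1 = predicted c θ t z U := by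
      rw [gammaInv, predicted, hY]
      simp only [map_add, map_smul, adjoint_eq_chi_adjoint (oneOp_apply c t), ← hm]
      module
    -- Block elimination: the second row of `Γ_t⁻¹` is determined by the first, so no separate
    -- analysis of it is needed.
    have h4 : (gammaInv c θ t Y).2 = -(2 * c.φ) • oneOp c t (gammaInv c θ t Y).1
        - (2 * c.φ) • Y.2 := by
      simp only [gammaInv, map_sub, map_smul]
      module
    rw [pairInner_gammaInv_comm hθ hε hLε, hK, pairInner, h4, h3, ← oneOp_apply, hY]
    simp only [inner_sub_right, inner_neg_left, real_inner_smul_right, inner_chi_one ht]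
    ring
  have h5 : pairInner (gammaInv c θ t (Kvec c θ t)) Y =
      pairInner (gammaInv c θ t (Kvec c θ t)) (chi c.T t z, 0) -
      pairInner (gammaInv c θ t (Kvec c θ t))
        (tailPair c.T t (fun _ => -(2 * c.ϱ * c.q)) (fun _ => c.q)) -
      inner ℝ (gammaInv c θ t (Kvec c θ t)).1 (chi c.T t (GtildeOp c θ 0 (U - chi c.T t U))) +
      m * inner ℝ (gammaInv c θ t (Kvec c θ t)).2 (chi c.T t (oneL2 c.T)) := by
    simp only [hY, tailPair, toL2_indicator_const, pairInner, map_add, map_sub, map_smul,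
      inner_add_right, inner_sub_right, real_inner_smul_right, inner_zero_right]
    ring
  rw [h1]
  linarith

theorem chi_adjoint_oneOp (t : ℝ) (x : L2 c.T) :
    chi c.T t (ContinuousLinearMap.adjoint (oneOp c 0) (chi c.T t x)) =
      chi c.T t (ContinuousLinearMap.adjoint (oneOp c 0) x) := by
  have h := chi_adjoint_sub_chi (chi_oneOp_chi c t) x
  rw [map_sub, map_sub, sub_eq_zero] at h
  exact h.symm

theorem Dop_apply (t : ℝ) (x : L2 c.T) : Dop c θ t x = (2 * θ.1) • x + (GtildeOp c θ t x +
    ContinuousLinearMap.adjoint (GtildeOp c θ t) x) +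
    (2 * c.φ) • ContinuousLinearMap.adjoint (oneOp c t) (oneOp c t x) := rfl

/-- The gradient of the deterministic part of the objective. -/
def driftVec (c : Constants) : L2 c.T := (2 * c.ϱ * c.q) • oneL2 c.T +
  (2 * c.φ * c.q) • ContinuousLinearMap.adjoint (oneOp c 0) (oneL2 c.T)

/-- Split `w` into its part on `[t,T]` and the known past. On `[t,T]` the adjoint of the causal
impact operator does not see the past, and the inventory term sees only its total. Hence `D_t`
applied to the prediction is the affine part of the gradient on `[t,T]`, and the prediction error is
governed by the gradient itself. -/
theorem Dop_chi_sub_predicted (hθ : θ ∈ admissibleParams c.T L ε) (hε : 0 ≤ ε)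
    (hLε : 0 < 2 * L⁻¹ - ε) (t : ℝ) (z : L2 c.T) {U w : L2 c.T}
    (hw : w - chi c.T t w = U - chi c.T t U) :
    Dop c θ t (chi c.T t w - predicted c θ t z U) =
      -chi c.T t (z + driftVec c - Dop c θ 0 w) := by
  set V := U - chi c.T t U with hV
  have hwV : w = chi c.T t w + V := by rw [← hw]; abel
  have h0 : chi c.T t V = 0 := by rw [hV, map_sub, chi_idem, sub_self]
  have h1 : chi c.T t (ContinuousLinearMap.adjoint (GtildeOp c θ 0) V) = 0 :=
    chi_adjoint_sub_chi (chi_GtildeOp_chi c θ t) U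
  have h2 : chi c.T t (ContinuousLinearMap.adjoint (oneOp c 0) (oneOp c 0 V)) =
      (∫ s, (if s < t then U s else 0) ∂(leb c.T)) •
        chi c.T t (ContinuousLinearMap.adjoint (oneOp c 0) (oneL2 c.T)) := by
    rw [← chi_adjoint_oneOp, hV, chi_oneOp_sub_chi, map_smul, map_smul, chi_adjoint_oneOp]
  have h3 : chi c.T t (Dop c θ 0 (chi c.T t w)) = Dop c θ t (chi c.T t w) := by
    rw [Dop_apply, Dop_apply, adjoint_eq_chi_adjoint (GtildeOp_apply c θ t), GtildeOp_apply c θ t,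
      adjoint_eq_chi_adjoint (oneOp_apply c t), oneOp_apply c t]
    simp only [map_add, map_smul, chi_idem, chi_GtildeOp_chi]
  rw [map_sub, predicted, Dop_Dinv hθ hε hLε, ← hV]
  nth_rewrite 2 [hwV]
  rw [map_add (Dop c θ 0)]
  simp only [map_add, map_sub, h3]
  rw [Dop_apply 0 V]
  simp only [map_add, map_smul, h0, h1, h2, driftVec, chi_adjoint_oneOp]
  module

/-- The gradient at time `t`, where `x`, `z` and `w` are the conditional expectations of
`A_t - A_T`, `A - A_T` and `U`. -/
def condGradient (c : Constants) (θ : Param c.T) (t x ut : ℝ) (U w : L2 c.T) : ℝ :=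
  x + (2 * c.ϱ * c.q + 2 * c.φ * c.q * (c.T - t)) - 2 * θ.1 * ut -
    (∫ s, Gtilde c θ t s * U s ∂(leb c.T)) - inner ℝ (kvec c θ t) w -
    2 * c.φ * inner ℝ (chi c.T t (oneL2 c.T)) (oneOp c 0 w)

/-- The gradient is affine in the future part of `w`, and the feedback formula says precisely that
it vanishes at the prediction. Only the linear part in the discrepancy survives. -/
theorem condGradient_eq (hθ : θ ∈ admissibleParams c.T L ε) (hL : 0 < L) (hε : 0 ≤ ε)
    (hLε : 0 < 2 * L⁻¹ - ε) {t : ℝ} (ht : t ∈ Icc 0 c.T) (x : ℝ) (z : L2 c.T) {u : ℝ → ℝ}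
    {U w : L2 c.T} (hu : u =ᵐ[leb c.T] U) (hw : w - chi c.T t w = U - chi c.T t U) {ut : ℝ}
    (hut : ut = aCoef c θ t x z + ∫ s in (0 : ℝ)..t, Bcoef c θ t s * u s) :
    condGradient c θ t x ut U w = -inner ℝ (kvec c θ t) (chi c.T t w - predicted c θ t z U) -
      2 * c.φ * inner ℝ (chi c.T t (oneL2 c.T))
        (oneOp c 0 (chi c.T t (chi c.T t w - predicted c θ t z U))) := by
  have h1 : inner ℝ (kvec c θ t) w = inner ℝ (kvec c θ t) (chi c.T t w) := by
    rw [← inner_chi_left, chi_kvec c θ ht.1]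
  have h2 : inner ℝ (chi c.T t (oneL2 c.T)) (oneOp c 0 w) =
      inner ℝ (chi c.T t (oneL2 c.T)) (oneOp c 0 (chi c.T t w)) +
        (∫ s, (if s < t then U s else 0) ∂(leb c.T)) * (c.T - t) := by
    have hwV : w = chi c.T t w + (U - chi c.T t U) := by rw [← hw]; abel
    nth_rewrite 1 [hwV]
    rw [map_add, inner_add_right, ← chi_idem (T := c.T) t (oneL2 c.T),
      inner_chi_left t _ (oneOp c 0 (U - _)), chi_oneOp_sub_chi, real_inner_smul_right,
      inner_chi_one ht, chi_idem]
  rw [condGradient, hut, two_lambda_greedy hθ hL hε hLε ht x z hu, h1, h2]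
  simp only [map_sub, inner_sub_right, chi_idem]
  ring

/-- The constant in the bound of the conditional gradient. -/
def gradConst (c : Constants) (L ε : ℝ) : ℝ :=
  (2 * c.ϱ * ‖oneL2 c.T‖ + L + 2 * c.φ * (‖oneL2 c.T‖ * ‖oneOp c 0‖)) / (2 * L⁻¹ - ε)

theorem gradConst_nonneg (hL : 0 < L) (hLε : 0 < 2 * L⁻¹ - ε) : 0 ≤ gradConst c L ε := by
  have := c.ϱ_nonneg
  have := c.φ_nonneg
  unfold gradConst
  positivity

/-- Closes the loop: the current gradient is bounded by the prediction error through
`condGradient_eq`, and the prediction error by the gradient on `[t,T]` through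
`Dop_chi_sub_predicted` and coercivity. The present is controlled by the future, which is the form
needed for a backward Gronwall argument. -/
theorem abs_condGradient_le (hθ : θ ∈ admissibleParams c.T L ε) (hL : 0 < L) (hε : 0 ≤ ε)
    (hLε : 0 < 2 * L⁻¹ - ε) {t : ℝ} (ht : t ∈ Icc 0 c.T) (x : ℝ) (z : L2 c.T) {u : ℝ → ℝ}
    {U w : L2 c.T} (hu : u =ᵐ[leb c.T] U) (hw : w - chi c.T t w = U - chi c.T t U) {ut : ℝ}
    (hut : ut = aCoef c θ t x z + ∫ s in (0 : ℝ)..t, Bcoef c θ t s * u s) :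
    |condGradient c θ t x ut U w| ≤
      gradConst c L ε * ‖chi c.T t (z + driftVec c - Dop c θ 0 w)‖ := by
  rw [condGradient_eq hθ hL hε hLε ht x z hu hw hut]
  set e := chi c.T t w - predicted c θ t z U with he
  have h1 : (2 * L⁻¹ - ε) * ‖e‖ ≤ ‖chi c.T t (z + driftVec c - Dop c θ 0 w)‖ := by
    refine (norm_le_of_Dop hθ hε t e).trans (le_of_eq ?_)
    rw [he, Dop_chi_sub_predicted hθ hε hLε t z hw, norm_neg]
  have h2 : |inner ℝ (kvec c θ t) e| ≤ (2 * c.ϱ * ‖oneL2 c.T‖ + L) * ‖e‖ := by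
    refine (abs_real_inner_le_norm _ _).trans ?_
    gcongr
    exact (norm_kvec_le c θ ht.1).trans (by linarith [hθ.2.2.1])
  have h3 : |inner ℝ (chi c.T t (oneL2 c.T)) (oneOp c 0 (chi c.T t e))| ≤
      ‖oneL2 c.T‖ * ‖oneOp c 0‖ * ‖e‖ := by
    refine (abs_real_inner_le_norm _ _).trans ?_
    rw [mul_assoc]
    gcongr
    · exact chi_norm_le _ _
    · exact ((oneOp c 0).le_opNorm _).trans
        (mul_le_mul_of_nonneg_left (chi_norm_le _ _) (norm_nonneg _))
  have h4 := c.φ_nonneg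
  have h5 : |-inner ℝ (kvec c θ t) e - 2 * c.φ * inner ℝ (chi c.T t (oneL2 c.T))
      (oneOp c 0 (chi c.T t e))| ≤ (2 * c.ϱ * ‖oneL2 c.T‖ + L +
        2 * c.φ * (‖oneL2 c.T‖ * ‖oneOp c 0‖)) * ‖e‖ := by
    refine (abs_sub _ _).trans ?_
    rw [abs_neg, abs_mul, abs_of_nonneg (by positivity : 0 ≤ 2 * c.φ)]
    have := mul_le_mul_of_nonneg_left h3 (by positivity : 0 ≤ 2 * c.φ)
    linarith
  refine h5.trans ?_
  rw [gradConst, div_mul_eq_mul_div, le_div_iff₀ hLε, mul_assoc]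
  have := c.ϱ_nonneg
  refine mul_le_mul_of_nonneg_left ?_ (by positivity)
  rw [mul_comm]; exact h1

/-- The unconditional gradient, in `L²([0,T])`, is represented by the pointwise formula. -/
theorem gradient_ae_eq (c : Constants) (θ : Param c.T) (z U : L2 c.T) :
    (z + driftVec c - Dop c θ 0 U : L2 c.T) =ᵐ[leb c.T] fun t =>
      condGradient c θ t (z t) (U t) U U := by
  have hI := adjoint_oneOp_zero_apply c
  have hI' : ∀ x : L2 c.T, ContinuousLinearMap.adjoint (oneOp c 0) x =ᵐ[leb c.T] fun t =>
      inner ℝ (chi c.T t (oneL2 c.T)) x := by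
    intro x
    filter_upwards [hI x] with t ht
    rw [ht, inner_chi_left, inner_oneL2]
    refine integral_congr_ae ?_
    filter_upwards [chi_coe t x] with s hs
    rw [hs]
    by_cases h : t ≤ s <;> simp [h]
  rw [driftVec, Dop_apply]
  filter_upwards [Lp.coeFn_sub (z + ((2 * c.ϱ * c.q) • oneL2 c.T +
      (2 * c.φ * c.q) • ContinuousLinearMap.adjoint (oneOp c 0) (oneL2 c.T)))
      ((2 * θ.1) • U + (GtildeOp c θ 0 U + ContinuousLinearMap.adjoint (GtildeOp c θ 0) U) +
        (2 * c.φ) • ContinuousLinearMap.adjoint (oneOp c 0) (oneOp c 0 U)),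
    Lp.coeFn_add z ((2 * c.ϱ * c.q) • oneL2 c.T +
      (2 * c.φ * c.q) • ContinuousLinearMap.adjoint (oneOp c 0) (oneL2 c.T)),
    Lp.coeFn_add ((2 * c.ϱ * c.q) • oneL2 c.T)
      ((2 * c.φ * c.q) • ContinuousLinearMap.adjoint (oneOp c 0) (oneL2 c.T)),
    Lp.coeFn_smul (2 * c.ϱ * c.q) (oneL2 c.T),
    Lp.coeFn_smul (2 * c.φ * c.q) (ContinuousLinearMap.adjoint (oneOp c 0) (oneL2 c.T)),
    Lp.coeFn_add ((2 * θ.1) • U + (GtildeOp c θ 0 U + ContinuousLinearMap.adjoint (GtildeOp c θ 0) U))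
      ((2 * c.φ) • ContinuousLinearMap.adjoint (oneOp c 0) (oneOp c 0 U)),
    Lp.coeFn_add ((2 * θ.1) • U)
      (GtildeOp c θ 0 U + ContinuousLinearMap.adjoint (GtildeOp c θ 0) U),
    Lp.coeFn_add (GtildeOp c θ 0 U) (ContinuousLinearMap.adjoint (GtildeOp c θ 0) U),
    Lp.coeFn_smul (2 * θ.1) U,
    Lp.coeFn_smul (2 * c.φ) (ContinuousLinearMap.adjoint (oneOp c 0) (oneOp c 0 U)),
    hI' (oneL2 c.T), hI' (oneOp c 0 U), GtildeOp_zero_apply c θ U,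
    adjoint_GtildeOp_zero_apply c θ U, oneL2_coe c.T, ae_leb_mem c.T]
    with t h1 h2 h3 h4 h5 h6 h7 h8 h9 h10 h11 h12 h13 h14 h15 ht
  rw [h1, Pi.sub_apply, h2, Pi.add_apply, h3, Pi.add_apply, h4, h5, h6, Pi.add_apply, h7,
    Pi.add_apply, h8, Pi.add_apply, h9, h10]
  simp only [Pi.smul_apply, smul_eq_mul]
  rw [h11, h12, h13, h14, h15, condGradient, inner_kvec c θ ht.1]
  rw [show inner ℝ (chi c.T t (oneL2 c.T)) (oneL2 c.T) = c.T - t by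
    rw [← inner_chi_one ht, inner_chi_left t _ (chi c.T t _), chi_idem, inner_chi_left]]
  ring

end Greedy

end Liquidation

namespace Liquidation

/-! ### Random elements of `L²([0,T])` -/

section Pairing

variable {Ω : Type*} [mΩ : MeasurableSpace Ω] {P : Measure Ω} [IsProbabilityMeasure P] {T : ℝ}

theorem measurable_ev_prod {Y : Ω → L2 T} (hY : Measurable Y) :
    Measurable fun z : ℝ × Ω => ev (Y z.2) z.1 :=
  measurable_ev_comp (hY.comp measurable_snd) measurable_fst

theorem enorm_sq_L2_eq (x : L2 T) : ‖x‖ₑ ^ 2 = ∫⁻ t, ‖ev x t‖ₑ ^ 2 ∂(leb T) := by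
  have h1 := integral_sq_eq_toReal_lintegral (Lp.aestronglyMeasurable x)
  rw [← norm_sq_L2_eq] at h1
  have h2 : ∫⁻ t, ‖ev x t‖ₑ ^ 2 ∂(leb T) = ∫⁻ t, ‖x t‖ₑ ^ 2 ∂(leb T) :=
    lintegral_congr_ae ((ev_ae_eq x).mono fun t ht => by simp only [ht])
  rw [h2, ← ENNReal.ofReal_toReal (lintegral_sq_lt_top (Lp.memLp x)).ne, ← h1,
    ENNReal.ofReal_pow (norm_nonneg _), ofReal_norm]

theorem memLp_ev_prod {Y : Ω → L2 T} (hY : Measurable Y) (hY2 : MemLp Y 2 P) :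
    MemLp (fun z : ℝ × Ω => ev (Y z.2) z.1) 2 ((leb T).prod P) := by
  refine memLp_two_of_lintegral (measurable_ev_prod hY).aestronglyMeasurable ?_
  rw [lintegral_prod_symm _ ((measurable_ev_prod hY).enorm.pow_const 2).aemeasurable]
  simp only [← enorm_sq_L2_eq]
  have := (eLpNorm_lt_top_iff_lintegral_rpow_enorm_lt_top (f := Y) (μ := P) (p := 2) (by norm_num)
    (by norm_num)).1 hY2.2
  simpa using this

theorem memLp_prod_section {f : ℝ × Ω → ℝ} (hf : MemLp f 2 ((leb T).prod P)) :
    ∀ᵐ t ∂(leb T), MemLp (fun ω => f (t, ω)) 2 P := by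
  have hsq := (memLp_two_iff_integrable_sq hf.1).1 hf
  filter_upwards [hf.1.prodMk_left, hsq.prod_right_ae] with s h1 h2
  exact (memLp_two_iff_integrable_sq h1).2 h2

theorem memLp_prod_section' {f : ℝ × Ω → ℝ} (hf : MemLp f 2 ((leb T).prod P)) :
    ∀ᵐ ω ∂P, MemLp (fun t => f (t, ω)) 2 (leb T) := by
  have hf' : MemLp (fun z : Ω × ℝ => f z.swap) 2 (P.prod (leb T)) :=
    hf.comp_measurePreserving Measure.measurePreserving_swap
  have hsq := (memLp_two_iff_integrable_sq hf'.1).1 hf'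
  filter_upwards [hf'.1.prodMk_left, hsq.prod_right_ae] with s h1 h2
  exact (memLp_two_iff_integrable_sq h1).2 h2

theorem inner_L2_eq_ev (x y : L2 T) : inner ℝ x y = ∫ t, ev x t * ev y t ∂(leb T) := by
  rw [inner_L2_eq]
  refine integral_congr_ae ?_
  filter_upwards [ev_ae_eq x, ev_ae_eq y] with t h1 h2
  rw [h1, h2]

theorem integral_inner_eq {Y V : Ω → L2 T} (hY : Measurable Y) (hY2 : MemLp Y 2 P)
    (hV : Measurable V) (hV2 : MemLp V 2 P) :
    ∫ ω, inner ℝ (Y ω) (V ω) ∂P = ∫ t, ∫ ω, ev (Y ω) t * ev (V ω) t ∂P ∂(leb T) := by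
  have h : Integrable (fun z : ℝ × Ω => ev (Y z.2) z.1 * ev (V z.2) z.1) ((leb T).prod P) :=
    (memLp_ev_prod hY hY2).integrable_mul (memLp_ev_prod hV hV2)
  rw [integral_integral_swap h]
  simp only [inner_L2_eq_ev]

theorem integrable_integral_ev_mul {Y V : Ω → L2 T} (hY : Measurable Y) (hY2 : MemLp Y 2 P)
    (hV : Measurable V) (hV2 : MemLp V 2 P) :
    Integrable (fun t => ∫ ω, ev (Y ω) t * ev (V ω) t ∂P) (leb T) :=
  Integrable.integral_prod_left (f := fun z : ℝ × Ω => ev (Y z.2) z.1 * ev (V z.2) z.1)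
    ((memLp_ev_prod hY hY2).integrable_mul (memLp_ev_prod hV hV2))

theorem integral_norm_sq_eq {Y : Ω → L2 T} (hY : Measurable Y) (hY2 : MemLp Y 2 P) :
    ∫ ω, ‖Y ω‖ ^ 2 ∂P = ∫ t, ∫ ω, ev (Y ω) t ^ 2 ∂P ∂(leb T) := by
  have h := integral_inner_eq hY hY2 hY hY2
  simp only [real_inner_self_eq_norm_sq] at h
  simpa only [← sq] using h

theorem integral_condExp_mul {𝒢 : MeasurableSpace Ω} (h𝒢 : 𝒢 ≤ mΩ) {X Y : Ω → ℝ}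
    (hX : MemLp X 2 P) (hY : MemLp Y 2 P) (hYm : AEStronglyMeasurable[𝒢] Y P) :
    ∫ ω, X ω * Y ω ∂P = ∫ ω, (P[X | 𝒢]) ω * Y ω ∂P := by
  rw [← integral_condExp h𝒢]
  exact integral_congr_ae (condExp_mul_of_aestronglyMeasurable_right hYm
    (hX.integrable_mul hY) (hX.integrable (by norm_num)))

/-- Pathwise this is an identity for almost every `t`. Exchanging the two quantifiers requires a
measurable exceptional set, which joint measurability of `ev` provides. -/
theorem ae_ev_toL2 {f : ℝ → Ω → ℝ} (hf : Measurable (Function.uncurry f))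
    (hf2 : ∀ᵐ ω ∂P, MemLp (fun t => f t ω) 2 (leb T)) :
    ∀ᵐ t ∂(leb T), ∀ᵐ ω ∂P, ev (toL2 T fun s => f s ω) t = f t ω := by
  rw [Measure.ae_ae_comm]
  · filter_upwards [hf2] with ω hω
    exact ev_ae_eq_of_eq hω
  · refine measurableSet_eq_fun ?_ hf
    exact measurable_ev_prod (measurable_toL2 (f := fun ω t => f t ω) (hf.comp measurable_swap))

theorem memLp_toL2 {f : ℝ → Ω → ℝ} (hf : Measurable (Function.uncurry f))
    (hf2 : MemLp (Function.uncurry f) 2 ((leb T).prod P)) :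
    MemLp (fun ω => toL2 T fun s => f s ω) 2 P := by
  have hm : Measurable fun ω => toL2 T fun s => f s ω :=
    measurable_toL2 (f := fun ω t => f t ω) (hf.comp measurable_swap)
  refine ⟨hm.aestronglyMeasurable, ?_⟩
  rw [eLpNorm_lt_top_iff_lintegral_rpow_enorm_lt_top (by norm_num) (by norm_num)]
  simp only [ENNReal.toReal_ofNat, ENNReal.rpow_ofNat]
  refine lt_of_le_of_lt (le_of_eq ?_) (lintegral_sq_lt_top hf2)
  rw [lintegral_prod_symm _ (hf.enorm.pow_const 2).aemeasurable]
  refine lintegral_congr_ae ?_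
  filter_upwards [memLp_prod_section' hf2] with ω hω
  rw [enorm_sq_L2_eq]
  refine lintegral_congr_ae ((ev_ae_eq_of_eq hω).mono fun t ht => ?_)
  exact congrArg (fun a : ℝ => ‖a‖ₑ ^ 2) ht

variable {𝒢 : ℝ → MeasurableSpace Ω} {g V : Ω → L2 T}

theorem integral_inner_eq_condExp (h𝒢 : ∀ t ∈ Icc 0 T, 𝒢 t ≤ mΩ) (hg : Measurable g)
    (hg2 : MemLp g 2 P) (hV : Measurable V) (hV2 : MemLp V 2 P)
    (hVm : ∀ᵐ t ∂(leb T), AEStronglyMeasurable[𝒢 t] (fun ω => ev (V ω) t) P) :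
    ∀ᵐ t ∂(leb T), ∫ ω, ev (g ω) t * ev (V ω) t ∂P =
      ∫ ω, (P[fun ω => ev (g ω) t | 𝒢 t]) ω * ev (V ω) t ∂P := by
  filter_upwards [hVm, ae_leb_mem T, memLp_prod_section (memLp_ev_prod hg hg2),
    memLp_prod_section (memLp_ev_prod hV hV2)] with t h1 h2 h3 h4
  exact integral_condExp_mul (h𝒢 t h2) h3 h4 h1

theorem integral_inner_eq_zero_of_condExp (h𝒢 : ∀ t ∈ Icc 0 T, 𝒢 t ≤ mΩ) (hg : Measurable g)
    (hg2 : MemLp g 2 P) (hV : Measurable V) (hV2 : MemLp V 2 P)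
    (hVm : ∀ᵐ t ∂(leb T), AEStronglyMeasurable[𝒢 t] (fun ω => ev (V ω) t) P)
    (h0 : ∀ᵐ t ∂(leb T), P[fun ω => ev (g ω) t | 𝒢 t] =ᵐ[P] 0) :
    ∫ ω, inner ℝ (g ω) (V ω) ∂P = 0 := by
  rw [integral_inner_eq hg hg2 hV hV2]
  refine integral_eq_zero_of_ae ?_
  filter_upwards [integral_inner_eq_condExp h𝒢 hg hg2 hV hV2 hVm, h0] with t h1 h2
  rw [h1]
  refine integral_eq_zero_of_ae ?_
  filter_upwards [h2] with ω hω
  rw [hω]; simp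

/-- Conditioning at each time followed by Young's inequality. At times where `V` vanishes no bound
on the conditional expectation of `g` is needed, so `p` may be supported where `V` is. -/
theorem integral_inner_le_of_condExp (h𝒢 : ∀ t ∈ Icc 0 T, 𝒢 t ≤ mΩ) (hg : Measurable g)
    (hg2 : MemLp g 2 P) (hV : Measurable V) (hV2 : MemLp V 2 P)
    (hVm : ∀ᵐ t ∂(leb T), AEStronglyMeasurable[𝒢 t] (fun ω => ev (V ω) t) P)
    {p : ℝ → ℝ} (hp : Integrable p (leb T)) (hp0 : ∀ᵐ t ∂(leb T), 0 ≤ p t)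
    (hle : ∀ᵐ t ∂(leb T), (∀ᵐ ω ∂P, ev (V ω) t = 0) ∨
      ∫ ω, ((P[fun ω => ev (g ω) t | 𝒢 t]) ω) ^ 2 ∂P ≤ p t) :
    ∫ ω, inner ℝ (g ω) (V ω) ∂P ≤
      1 / 2 * ∫ ω, ‖V ω‖ ^ 2 ∂P + 1 / 2 * ∫ t, p t ∂(leb T) := by
  rw [integral_inner_eq hg hg2 hV hV2, integral_norm_sq_eq hV hV2, ← integral_const_mul,
    ← integral_const_mul]
  have hi : Integrable (fun t => ∫ ω, ev (V ω) t ^ 2 ∂P) (leb T) := by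
    simp only [sq]; exact integrable_integral_ev_mul hV hV2 hV hV2
  rw [← integral_add (hi.const_mul _) (hp.const_mul _)]
  refine integral_mono_ae (integrable_integral_ev_mul hg hg2 hV hV2)
    ((hi.const_mul _).add (hp.const_mul _)) ?_
  filter_upwards [integral_inner_eq_condExp h𝒢 hg hg2 hV hV2 hVm, hp0, hle,
    memLp_prod_section (memLp_ev_prod hg hg2), memLp_prod_section (memLp_ev_prod hV hV2)]
    with t h1 h2 h3 h4 h5
  have h7 : 0 ≤ ∫ ω, ev (V ω) t ^ 2 ∂P := integral_nonneg fun ω => sq_nonneg _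
  rcases h3 with h3 | h3
  · have h6 : ∫ ω, ev (g ω) t * ev (V ω) t ∂P = 0 := by
      refine integral_eq_zero_of_ae ?_
      filter_upwards [h3] with ω hω
      rw [hω]; simp
    rw [h6]
    change 0 ≤ 1 / 2 * (∫ ω, ev (V ω) t ^ 2 ∂P) + 1 / 2 * p t
    positivity
  · rw [h1]
    have h6 : MemLp (P[fun ω => ev (g ω) t | 𝒢 t]) 2 P := MemLp.condExp (by norm_num) h4
    calc _ ≤ ∫ ω, (1 / 2 * (ev (V ω) t) ^ 2 +
          1 / 2 * ((P[fun ω => ev (g ω) t | 𝒢 t]) ω) ^ 2) ∂P := by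
          refine integral_mono (h6.integrable_mul h5)
            ((h5.integrable_sq.const_mul _).add (h6.integrable_sq.const_mul _)) fun ω => ?_
          have := sq_nonneg (ev (V ω) t - (P[fun ω => ev (g ω) t | 𝒢 t]) ω)
          change (P[fun ω => ev (g ω) t | 𝒢 t]) ω * ev (V ω) t ≤ _
          nlinarith
      _ = 1 / 2 * ∫ ω, ev (V ω) t ^ 2 ∂P +
          1 / 2 * ∫ ω, ((P[fun ω => ev (g ω) t | 𝒢 t]) ω) ^ 2 ∂P := by
          rw [integral_add (h5.integrable_sq.const_mul _) (h6.integrable_sq.const_mul _),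
            integral_const_mul, integral_const_mul]
      _ ≤ _ := by
          change _ ≤ 1 / 2 * (∫ ω, ev (V ω) t ^ 2 ∂P) + 1 / 2 * p t
          linarith

end Pairing

/-! ### A backward Gronwall argument -/

/-- The rate `2K + 1` is chosen so that `K / (2K + 1) ≤ 1/2`: one application of the integral
operator halves the exponential weight. -/
theorem integral_exp_backward_le {K T s : ℝ} (hK : 0 ≤ K) :
    K * ∫ r in s..T, Real.exp ((2 * K + 1) * (T - r)) ≤
      1 / 2 * Real.exp ((2 * K + 1) * (T - s)) := by
  have hβ : (0 : ℝ) < 2 * K + 1 := by positivity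
  have h : ∫ r in s..T, Real.exp ((2 * K + 1) * (T - r)) =
      (Real.exp ((2 * K + 1) * (T - s)) - 1) / (2 * K + 1) := by
    have hd : ∀ r ∈ uIcc s T, HasDerivAt
        (fun r => -(Real.exp ((2 * K + 1) * (T - r)) / (2 * K + 1)))
        (Real.exp ((2 * K + 1) * (T - r))) r := by
      intro r _
      have h1 : HasDerivAt (fun r => (2 * K + 1) * (T - r)) ((2 * K + 1) * (-1)) r :=
        ((hasDerivAt_id r).const_sub T).const_mul _
      refine (h1.exp.div_const (2 * K + 1)).neg.congr_deriv ?_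
      rw [mul_neg_one, mul_neg, neg_div, neg_neg, mul_div_cancel_right₀ _ hβ.ne']
    rw [intervalIntegral.integral_eq_sub_of_hasDerivAt hd
      (Continuous.intervalIntegrable (by fun_prop) _ _)]
    simp
    ring
  rw [h, ← mul_div_assoc, div_le_iff₀ hβ]
  have := Real.exp_pos ((2 * K + 1) * (T - s))
  nlinarith

/-- A Gronwall argument that does not ask `h` to be measurable: the integral inequality is only
applied to continuous majorants `p`. Starting from the exponential majorant with constant `H`, each
step halves the constant. -/
theorem eq_zero_of_backward_bound {T K H : ℝ} (hK : 0 ≤ K) (hH : 0 ≤ H) {h : ℝ → ℝ}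
    (h0 : ∀ s ∈ Icc 0 T, 0 ≤ h s) (hbd : ∀ s ∈ Icc 0 T, h s ≤ H)
    (hstep : ∀ p : ℝ → ℝ, Continuous p → (∀ r, 0 ≤ p r) → (∀ r ∈ Icc 0 T, h r ≤ p r) →
      ∀ s ∈ Icc 0 T, h s ≤ K * ∫ r in s..T, p r) :
    ∀ s ∈ Icc 0 T, h s = 0 := by
  have key : ∀ n : ℕ, ∀ s ∈ Icc 0 T,
      h s ≤ H * (1 / 2) ^ n * Real.exp ((2 * K + 1) * (T - s)) := by
    intro n
    induction n with
    | zero =>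
      intro s hs
      rw [pow_zero, mul_one]
      have : 1 ≤ Real.exp ((2 * K + 1) * (T - s)) :=
        Real.one_le_exp (mul_nonneg (by positivity) (by linarith [hs.2]))
      nlinarith [hbd s hs]
    | succ n ih =>
      intro s hs
      refine (hstep _ (by fun_prop) (fun r => by positivity) ih s hs).trans ?_
      rw [intervalIntegral.integral_const_mul, mul_left_comm, pow_succ,
        ← mul_assoc H ((1 / 2) ^ n) (1 / 2), mul_assoc (H * (1 / 2) ^ n) (1 / 2)]
      exact mul_le_mul_of_nonneg_left (integral_exp_backward_le hK) (by positivity)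
  intro s hs
  refine le_antisymm ?_ (h0 s hs)
  have hlim : Tendsto (fun n : ℕ => H * (1 / 2) ^ n * Real.exp ((2 * K + 1) * (T - s))) atTop
      (𝓝 (H * 0 * Real.exp ((2 * K + 1) * (T - s)))) :=
    ((tendsto_pow_atTop_nhds_zero_of_lt_one (by norm_num) (by norm_num)).const_mul H).mul_const _
  rw [mul_zero, zero_mul] at hlim
  exact ge_of_tendsto hlim (Eventually.of_forall fun n => key n s hs)

end Liquidation

namespace Liquidation

/-! ### Jointly measurable versions of the gradient -/

theorem ae_translate_left {T t : ℝ} (ht : t ≤ T) {q : ℝ → Prop} (hq : ∀ᵐ r ∂(leb T), q r) :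
    ∀ᵐ s ∂(leb T), s < t → q (t - s) := by
  obtain ⟨N, hN, hNm, hN0⟩ := exists_measurable_superset_of_null (ae_iff.1 hq)
  have h1 := lintegral_translate_left_le (T := T) (f := N.indicator 1) ht
  rw [lintegral_indicator_one hNm, hN0, nonpos_iff_eq_zero, lintegral_eq_zero_iff] at h1
  · filter_upwards [h1] with s hs hst
    by_contra hq'
    have : t - s ∈ N := hN hq'
    simp [hst, this] at hs
  · exact Measurable.ite (measurableSet_lt measurable_id measurable_const)
      ((measurable_one.indicator hNm).comp (measurable_const.sub measurable_id)) measurable_const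

theorem ae_translate_right {T t : ℝ} (ht : 0 ≤ t) {q : ℝ → Prop} (hq : ∀ᵐ r ∂(leb T), q r) :
    ∀ᵐ s ∂(leb T), t < s → q (s - t) := by
  obtain ⟨N, hN, hNm, hN0⟩ := exists_measurable_superset_of_null (ae_iff.1 hq)
  have h1 := lintegral_translate_right_le (T := T) (f := N.indicator 1) ht
  rw [lintegral_indicator_one hNm, hN0, nonpos_iff_eq_zero, lintegral_eq_zero_iff] at h1
  · filter_upwards [h1] with s hs hst
    by_contra hq'
    have : s - t ∈ N := hN hq'
    simp [hst, this] at hs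
  · exact Measurable.ite (measurableSet_lt measurable_const measurable_id)
      ((measurable_one.indicator hNm).comp (measurable_id.sub_const t)) measurable_const

/-- A version of `G̃` which is jointly measurable in the parameter and the time variables. -/
def GtildeEv (c : Constants) (θ : Param c.T) (t s : ℝ) : ℝ :=
  if s < t then 2 * c.ϱ + ev θ.2 (t - s) else 0

theorem measurable_GtildeEv (c : Constants) :
    Measurable fun z : Param c.T × ℝ × ℝ => GtildeEv c z.1 z.2.1 z.2.2 :=
  Measurable.ite (measurableSet_lt measurable_snd.snd measurable_snd.fst)
    (measurable_const.add (measurable_ev_comp measurable_fst.snd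
      (measurable_snd.fst.sub measurable_snd.snd))) measurable_const

variable {c : Constants}

theorem Gtilde_ae_eq_left (θ : Param c.T) {t : ℝ} (ht : t ≤ c.T) :
    ∀ᵐ s ∂(leb c.T), Gtilde c θ t s = GtildeEv c θ t s := by
  filter_upwards [ae_translate_left ht (ev_ae_eq θ.2)] with s hs
  rw [Gtilde, GtildeEv]
  split_ifs with h
  · rw [hs h]
  · rfl

theorem Gtilde_ae_eq_right (θ : Param c.T) {t : ℝ} (ht : 0 ≤ t) :
    ∀ᵐ s ∂(leb c.T), Gtilde c θ s t = GtildeEv c θ s t := by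
  filter_upwards [ae_translate_right ht (ev_ae_eq θ.2)] with s hs
  rw [Gtilde, GtildeEv]
  split_ifs with h
  · rw [hs h]
  · rfl

theorem integral_Gtilde_eq_ev (θ : Param c.T) {t : ℝ} (ht : t ≤ c.T) (x : L2 c.T) :
    ∫ s, Gtilde c θ t s * x s ∂(leb c.T) = ∫ s, GtildeEv c θ t s * ev x s ∂(leb c.T) := by
  refine integral_congr_ae ?_
  filter_upwards [Gtilde_ae_eq_left θ ht, ev_ae_eq x] with s h1 h2
  rw [h1, h2]

theorem inner_kvec_eq_ev (θ : Param c.T) {t : ℝ} (ht : 0 ≤ t) (x : L2 c.T) :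
    inner ℝ (kvec c θ t) x = ∫ s, GtildeEv c θ s t * ev x s ∂(leb c.T) := by
  rw [inner_kvec c θ ht]
  refine integral_congr_ae ?_
  filter_upwards [Gtilde_ae_eq_right θ ht, ev_ae_eq x] with s h1 h2
  rw [h1, h2]

theorem measurable_integral_leb {α : Type*} [MeasurableSpace α] {T : ℝ} {f : α × ℝ → ℝ}
    (hf : Measurable f) : Measurable fun a => ∫ s, f (a, s) ∂(leb T) :=
  (hf.stronglyMeasurable.integral_prod_right').measurable

theorem measurable_integral_GtildeEv_left (c : Constants) : Measurable
    fun z : Param c.T × L2 c.T × ℝ => ∫ s, GtildeEv c z.1 z.2.2 s * ev z.2.1 s ∂(leb c.T) := by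
  refine measurable_integral_leb
    (f := fun y : (Param c.T × L2 c.T × ℝ) × ℝ => GtildeEv c y.1.1 y.1.2.2 y.2 * ev y.1.2.1 y.2) ?_
  exact ((measurable_GtildeEv c).comp (measurable_fst.fst.prodMk
    (measurable_fst.snd.snd.prodMk measurable_snd))).mul
    (measurable_ev_comp measurable_fst.snd.fst measurable_snd)

theorem measurable_integral_GtildeEv_right (c : Constants) : Measurable
    fun z : Param c.T × L2 c.T × ℝ => ∫ s, GtildeEv c z.1 s z.2.2 * ev z.2.1 s ∂(leb c.T) := by
  refine measurable_integral_leb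
    (f := fun y : (Param c.T × L2 c.T × ℝ) × ℝ => GtildeEv c y.1.1 y.2 y.1.2.2 * ev y.1.2.1 y.2) ?_
  exact ((measurable_GtildeEv c).comp (measurable_fst.fst.prodMk
    (measurable_snd.prodMk measurable_fst.snd.snd))).mul
    (measurable_ev_comp measurable_fst.snd.fst measurable_snd)

theorem measurable_kvec {t : ℝ} (ht : 0 ≤ t) : Measurable fun θ : Param c.T => kvec c θ t := by
  have h : (fun θ : Param c.T => kvec c θ t) = fun θ => toL2 c.T fun s => GtildeEv c θ s t := by
    ext1 θ
    rw [kvec]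
    refine toL2_congr ?_
    filter_upwards [Gtilde_ae_eq_right θ ht] with s hs
    rw [← hs, indicator]
    split_ifs with h
    · rfl
    · rw [Gtilde, if_neg (fun h' => h (le_of_lt h'))]
  rw [h]
  exact measurable_toL2 ((measurable_GtildeEv c).comp
    (measurable_fst.prodMk (measurable_snd.prodMk measurable_const)))

/-- A jointly measurable version of the unconditional gradient. -/
def gradientEv (c : Constants) (θ : Param c.T) (t x ut : ℝ) (U : L2 c.T) : ℝ :=
  x + (2 * c.ϱ * c.q + 2 * c.φ * c.q * (c.T - t)) - 2 * θ.1 * ut -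
    (∫ s, GtildeEv c θ t s * ev U s ∂(leb c.T)) - (∫ s, GtildeEv c θ s t * ev U s ∂(leb c.T)) -
    2 * c.φ * ∫ s, (if t ≤ s then 1 else 0) * ev (oneOp c 0 U) s ∂(leb c.T)

theorem condGradient_eq_ev (θ : Param c.T) {t : ℝ} (ht : t ∈ Icc 0 c.T) (x ut : ℝ) (U : L2 c.T) :
    condGradient c θ t x ut U U = gradientEv c θ t x ut U := by
  have h : inner ℝ (chi c.T t (oneL2 c.T)) (oneOp c 0 U) =
      ∫ s, (if t ≤ s then 1 else 0) * ev (oneOp c 0 U) s ∂(leb c.T) := by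
    rw [inner_L2_eq]
    refine integral_congr_ae ?_
    filter_upwards [chi_coe t (oneL2 c.T), oneL2_coe c.T, ev_ae_eq (oneOp c 0 U)] with s h1 h2 h3
    rw [h1, h3, indicator, h2]
    rfl
  rw [condGradient, gradientEv, integral_Gtilde_eq_ev θ ht.2, inner_kvec_eq_ev θ ht.1, h]

theorem measurable_gradientEv {α : Type*} [MeasurableSpace α] {θ : α → Param c.T} {t x ut : α → ℝ}
    {U : α → L2 c.T} (hθ : Measurable θ) (ht : Measurable t) (hx : Measurable x)
    (hut : Measurable ut) (hU : Measurable U) :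
    Measurable fun a => gradientEv c (θ a) (t a) (x a) (ut a) (U a) := by
  have h1 := (measurable_integral_GtildeEv_left c).comp (hθ.prodMk (hU.prodMk ht))
  have h2 := (measurable_integral_GtildeEv_right c).comp (hθ.prodMk (hU.prodMk ht))
  have h3 : Measurable fun a => ∫ s, (if t a ≤ s then (1 : ℝ) else 0) * ev (oneOp c 0 (U a)) s
      ∂(leb c.T) := by
    refine measurable_integral_leb
      (f := fun y : α × ℝ => (if t y.1 ≤ y.2 then (1 : ℝ) else 0) * ev (oneOp c 0 (U y.1)) y.2) ?_
    exact (Measurable.ite (measurableSet_le (ht.comp measurable_fst) measurable_snd)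
      measurable_const measurable_const).mul (measurable_ev_comp
        ((oneOp c 0).continuous.measurable.comp (hU.comp measurable_fst)) measurable_snd)
  unfold gradientEv
  exact ((((hx.add (measurable_const.add ((measurable_const.sub ht).const_mul _))).sub
    ((hθ.fst.const_mul _).mul hut)).sub h1).sub h2).sub (h3.const_mul _)

theorem stronglyMeasurable_toL2_Iio {Ω : Type*} [MeasurableSpace Ω] {T : ℝ} {f : ℝ → Ω → ℝ}
    (h : Measurable fun z : ℝ × Ω => f z.1 z.2) (t : ℝ) :
    StronglyMeasurable fun ω => toL2 T ((Iio t).indicator fun s => f s ω) := by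
  refine (measurable_toL2 (f := fun ω => (Iio t).indicator fun s => f s ω) ?_).stronglyMeasurable
  have h1 : Measurable ({z : ℝ × Ω | z.1 < t}.indicator fun z => f z.1 z.2) :=
    h.indicator (measurable_fst measurableSet_Iio)
  exact h1.comp measurable_swap

/-! ### Controls as random elements of `L²([0,T])` -/

theorem measurable_indicator_of_subtype {Ω : Type*} [MeasurableSpace Ω] {t : ℝ} {u : ℝ → Ω → ℝ}
    (h : Measurable fun p : Icc 0 t × Ω => u p.1 p.2) :
    Measurable fun z : ℝ × Ω => (Icc 0 t).indicator (fun s => u s z.2) z.1 := by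
  classical
  have hs : MeasurableSet {z : ℝ × Ω | z.1 ∈ Icc 0 t} := measurable_fst measurableSet_Icc
  have h1 : Measurable fun z : {z : ℝ × Ω | z.1 ∈ Icc 0 t} => u z.1.1 z.1.2 :=
    h.comp ((measurable_subtype_coe.fst.subtype_mk (h := fun z => z.2)).prodMk
      measurable_subtype_coe.snd)
  convert Measurable.dite h1 (measurable_const (a := (0 : ℝ))) hs using 1
  ext z
  simp only [indicator, mem_ofPred_eq]
  split_ifs <;> rfl

section Control

variable {Ω : Type*} [mΩ : MeasurableSpace Ω] {P : Measure Ω} [IsProbabilityMeasure P] {T : ℝ}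
  {𝒢 : ℝ → MeasurableSpace Ω} {u : ℝ → Ω → ℝ}

/-- The trajectory of a control in `L²([0,T])`. -/
def path (T : ℝ) (u : ℝ → Ω → ℝ) (ω : Ω) : L2 T := toL2 T fun t => u t ω

theorem path_eq_indicator (ω : Ω) :
    path T u ω = toL2 T ((Icc 0 T).indicator fun t => u t ω) :=
  toL2_congr (ae_leb fun t ht => by rw [indicator_of_mem ht])

theorem measurable_path (h : Measurable fun z : ℝ × Ω => (Icc 0 T).indicator (fun s => u s z.2) z.1) :
    Measurable (path T u) := by
  have h1 : path T u = fun ω => toL2 T ((Icc 0 T).indicator fun t => u t ω) := by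
    ext1 ω; exact path_eq_indicator ω
  rw [h1]
  exact measurable_toL2 (f := fun ω => (Icc 0 T).indicator fun t => u t ω) (h.comp measurable_swap)

theorem memLp_path (h : Measurable fun z : ℝ × Ω => (Icc 0 T).indicator (fun s => u s z.2) z.1)
    (h2 : MemLp (fun z : ℝ × Ω => (Icc 0 T).indicator (fun s => u s z.2) z.1) 2 ((leb T).prod P)) :
    MemLp (path T u) 2 P := by
  have h1 : path T u = fun ω => toL2 T ((Icc 0 T).indicator fun t => u t ω) := by
    ext1 ω; exact path_eq_indicator ω
  rw [h1]
  exact memLp_toL2 (f := fun t ω => (Icc 0 T).indicator (fun t => u t ω) t) h h2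

theorem ae_memLp_of_prod
    (h2 : MemLp (fun z : ℝ × Ω => (Icc 0 T).indicator (fun s => u s z.2) z.1) 2 ((leb T).prod P)) :
    ∀ᵐ ω ∂P, MemLp (fun t => u t ω) 2 (leb T) := by
  filter_upwards [memLp_prod_section' h2] with ω hω
  exact hω.ae_eq (ae_leb fun t ht => by simp only [indicator_of_mem ht])

theorem ae_ev_path (h : Measurable fun z : ℝ × Ω => (Icc 0 T).indicator (fun s => u s z.2) z.1)
    (h2 : MemLp (fun z : ℝ × Ω => (Icc 0 T).indicator (fun s => u s z.2) z.1) 2 ((leb T).prod P)) :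
    ∀ᵐ t ∂(leb T), ∀ᵐ ω ∂P, ev (path T u ω) t = u t ω := by
  filter_upwards [ae_ev_toL2 (f := fun t ω => (Icc 0 T).indicator (fun t => u t ω) t) h
    (memLp_prod_section' h2), ae_leb_mem T] with t ht htm
  filter_upwards [ht] with ω hω
  rw [path_eq_indicator, hω, indicator_of_mem htm]

theorem memLp_indicator_of_lintegral
    (h : Measurable fun z : ℝ × Ω => (Icc 0 T).indicator (fun s => u s z.2) z.1)
    (h2 : ∫⁻ ω, ∫⁻ t, ‖u t ω‖ₑ ^ 2 ∂(leb T) ∂P < ∞) :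
    MemLp (fun z : ℝ × Ω => (Icc 0 T).indicator (fun s => u s z.2) z.1) 2 ((leb T).prod P) := by
  refine memLp_two_of_lintegral h.aestronglyMeasurable ?_
  rw [lintegral_prod_symm _ (h.enorm.pow_const 2).aemeasurable]
  refine lt_of_le_of_lt (le_of_eq (lintegral_congr fun ω => ?_)) h2
  exact lintegral_congr_ae (ae_leb fun t ht => by simp only [indicator_of_mem ht])

theorem IsControl.measurable_indicator (hu : IsControl T P 𝒢 u) {t : ℝ} (ht : t ∈ Icc 0 T) :
    @Measurable (ℝ × Ω) ℝ (@Prod.instMeasurableSpace _ _ inferInstance (𝒢 t)) _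
      fun z => (Icc 0 t).indicator (fun s => u s z.2) z.1 :=
  @measurable_indicator_of_subtype Ω (𝒢 t) t u (hu.progressive t ht)

theorem IsControl.measurable (hu : IsControl T P 𝒢 u) {t : ℝ} (ht : t ∈ Icc 0 T) :
    Measurable[𝒢 t] (u t) :=
  (hu.progressive t ht).comp
    (@measurable_prodMk_left _ _ _ (𝒢 t) (⟨t, ht.1, le_rfl⟩ : Icc 0 t))

theorem IsControl.measurable_prod (hu : IsControl T P 𝒢 u) (hT : 0 ≤ T)
    (h𝒢 : ∀ t ∈ Icc 0 T, 𝒢 t ≤ mΩ) :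
    Measurable fun z : ℝ × Ω => (Icc 0 T).indicator (fun s => u s z.2) z.1 :=
  (hu.measurable_indicator (right_mem_Icc.2 hT)).mono
    (sup_le_sup le_rfl (MeasurableSpace.comap_mono (h𝒢 T (right_mem_Icc.2 hT)))) le_rfl

theorem IsControl.memLp_prod (hu : IsControl T P 𝒢 u) (hT : 0 ≤ T)
    (h𝒢 : ∀ t ∈ Icc 0 T, 𝒢 t ≤ mΩ) :
    MemLp (fun z : ℝ × Ω => (Icc 0 T).indicator (fun s => u s z.2) z.1) 2 ((leb T).prod P) :=
  memLp_indicator_of_lintegral (hu.measurable_prod hT h𝒢) hu.sq_integrable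

/-- The path before `t` is known at `t`, but only up to a null event: the class of the whole path is
the default `0` when the path is not square integrable on `[0,T]`, which is not decided by time `t`.
-/
theorem IsControl.path_sub_chi (hu : IsControl T P 𝒢 u) (hT : 0 ≤ T)
    (h𝒢 : ∀ t ∈ Icc 0 T, 𝒢 t ≤ mΩ) {t : ℝ} (ht : t ∈ Icc 0 T) :
    AEStronglyMeasurable[𝒢 t] (fun ω => path T u ω - chi T t (path T u ω)) P := by
  refine ⟨_, @stronglyMeasurable_toL2_Iio Ω (𝒢 t) T
    (fun s ω => (Icc 0 t).indicator (fun s => u s ω) s) (hu.measurable_indicator ht) t, ?_⟩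
  filter_upwards [ae_memLp_of_prod (hu.memLp_prod hT h𝒢)] with ω hω
  refine Lp.ext ?_
  have h4 : MemLp ((Iio t).indicator fun s => u s ω) 2 (leb T) := hω.indicator measurableSet_Iio
  have h5 : toL2 T ((Iio t).indicator ((Icc 0 t).indicator fun s => u s ω)) =
      toL2 T ((Iio t).indicator fun s => u s ω) := by
    refine toL2_congr (ae_leb fun s hs => ?_)
    simp only [indicator]
    by_cases h : s < t
    · simp [h, hs.1, h.le]
    · simp [h]
  rw [h5]
  filter_upwards [coe_sub_chi t (path T u ω), coeFn_toL2 h4, coeFn_toL2 hω] with s h6 h7 h8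
  rw [h6, h7, path, h8]
  rfl

end Control

end Liquidation

namespace Liquidation

/-! ### The greedy strategy satisfies the first-order condition -/

section FirstOrder

variable {Ω : Type*} {ℱ : MeasurableSpace Ω} [mΩ : MeasurableSpace Ω] {P : Measure Ω}
  [IsProbabilityMeasure P] {c : Constants}

/-- The gradient of the objective with parameter `θ` at the strategy `u`. -/
def gradVec (c : Constants) (θ : Ω → Param c.T) (A u : ℝ → Ω → ℝ) (ω : Ω) : L2 c.T :=
  path c.T (fun s ω => A s ω - A c.T ω) ω + driftVec c - Dop c (θ ω) 0 (path c.T u ω)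

theorem exists_norm_Dop_le (c : Constants) (L ε : ℝ) :
    ∃ C, 0 ≤ C ∧ ∀ θ ∈ admissibleParams c.T L ε, ‖Dop c θ 0‖ ≤ C := by
  refine ⟨‖Dop c (0 : Param c.T) 0‖ + (2 * |L| + 2 * (√c.T * |L|)), by positivity, fun θ hθ => ?_⟩
  have h1 := norm_Dop_sub_le c θ 0 0
  have h2 : ‖Dop c θ 0‖ ≤ ‖Dop c (0 : Param c.T) 0‖ + ‖Dop c θ 0 - Dop c (0 : Param c.T) 0‖ := by
    have := norm_add_le (Dop c (0 : Param c.T) 0) (Dop c θ 0 - Dop c (0 : Param c.T) 0)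
    rwa [add_sub_cancel] at this
  refine h2.trans (add_le_add_right (h1.trans ?_) _)
  have h3 : |θ.1| ≤ |L| := by
    have hL : 0 ≤ L := (norm_nonneg _).trans hθ.2.2.1
    have : 0 ≤ θ.1 := (inv_nonneg.2 hL).trans hθ.1
    rw [abs_of_nonneg this, abs_of_nonneg hL]
    exact hθ.2.1
  have h4 : ‖θ.2‖ ≤ |L| := hθ.2.2.1.trans (le_abs_self L)
  simp only [Prod.fst_zero, Prod.snd_zero, sub_zero]
  gcongr

variable {𝒢 : ℝ → MeasurableSpace Ω} {A u : ℝ → Ω → ℝ}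
  {θ : Ω → Param c.T} {E : Set Ω} {L ε : ℝ}

/-- The standing assumptions on information, signal, parameter and control. -/
structure Setting {Ω : Type*} (ℱ : MeasurableSpace Ω) [mΩ : MeasurableSpace Ω] (c : Constants)
    (P : Measure Ω) (𝒢 : ℝ → MeasurableSpace Ω) (A u : ℝ → Ω → ℝ) (θ : Ω → Param c.T) (L ε : ℝ) : Prop where
  le : ∀ t ∈ Icc 0 c.T, 𝒢 t ≤ mΩ
  mono : ∀ s ∈ Icc 0 c.T, ∀ t ∈ Icc 0 c.T, s ≤ t → 𝒢 s ≤ 𝒢 t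
  initial : ∀ t ∈ Icc 0 c.T, ℱ ≤ 𝒢 t
  meas_A : Measurable fun z : ℝ × Ω =>
    (Icc 0 c.T).indicator (fun s => A s z.2 - A c.T z.2) z.1
  memLp_A : MemLp (fun z : ℝ × Ω => (Icc 0 c.T).indicator (fun s => A s z.2 - A c.T z.2) z.1) 2
    ((leb c.T).prod P)
  control : IsControl c.T P 𝒢 u
  meas_θ : Measurable[ℱ] θ
  mem_θ : ∀ ω, θ ω ∈ admissibleParams c.T L ε
  L_pos : 0 < L
  ε_nonneg : 0 ≤ ε
  coercive : 0 < 2 * L⁻¹ - ε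

namespace Setting

variable (S : Setting ℱ c P 𝒢 A u θ L ε)
include S

theorem T_mem : c.T ∈ Icc 0 c.T := right_mem_Icc.2 c.T_pos.le

theorem le_base : ℱ ≤ mΩ := (S.initial _ S.T_mem).trans (S.le _ S.T_mem)

theorem measurable_Z : Measurable (path c.T fun s ω => A s ω - A c.T ω) := measurable_path S.meas_A

theorem memLp_Z : MemLp (path c.T fun s ω => A s ω - A c.T ω) 2 P :=
  memLp_path S.meas_A S.memLp_A

theorem measurable_U : Measurable (path c.T u) :=
  measurable_path (S.control.measurable_prod c.T_pos.le S.le)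

theorem memLp_U : MemLp (path c.T u) 2 P :=
  memLp_path (S.control.measurable_prod c.T_pos.le S.le) (S.control.memLp_prod c.T_pos.le S.le)

theorem measurable_θ' : Measurable θ := S.meas_θ.mono S.le_base le_rfl

theorem stronglyMeasurable_Dop : StronglyMeasurable[ℱ] fun ω => Dop c (θ ω) 0 :=
  (continuous_Dop c 0).comp_stronglyMeasurable
    (Measurable.stronglyMeasurable S.meas_θ)

theorem measurable_Dop_apply {X : Ω → L2 c.T} (hX : Measurable X) :
    Measurable fun ω => Dop c (θ ω) 0 (X ω) :=
  ((isBoundedBilinearMap_apply (𝕜 := ℝ) (E := L2 c.T) (F := L2 c.T)).continuous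
    |>.comp_stronglyMeasurable ((S.stronglyMeasurable_Dop.mono S.le_base).prodMk
      hX.stronglyMeasurable)).measurable

theorem memLp_Dop_apply {X : Ω → L2 c.T} (hX : Measurable X) (hX2 : MemLp X 2 P) :
    MemLp (fun ω => Dop c (θ ω) 0 (X ω)) 2 P := by
  obtain ⟨C, hC0, hC⟩ := exists_norm_Dop_le c L ε
  refine (hX2.norm.const_mul C).mono (S.measurable_Dop_apply hX).aestronglyMeasurable
    (Eventually.of_forall fun ω => ?_)
  rw [norm_mul, Real.norm_of_nonneg hC0, norm_norm]
  exact ContinuousLinearMap.le_of_opNorm_le _ (hC _ (S.mem_θ ω)) _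

theorem measurable_gradVec : Measurable (gradVec c θ A u) :=
  (S.measurable_Z.add_const _).sub (S.measurable_Dop_apply S.measurable_U)

theorem memLp_gradVec : MemLp (gradVec c θ A u) 2 P :=
  (S.memLp_Z.add (memLp_const _)).sub (S.memLp_Dop_apply S.measurable_U S.memLp_U)

/-- The random parameter is known initially, so the operator `Dop c (θ ω) 0` is pulled out of the
conditional expectation. -/
theorem condExp_gradVec {t : ℝ} (ht : t ∈ Icc 0 c.T) :
    P[gradVec c θ A u | 𝒢 t] =ᵐ[P] fun ω =>
      (P[path c.T fun s ω => A s ω - A c.T ω | 𝒢 t]) ω + driftVec c -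
        Dop c (θ ω) 0 ((P[path c.T u | 𝒢 t]) ω) := by
  have h1 : P[fun ω => Dop c (θ ω) 0 (path c.T u ω) | 𝒢 t] =ᵐ[P] fun ω =>
      Dop c (θ ω) 0 ((P[path c.T u | 𝒢 t]) ω) :=
    condExp_bilin_of_stronglyMeasurable_left
      (ContinuousLinearMap.id ℝ (L2 c.T →L[ℝ] L2 c.T))
      (S.stronglyMeasurable_Dop.mono (S.initial t ht))
      ((S.memLp_Dop_apply S.measurable_U S.memLp_U).integrable (by norm_num))
      (S.memLp_U.integrable (by norm_num))
  have i1 := S.memLp_Z.integrable (q := 2) (by norm_num)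
  have i2 := (memLp_const (driftVec c) (μ := P) (p := 2)).integrable (by norm_num)
  have i3 := (S.memLp_Dop_apply S.measurable_U S.memLp_U).integrable (q := 2) (by norm_num)
  have h2 := condExp_sub (i1.add i2) i3 (𝒢 t)
  have h3 := condExp_add i1 i2 (𝒢 t)
  have h4 : P[fun _ : Ω => driftVec c | 𝒢 t] = fun _ => driftVec c :=
    condExp_const (S.le t ht) _
  rw [h4] at h3
  filter_upwards [h1, h2, h3] with ω h1 h2 h3
  have h5 : gradVec c θ A u = ((path c.T fun s ω => A s ω - A c.T ω) + fun _ => driftVec c) -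
    fun ω => Dop c (θ ω) 0 (path c.T u ω) := rfl
  rw [h5, h2, Pi.sub_apply, h3, Pi.add_apply, h1]

/-- Since the past is known, `w = E[U | 𝒢_t]` agrees with `U` before `t`. This is the hypothesis on
`w` in the pathwise lemmas. -/
theorem condExp_path_sub_chi {t : ℝ} (ht : t ∈ Icc 0 c.T) :
    ∀ᵐ ω ∂P, (P[path c.T u | 𝒢 t]) ω - chi c.T t ((P[path c.T u | 𝒢 t]) ω) =
      path c.T u ω - chi c.T t (path c.T u ω) := by
  have hi := S.memLp_U.integrable (q := 2) (by norm_num)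
  have h1 := (ContinuousLinearMap.id ℝ (L2 c.T) - chi c.T t).comp_condExp_comm hi (m := 𝒢 t)
  have h2 : P[fun ω => path c.T u ω - chi c.T t (path c.T u ω) | 𝒢 t] =ᵐ[P]
      fun ω => path c.T u ω - chi c.T t (path c.T u ω) :=
    condExp_of_aestronglyMeasurable' (S.le t ht)
      (S.control.path_sub_chi c.T_pos.le S.le ht) (hi.sub ((chi c.T t).integrable_comp hi))
  filter_upwards [h1, h2] with ω h1 h2
  exact h1.trans h2

/-- Transfers `gradient_ae_eq` from fixed `ω` to fixed `t`. The exchange of quantifiers goes through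
the jointly measurable `gradientEv`. -/
theorem measurable_ev_gradVec :
    ∀ᵐ t ∂(leb c.T), ∀ᵐ ω ∂P, ev (gradVec c θ A u ω) t =
      condGradient c (θ ω) t (A t ω - A c.T ω) (u t ω) (path c.T u ω) (path c.T u ω) := by
  have h1 : ∀ᵐ t ∂(leb c.T), ∀ᵐ ω ∂P, ev (gradVec c θ A u ω) t =
      gradientEv c (θ ω) t (ev (path c.T (fun s ω => A s ω - A c.T ω) ω) t)
        (ev (path c.T u ω) t) (path c.T u ω) := by
    rw [Measure.ae_ae_comm]
    · refine Eventually.of_forall fun ω => ?_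
      filter_upwards [ev_ae_eq (gradVec c θ A u ω), gradient_ae_eq c (θ ω)
        (path c.T (fun s ω => A s ω - A c.T ω) ω) (path c.T u ω),
        ev_ae_eq (path c.T (fun s ω => A s ω - A c.T ω) ω), ev_ae_eq (path c.T u ω),
        ae_leb_mem c.T] with t h1 h2 h3 h4 ht
      rw [h1, h3, h4, ← condGradient_eq_ev (θ ω) ht]
      exact h2
    · refine measurableSet_eq_fun (measurable_ev_prod S.measurable_gradVec) ?_
      exact measurable_gradientEv (S.measurable_θ'.comp measurable_snd) measurable_fst
        (measurable_ev_prod S.measurable_Z) (measurable_ev_prod S.measurable_U)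
        (S.measurable_U.comp measurable_snd)
  filter_upwards [h1, ae_ev_path (u := fun s ω => A s ω - A c.T ω) S.meas_A
    S.memLp_A, ae_leb_mem c.T, ae_ev_path
    (S.control.measurable_prod c.T_pos.le S.le) (S.control.memLp_prod c.T_pos.le S.le)]
    with t h2 h3 ht h4
  filter_upwards [h2, h3, h4] with ω h5 h6 h7
  rw [h5, h6, h7, condGradient_eq_ev (θ ω) ht]

theorem integral_Gtilde_measurable {t : ℝ} (ht : t ∈ Icc 0 c.T) :
    AEStronglyMeasurable[𝒢 t]
      (fun ω => ∫ s, Gtilde c (θ ω) t s * path c.T u ω s ∂(leb c.T)) P := by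
  have h1 : (fun ω => ∫ s, Gtilde c (θ ω) t s * path c.T u ω s ∂(leb c.T)) = fun ω =>
      ∫ s, GtildeEv c (θ ω) t s *
        ev (path c.T u ω - chi c.T t (path c.T u ω)) s ∂(leb c.T) := by
    ext1 ω
    rw [← integral_Gtilde_eq_ev _ ht.2]
    refine integral_congr_ae ?_
    filter_upwards [coe_sub_chi t (path c.T u ω)] with s hs
    rw [hs, Gtilde]
    split_ifs <;> simp
  rw [h1]
  obtain ⟨V, hV, hVe⟩ := S.control.path_sub_chi c.T_pos.le S.le ht
  have hθ : Measurable[𝒢 t] θ := S.meas_θ.mono (S.initial t ht) le_rfl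
  have hm : Measurable[𝒢 t] fun ω => ∫ s, GtildeEv c (θ ω) t s * ev (V ω) s ∂(leb c.T) :=
    (measurable_integral_GtildeEv_left c).comp (f := fun ω => (θ ω, V ω, t))
      (Measurable.prodMk hθ (Measurable.prodMk hV.measurable measurable_const))
  refine ⟨_, Measurable.stronglyMeasurable hm, ?_⟩
  filter_upwards [hVe] with ω hω
  rw [hω]

/-- The conditional expectation of the gradient at time `t`. -/
theorem condExp_ev_gradVec :
    ∀ᵐ t ∂(leb c.T), P[fun ω => ev (gradVec c θ A u ω) t | 𝒢 t] =ᵐ[P] fun ω =>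
      condGradient c (θ ω) t ((P[fun ω => A t ω - A c.T ω | 𝒢 t]) ω) (u t ω) (path c.T u ω)
        ((P[path c.T u | 𝒢 t]) ω) := by
  filter_upwards [S.measurable_ev_gradVec, ae_leb_mem c.T,
    memLp_prod_section (memLp_ev_prod S.measurable_gradVec S.memLp_gradVec),
    memLp_prod_section S.memLp_A] with t h1 ht h2 h3
  have hg : Integrable (fun ω => ev (gradVec c θ A u ω) t) P := h2.integrable (by norm_num)
  have hA : Integrable (fun ω => A t ω - A c.T ω) P := by
    have := h3.integrable (q := 2) (by norm_num)
    simpa only [indicator_of_mem ht] using this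
  have hU := S.memLp_U.integrable (q := 2) (by norm_num)
  have hk : StronglyMeasurable[𝒢 t] fun ω => kvec c (θ ω) t :=
    Measurable.stronglyMeasurable
      ((measurable_kvec ht.1).comp (S.meas_θ.mono (S.initial t ht) le_rfl))
  have hkb : ∀ ω, ‖kvec c (θ ω) t‖ ≤ 2 * c.ϱ * ‖oneL2 c.T‖ + L := fun ω =>
    (norm_kvec_le c _ ht.1).trans (by linarith [(S.mem_θ ω).2.2.1])
  have hkU : Integrable (fun ω => inner ℝ (kvec c (θ ω) t) (path c.T u ω)) P := by
    refine (hU.norm.const_mul (2 * c.ϱ * ‖oneL2 c.T‖ + L)).mono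
      ((hk.mono (S.le t ht)).inner S.measurable_U.stronglyMeasurable).aestronglyMeasurable
      (Eventually.of_forall fun ω => ?_)
    refine (norm_inner_le_norm _ _).trans ?_
    rw [norm_mul, norm_norm]
    exact mul_le_mul_of_nonneg_right ((hkb ω).trans (le_abs_self _)) (norm_nonneg _)
  have h4 : P[fun ω => inner ℝ (kvec c (θ ω) t) (path c.T u ω) | 𝒢 t] =ᵐ[P] fun ω =>
      inner ℝ (kvec c (θ ω) t) ((P[path c.T u | 𝒢 t]) ω) :=
    condExp_bilin_of_stronglyMeasurable_left (innerSL ℝ) hk hkU hU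
  set ℓ : L2 c.T →L[ℝ] ℝ := (2 * c.φ) • (innerSL ℝ (chi c.T t (oneL2 c.T)) ∘L oneOp c 0) with hℓ
  have hℓa : ∀ x, ℓ x = 2 * c.φ * inner ℝ (chi c.T t (oneL2 c.T)) (oneOp c 0 x) := fun x => rfl
  have h5 := ℓ.comp_condExp_comm hU (m := 𝒢 t)
  have hℓU : Integrable (fun ω => ℓ (path c.T u ω)) P := ℓ.integrable_comp hU
  -- The terms known at time `t`. The three other terms are conditioned separately.
  set m : Ω → ℝ := fun ω => (2 * c.ϱ * c.q + 2 * c.φ * c.q * (c.T - t)) - 2 * (θ ω).1 * u t ω -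
    ∫ s, Gtilde c (θ ω) t s * path c.T u ω s ∂(leb c.T) with hm
  have h6 : (fun ω => ev (gradVec c θ A u ω) t) =ᵐ[P] fun ω => (A t ω - A c.T ω) -
      inner ℝ (kvec c (θ ω) t) (path c.T u ω) - ℓ (path c.T u ω) + m ω := by
    filter_upwards [h1] with ω hω
    rw [hω, condGradient, hm, hℓa]
    ring
  have hmm : AEStronglyMeasurable[𝒢 t] m P := by
    refine AEStronglyMeasurable.sub ?_ (S.integral_Gtilde_measurable ht)
    have hu := S.control.measurable ht
    have hθ : Measurable[𝒢 t] θ := S.meas_θ.mono (S.initial t ht) le_rfl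
    have h8 : Measurable[𝒢 t] fun ω => (2 * c.ϱ * c.q + 2 * c.φ * c.q * (c.T - t)) -
      2 * (θ ω).1 * u t ω := by fun_prop
    exact (Measurable.stronglyMeasurable h8).aestronglyMeasurable
  -- Integrability of `m` comes from that of the whole gradient and of the other terms, so the
  -- impact integral needs no estimate of its own.
  have hmi : Integrable m P := by
    have h7 : m =ᵐ[P] fun ω => ev (gradVec c θ A u ω) t - ((A t ω - A c.T ω) -
      inner ℝ (kvec c (θ ω) t) (path c.T u ω) - ℓ (path c.T u ω)) := by
      filter_upwards [h6] with ω hω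
      rw [hω]; ring
    exact (hg.sub ((hA.sub hkU).sub hℓU)).congr h7.symm
  have e0 := condExp_congr_ae h6 (m := 𝒢 t)
  have e1 := condExp_add ((hA.sub hkU).sub hℓU) hmi (𝒢 t)
  have e2 := condExp_sub (hA.sub hkU) hℓU (𝒢 t)
  have e3 := condExp_sub hA hkU (𝒢 t)
  have e4 := condExp_of_aestronglyMeasurable' (S.le t ht) hmm hmi
  filter_upwards [e0, e1, e2, e3, e4, h4, h5] with ω e0 e1 e2 e3 e4 h4 h5
  rw [e0]
  refine e1.trans ?_
  rw [Pi.add_apply, e2, Pi.sub_apply, e3, Pi.sub_apply, e4, h4]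
  have h5' : (P[fun ω => ℓ (path c.T u ω) | 𝒢 t]) ω = ℓ ((P[path c.T u | 𝒢 t]) ω) := h5.symm
  rw [h5', hℓa, condGradient, hm]
  ring

end Setting

end FirstOrder

end Liquidation

namespace Liquidation

/-! ### Vanishing of the conditional gradient -/

section FirstOrder

variable {Ω : Type*} {ℱ : MeasurableSpace Ω} [mΩ : MeasurableSpace Ω] {P : Measure Ω}
  [IsProbabilityMeasure P] {c : Constants} {𝒢 : ℝ → MeasurableSpace Ω} {A u : ℝ → Ω → ℝ}
  {θ : Ω → Param c.T} {E : Set Ω} {L ε : ℝ}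

theorem integrable_inner_L2 {H : Type*} [NormedAddCommGroup H] [InnerProductSpace ℝ H]
    {f g : Ω → H} (hf : MemLp f 2 P) (hg : MemLp g 2 P) :
    Integrable (fun ω => inner ℝ (f ω) (g ω)) P := by
  refine (hf.norm.integrable_mul hg.norm).mono' (hf.1.inner hg.1) (Eventually.of_forall fun ω => ?_)
  exact norm_inner_le_norm _ _

theorem ae_ev_chi {T : ℝ} {X : Ω → L2 T} (hX : Measurable X) (s : ℝ) :
    ∀ᵐ r ∂(leb T), r < s → ∀ᵐ ω ∂P, ev (chi T s (X ω)) r = 0 := by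
  have h : ∀ᵐ r ∂(leb T), ∀ᵐ ω ∂P, r < s → ev (chi T s (X ω)) r = 0 := by
    rw [Measure.ae_ae_comm]
    · refine Eventually.of_forall fun ω => ?_
      filter_upwards [ev_ae_eq (chi T s (X ω)), chi_coe s (X ω)] with r h1 h2 h3
      rw [h1, h2, indicator_of_notMem (show r ∉ Ici s from fun h => absurd h3 (not_lt.2 h))]
    · have h1 : MeasurableSet {z : ℝ × Ω | z.1 < s} := measurable_fst measurableSet_Iio
      have h2 : MeasurableSet {z : ℝ × Ω | ev (chi T s (X z.2)) z.1 = 0} :=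
        measurableSet_eq_fun (measurable_ev_prod ((chi T s).continuous.measurable.comp hX))
          measurable_const
      exact h1.imp h2
  filter_upwards [h] with r hr hrs
  filter_upwards [hr] with ω hω
  exact hω hrs

/-- Information available at `s`, used only from `s` on, is an adapted direction: before `s` it
vanishes, and afterwards it is still available. -/
theorem aestronglyMeasurable_ev_chi {T : ℝ} (hmono : ∀ s ∈ Icc 0 T, ∀ t ∈ Icc 0 T, s ≤ t → 𝒢 s ≤ 𝒢 t)
    {s : ℝ} (hs : s ∈ Icc 0 T) (hle : 𝒢 s ≤ mΩ) {X : Ω → L2 T} (hX : Measurable[𝒢 s] X) :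
    ∀ᵐ r ∂(leb T), AEStronglyMeasurable[𝒢 r] (fun ω => ev (chi T s (X ω)) r) P := by
  filter_upwards [ae_ev_chi (P := P) (hX.mono hle le_rfl) s, ae_leb_mem T] with r h1 hr
  by_cases h : r < s
  · exact ⟨fun _ => 0, stronglyMeasurable_const, h1 h⟩
  · have h2 : Measurable[𝒢 r] X := hX.mono (hmono s hs r hr (not_lt.1 h)) le_rfl
    have h3 : Measurable[𝒢 r] fun ω => ev (chi T s (X ω)) r :=
      (measurable_ev T).comp (f := fun ω => (chi T s (X ω), r))
        (Measurable.prodMk ((chi T s).continuous.measurable.comp h2) measurable_const)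
    exact (Measurable.stronglyMeasurable h3).aestronglyMeasurable

namespace Setting

variable (S : Setting ℱ c P 𝒢 A u θ L ε)
include S

theorem measurable_indicator_gradVec (hE : MeasurableSet[ℱ] E) :
    Measurable (E.indicator (gradVec c θ A u)) :=
  S.measurable_gradVec.indicator (S.le_base _ hE)

theorem memLp_indicator_gradVec (hE : MeasurableSet[ℱ] E) :
    MemLp (E.indicator (gradVec c θ A u)) 2 P :=
  S.memLp_gradVec.indicator (S.le_base _ hE)

/-- The event `E` is known initially, so its indicator passes through the conditional expectations.
On `E` the pathwise bound applies, and off `E` both sides are zero. -/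
theorem abs_condExp_ev_le (hE : MeasurableSet[ℱ] E) (hg : IsGreedyOn c P 𝒢 A θ E u) :
    ∀ᵐ t ∂(leb c.T), ∀ᵐ ω ∂P,
      |(P[fun ω => ev (E.indicator (gradVec c θ A u) ω) t | 𝒢 t]) ω| ≤
        gradConst c L ε * ‖chi c.T t ((P[E.indicator (gradVec c θ A u) | 𝒢 t]) ω)‖ := by
  filter_upwards [S.condExp_ev_gradVec, hg, ev_ae_eq (0 : L2 c.T), Lp.coeFn_zero ℝ 2 (leb c.T),
    ae_leb_mem c.T, memLp_prod_section (memLp_ev_prod S.measurable_gradVec S.memLp_gradVec)]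
    with t h1 h2 h3 h4 ht h5
  have hEt : MeasurableSet[𝒢 t] E := S.initial t ht _ hE
  have h6 : (fun ω => ev (E.indicator (gradVec c θ A u) ω) t) =
      E.indicator fun ω => ev (gradVec c θ A u ω) t := by
    ext1 ω
    by_cases hω : ω ∈ E
    · rw [indicator_of_mem hω, indicator_of_mem hω]
    · rw [indicator_of_notMem hω, indicator_of_notMem hω, h3, h4]; rfl
  have h7 := condExp_indicator (m := 𝒢 t) (h5.integrable (by norm_num)) hEt
  have h8 := condExp_indicator (m := 𝒢 t) (S.memLp_gradVec.integrable (q := 2) (by norm_num)) hEt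
  rw [h6]
  filter_upwards [h1, h2, h7, h8, S.condExp_gradVec ht, S.condExp_path_sub_chi ht,
    ae_memLp_of_prod (S.control.memLp_prod c.T_pos.le S.le)] with ω e1 e2 e7 e8 e9 e10 e11
  rw [e7, e8]
  by_cases hω : ω ∈ E
  · rw [indicator_of_mem hω, indicator_of_mem hω, e1, e9]
    exact abs_condGradient_le (S.mem_θ ω) S.L_pos S.ε_nonneg S.coercive ht _ _
      (u := fun s => u s ω) (coeFn_toL2 e11).symm e10 (e2 hω)
  · rw [indicator_of_notMem hω, indicator_of_notMem hω]
    simp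

/-- Restriction to `[s,T]` and conditional expectation are both orthogonal projections. -/
theorem integral_norm_sq_chi_condExp {g : Ω → L2 c.T} (hg2 : MemLp g 2 P) {s : ℝ}
    (hs : s ∈ Icc 0 c.T) :
    ∫ ω, ‖chi c.T s ((P[g | 𝒢 s]) ω)‖ ^ 2 ∂P =
      ∫ ω, inner ℝ (g ω) (chi c.T s ((P[g | 𝒢 s]) ω)) ∂P := by
  have hY : StronglyMeasurable[𝒢 s] fun ω => chi c.T s ((P[g | 𝒢 s]) ω) :=
    (chi c.T s).continuous.comp_stronglyMeasurable stronglyMeasurable_condExp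
  have hY2 : MemLp (fun ω => chi c.T s ((P[g | 𝒢 s]) ω)) 2 P :=
    (chi c.T s).comp_memLp' (MemLp.condExp (by norm_num) hg2)
  have hi : Integrable (fun ω => inner ℝ (chi c.T s ((P[g | 𝒢 s]) ω)) (g ω)) P :=
    integrable_inner_L2 hY2 hg2
  have h1 : P[fun ω => inner ℝ (chi c.T s ((P[g | 𝒢 s]) ω)) (g ω) | 𝒢 s] =ᵐ[P] fun ω =>
      inner ℝ (chi c.T s ((P[g | 𝒢 s]) ω)) ((P[g | 𝒢 s]) ω) :=
    condExp_bilin_of_stronglyMeasurable_left (innerSL ℝ) hY hi (hg2.integrable (by norm_num))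
  simp_rw [real_inner_comm _ (g _)]
  refine Eq.trans ?_ (integral_condExp (S.le s hs))
  rw [integral_congr_ae h1]
  refine integral_congr_ae (Eventually.of_forall fun ω => ?_)
  simp only
  rw [inner_chi_left, ← chi_idem s ((P[g | 𝒢 s]) ω), ← inner_chi_left, chi_idem,
    real_inner_self_eq_norm_sq]

/-- With `Y = χ_s E[g | 𝒢_s]` one has `h(s) = E‖Y‖² = E⟨g, Y⟩`. As `Y` is an adapted direction
supported on `[s,T]`, at each time `r ≥ s` the gradient may be replaced by `E[g_r | 𝒢_r]`, whose
second moment is at most `Cg² h(r)`. Young's inequality gives `h(s) ≤ Cg² ∫_s^T h`, and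
`eq_zero_of_backward_bound` gives `h = 0`. -/
theorem condExp_ev_eq_zero (hE : MeasurableSet[ℱ] E) (hg : IsGreedyOn c P 𝒢 A θ E u) :
    ∀ᵐ t ∂(leb c.T), P[fun ω => ev (E.indicator (gradVec c θ A u) ω) t | 𝒢 t] =ᵐ[P] 0 := by
  set g := E.indicator (gradVec c θ A u) with hgdef
  have hgm : Measurable g := S.measurable_indicator_gradVec hE
  have hg2 : MemLp g 2 P := S.memLp_indicator_gradVec hE
  set h : ℝ → ℝ := fun s => ∫ ω, ‖chi c.T s ((P[g | 𝒢 s]) ω)‖ ^ 2 ∂P with hh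
  have hYm : ∀ s, Measurable[𝒢 s] (P[g | 𝒢 s]) := fun s =>
    stronglyMeasurable_condExp.measurable
  have hY : ∀ s ∈ Icc 0 c.T, Measurable fun ω => chi c.T s ((P[g | 𝒢 s]) ω) := fun s hs =>
    (chi c.T s).continuous.measurable.comp ((hYm s).mono (S.le s hs) le_rfl)
  have hY2 : ∀ s, MemLp (fun ω => chi c.T s ((P[g | 𝒢 s]) ω)) 2 P := fun s =>
    (chi c.T s).comp_memLp' (MemLp.condExp (by norm_num) hg2)
  have hYi : ∀ s, Integrable (fun ω => ‖chi c.T s ((P[g | 𝒢 s]) ω)‖ ^ 2) P := fun s =>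
    (hY2 s).norm.integrable_sq
  have hle := S.abs_condExp_ev_le hE hg
  set Cg := gradConst c L ε with hCg
  have hCg0 : 0 ≤ Cg := gradConst_nonneg S.L_pos S.coercive
  have hγ : ∀ᵐ t ∂(leb c.T), ∫ ω, ((P[fun ω => ev (g ω) t | 𝒢 t]) ω) ^ 2 ∂P ≤ Cg ^ 2 * h t := by
    filter_upwards [hle, memLp_prod_section (memLp_ev_prod hgm hg2)] with t ht ht2
    rw [hh, ← integral_const_mul]
    refine integral_mono_ae (MemLp.condExp (by norm_num) ht2).integrable_sq
      ((hYi t).const_mul _) ?_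
    filter_upwards [ht] with ω hω
    rw [← mul_pow, ← sq_abs]
    gcongr
  have hzero : ∀ s ∈ Icc 0 c.T, h s = 0 := by
    refine eq_zero_of_backward_bound (T := c.T) (K := Cg ^ 2) (H := ∫ ω, ‖g ω‖ ^ 2 ∂P)
      (by positivity) (integral_nonneg fun ω => by positivity)
      (fun s _ => integral_nonneg fun ω => by positivity) (fun s hs => ?_)
      (fun p hp hp0 hhp s hs => ?_)
    -- The a priori bound that starts the iteration: Young's inequality in `h(s) = E⟨g, Y⟩`,
    -- absorbing half of `h(s)`.
    · have h1 : h s ≤ ∫ ω, (1 / 2 * ‖g ω‖ ^ 2 + 1 / 2 * ‖chi c.T s ((P[g | 𝒢 s]) ω)‖ ^ 2) ∂P := by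
        rw [hh]
        simp only
        rw [S.integral_norm_sq_chi_condExp hg2 hs]
        refine integral_mono (integrable_inner_L2 hg2 (hY2 s))
          ((hg2.norm.integrable_sq.const_mul _).add ((hYi s).const_mul _)) fun ω => ?_
        have h2 := real_inner_le_norm (g ω) (chi c.T s ((P[g | 𝒢 s]) ω))
        have h3 := sq_nonneg (‖g ω‖ - ‖chi c.T s ((P[g | 𝒢 s]) ω)‖)
        simp only
        nlinarith
      rw [integral_add (hg2.norm.integrable_sq.const_mul _) ((hYi s).const_mul _),
        integral_const_mul, integral_const_mul] at h1
      change h s ≤ 1 / 2 * (∫ ω, ‖g ω‖ ^ 2 ∂P) + 1 / 2 * h s at h1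
      linarith
    · have hpi : Integrable p (leb c.T) := hp.integrableOn_Icc
      -- The majorant is cut to `[s,T]`. Before `s` the direction vanishes and the first alternative
      -- of the lemma applies.
      have h1 := integral_inner_le_of_condExp S.le hgm hg2 (hY s hs) (hY2 s)
        (aestronglyMeasurable_ev_chi S.mono hs (S.le s hs) (hYm s))
        (p := fun r => if s ≤ r then Cg ^ 2 * p r else 0)
        ((hpi.const_mul _).indicator measurableSet_Ici)
        (Eventually.of_forall fun r => by
          have := hp0 r
          split_ifs <;> positivity) ?_
      · rw [← S.integral_norm_sq_chi_condExp hg2 hs] at h1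
        have h2 : ∫ r, (if s ≤ r then Cg ^ 2 * p r else 0) ∂(leb c.T) =
            Cg ^ 2 * ∫ r in s..c.T, p r := by
          have e1 : (fun r => if s ≤ r then Cg ^ 2 * p r else 0) =
              (Ici s).indicator fun r => Cg ^ 2 * p r := by
            ext r; simp [indicator]
          rw [e1, integral_indicator measurableSet_Ici, leb,
            Measure.restrict_restrict measurableSet_Ici, integral_const_mul,
            intervalIntegral.integral_of_le hs.2, ← integral_Icc_eq_integral_Ioc]
          congr 3
          ext r
          simp only [mem_inter_iff, mem_Ici, mem_Icc]
          exact ⟨fun h => ⟨h.1, h.2.2⟩, fun h => ⟨h.1, hs.1.trans h.1, h.2⟩⟩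
        rw [h2] at h1
        change h s ≤ 1 / 2 * h s + _ at h1
        linarith
      · filter_upwards [hγ, ae_leb_mem c.T,
          ae_ev_chi (P := P) ((hYm s).mono (S.le s hs) le_rfl) s] with r h2 hr h3
        by_cases h4 : s ≤ r
        · right
          rw [if_pos h4]
          exact h2.trans (mul_le_mul_of_nonneg_left (hhp r hr) (by positivity))
        · exact Or.inl (h3 (not_le.1 h4))
  filter_upwards [hγ, ae_leb_mem c.T, memLp_prod_section (memLp_ev_prod hgm hg2)] with t h1 ht h2
  rw [hzero t ht, mul_zero] at h1
  have h3 := (integral_eq_zero_iff_of_nonneg (fun ω => sq_nonneg _)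
    (MemLp.condExp (m := 𝒢 t) (by norm_num) h2).integrable_sq).1
      (le_antisymm h1 (integral_nonneg fun ω => sq_nonneg _))
  filter_upwards [h3] with ω hω
  exact pow_eq_zero_iff two_ne_zero |>.1 hω

/-- On an initial event, the gradient at a greedy strategy is orthogonal to adapted directions. -/
theorem setIntegral_inner_gradVec_eq_zero (hE : MeasurableSet[ℱ] E)
    (hg : IsGreedyOn c P 𝒢 A θ E u) {V : Ω → L2 c.T} (hV : Measurable V) (hV2 : MemLp V 2 P)
    (hVm : ∀ᵐ t ∂(leb c.T), AEStronglyMeasurable[𝒢 t] (fun ω => ev (V ω) t) P) :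
    ∫ ω in E, inner ℝ (gradVec c θ A u ω) (V ω) ∂P = 0 := by
  rw [← integral_indicator (S.le_base _ hE)]
  refine Eq.trans (integral_congr_ae (Eventually.of_forall fun ω => ?_))
    (integral_inner_eq_zero_of_condExp S.le (S.measurable_indicator_gradVec hE)
      (S.memLp_indicator_gradVec hE) hV hV2 hVm (S.condExp_ev_eq_zero hE hg))
  by_cases hω : ω ∈ E
  · simp only [indicator_of_mem hω]
  · simp only [indicator_of_notMem hω, inner_zero_left]

end Setting

end FirstOrder

end Liquidation

namespace Liquidation

/-! ### The payoff as a quadratic functional -/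

section Payoff

variable {Ω : Type*}

theorem integral_leb_eq {T : ℝ} (hT : 0 ≤ T) (f : ℝ → ℝ) :
    ∫ t in (0 : ℝ)..T, f t = ∫ t, f t ∂(leb T) := by
  rw [intervalIntegral.integral_of_le hT, ← integral_Icc_eq_integral_Ioc]

/-- The payoff in terms of the terminal price `p`, the increments `z` of the price up to the
terminal time and the strategy `U`. -/
def payoffForm (c : Constants) (θ : Param c.T) (p : ℝ) (z U : L2 c.T) : ℝ :=
  c.q * p + inner ℝ (z + driftVec c) U - 1 / 2 * inner ℝ (Dop c θ 0 U) U -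
    c.φ * c.q ^ 2 * c.T - c.ϱ * c.q ^ 2

/-- Writing `Q_T P_T = q P_T - P_T ∫ u` and joining the last term to the revenue leaves only
increments of the price up to `T`. The quadratic part of the terminal penalty is absorbed into the
constant `2ϱ` of `G̃`, that of the running penalty into `1* 1`; their linear parts form `driftVec`.
-/
theorem payoff_eq (c : Constants) (θ : Param c.T) {A M u : ℝ → Ω → ℝ} {ω : Ω}
    (hu : MemLp (fun t => u t ω) 2 (leb c.T))
    (hA : MemLp (fun t => A t ω - A c.T ω) 2 (leb c.T))
    (hM : MemLp (fun t => M t ω - M c.T ω) 2 (leb c.T)) :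
    payoff c θ A M u ω = payoffForm c θ (A c.T ω + M c.T ω)
      (path c.T (fun t ω => A t ω - A c.T ω) ω + path c.T (fun t ω => M t ω - M c.T ω) ω)
      (path c.T u ω) := by
  set U := path c.T u ω with hU
  have hT := c.T_pos.le
  have hUe : U =ᵐ[leb c.T] fun t => u t ω := coeFn_toL2 hu
  have hinv : ∀ t ∈ Icc 0 c.T, ∫ s in (0 : ℝ)..t, u s ω =
      ∫ s, (if s ≤ t then 1 else 0) * U s ∂(leb c.T) := by
    intro t ht
    rw [intervalIntegral_eq_integral_leb ht]
    refine integral_congr_ae ?_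
    filter_upwards [hUe, ae_ne_leb c.T t] with s hs hst
    rw [hs]
    rcases lt_or_gt_of_ne hst with h | h
    · simp [h, h.le]
    · simp [h.not_gt, h.not_ge]
  have hIT : ∫ s in (0 : ℝ)..c.T, u s ω = ∫ s, U s ∂(leb c.T) := by
    rw [integral_leb_eq hT]
    exact integral_congr_ae (hUe.mono fun s hs => hs.symm)
  -- the squared inventory
  have hI1 : ∫ t in (0 : ℝ)..c.T, inventory c.q u t ω ^ 2 = c.q ^ 2 * c.T -
      2 * c.q * inner ℝ (oneL2 c.T) (oneOp c 0 U) + ‖oneOp c 0 U‖ ^ 2 := by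
    rw [integral_leb_eq hT, inner_oneL2, norm_sq_L2_eq, ← integral_const_mul]
    have e : ∫ t, c.q ^ 2 ∂(leb c.T) = c.q ^ 2 * c.T := by
      simp [hT, mul_comm]
    have i1 : Integrable (fun t => 2 * c.q * oneOp c 0 U t) (leb c.T) :=
      (integrable_coe_L2 _).const_mul _
    have i2 : Integrable (fun t => oneOp c 0 U t ^ 2) (leb c.T) := (Lp.memLp _).integrable_sq
    have i3 : Integrable (fun t => c.q ^ 2 - 2 * c.q * oneOp c 0 U t) (leb c.T) :=
      (integrable_const _).sub i1
    rw [← e, ← integral_sub (integrable_const _) i1, ← integral_add i3 i2]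
    refine integral_congr_ae ?_
    filter_upwards [oneOp_zero_apply c U, ae_leb_mem c.T] with t h1 h2
    simp only [inventory]
    rw [hinv t h2, ← h1]
    ring
  -- the revenue
  have hconv := memLp_convKernel (Lp.stronglyMeasurable θ.2).measurable (Lp.memLp θ.2)
  have hk := (integrable_kernel_mul hconv U U).integral_prod_left
  have hR : ∫ t in (0 : ℝ)..c.T, price θ A M u t ω * u t ω =
      inner ℝ (path c.T (fun t ω => A t ω - A c.T ω) ω + path c.T (fun t ω => M t ω - M c.T ω) ω) U
      + (A c.T ω + M c.T ω) * (∫ s, U s ∂(leb c.T)) - θ.1 * ‖U‖ ^ 2 -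
      ∫ s, ∫ u, (if u < s then θ.2 (s - u) else 0) * U u * U s ∂(leb c.T) ∂(leb c.T) := by
    rw [integral_leb_eq hT, inner_L2_eq, norm_sq_L2_eq, ← integral_const_mul, ← integral_const_mul]
    have i0 := integrable_mul_L2 (path c.T (fun t ω => A t ω - A c.T ω) ω +
      path c.T (fun t ω => M t ω - M c.T ω) ω) U
    have i1 : Integrable (fun t => (A c.T ω + M c.T ω) * U t) (leb c.T) :=
      (integrable_coe_L2 _).const_mul _
    have i2 : Integrable (fun t => θ.1 * U t ^ 2) (leb c.T) :=
      (Lp.memLp _).integrable_sq.const_mul _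
    have i3 : Integrable (fun t => (path c.T (fun t ω => A t ω - A c.T ω) ω +
        path c.T (fun t ω => M t ω - M c.T ω) ω : L2 c.T) t * U t +
        (A c.T ω + M c.T ω) * U t) (leb c.T) := i0.add i1
    have i4 : Integrable (fun t => (path c.T (fun t ω => A t ω - A c.T ω) ω +
        path c.T (fun t ω => M t ω - M c.T ω) ω : L2 c.T) t * U t +
        (A c.T ω + M c.T ω) * U t - θ.1 * U t ^ 2) (leb c.T) := i3.sub i2
    rw [← integral_add i0 i1, ← integral_sub i3 i2, ← integral_sub i4 hk]
    refine integral_congr_ae ?_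
    filter_upwards [hUe, ae_leb_mem c.T, coeFn_toL2 hA, coeFn_toL2 hM,
      Lp.coeFn_add (path c.T (fun t ω => A t ω - A c.T ω) ω)
        (path c.T (fun t ω => M t ω - M c.T ω) ω)] with t h1 h2 h3 h4 h5
    have h6 : ∫ s in (0 : ℝ)..t, θ.2 (t - s) * u s ω =
        ∫ s, (if s < t then θ.2 (t - s) else 0) * U s ∂(leb c.T) := by
      rw [intervalIntegral_eq_integral_leb h2]
      refine integral_congr_ae ?_
      filter_upwards [hUe] with s hs
      rw [hs]
      split_ifs <;> simp
    rw [h5, Pi.add_apply, path, path, h3, h4, integral_mul_const, ← h6, h1, price]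
    ring
  have hD := inner_Dop c θ 0 U U
  have hG := inner_GtildeOp_eq c θ U
  rw [real_inner_comm (GtildeOp c θ 0 U) U, real_inner_self_eq_norm_sq,
    real_inner_self_eq_norm_sq, hG] at hD
  rw [payoffForm, payoff, hR, hI1, inventory, hIT, hD, inner_add_left _ (driftVec c), driftVec,
    inner_add_left (_ • oneL2 c.T), real_inner_smul_left, real_inner_smul_left, ContinuousLinearMap.adjoint_inner_left, inner_oneL2 U]
  ring

end Payoff

/-! ### The performance gap of a greedy strategy -/

section Gap

variable {Ω : Type*} {ℱ : MeasurableSpace Ω} [mΩ : MeasurableSpace Ω] {P : Measure Ω}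
  [IsProbabilityMeasure P] {c : Constants} {𝒢 : ℝ → MeasurableSpace Ω} {A M u : ℝ → Ω → ℝ} {V : Ω → L2 c.T}
  {θ : Ω → Param c.T} {θs : Param c.T} {E : Set Ω} {L ε : ℝ}

theorem norm_Dop_sub_le_norm (c : Constants) (θ θ' : Param c.T) :
    ‖Dop c θ 0 - Dop c θ' 0‖ ≤ 2 * (1 + √c.T) * ‖θ - θ'‖ := by
  refine (norm_Dop_sub_le c θ θ' 0).trans ?_
  have h1 : |θ.1 - θ'.1| ≤ ‖θ - θ'‖ := norm_fst_le (θ - θ')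
  have h2 : ‖θ.2 - θ'.2‖ ≤ ‖θ - θ'‖ := norm_snd_le (θ - θ')
  have h3 := mul_le_mul_of_nonneg_left h2 (Real.sqrt_nonneg c.T)
  linarith

theorem ae_ev_comp {T : ℝ} {X Y : Ω → L2 T} (hX : Measurable X) (hY : Measurable Y) {w : Ω → ℝ}
    (hw : Measurable w) :
    ∀ᵐ t ∂(leb T), ∀ᵐ ω ∂P, ev (w ω • (X ω - Y ω)) t = w ω * (ev (X ω) t - ev (Y ω) t) := by
  rw [Measure.ae_ae_comm]
  · refine Eventually.of_forall fun ω => ?_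
    filter_upwards [ev_ae_eq (X ω), ev_ae_eq (Y ω), ev_ae_eq (w ω • (X ω - Y ω)),
      Lp.coeFn_smul (w ω) (X ω - Y ω), Lp.coeFn_sub (X ω) (Y ω)] with t h1 h2 h3 h4 h5
    rw [h1, h2, h3, h4, Pi.smul_apply, h5, Pi.sub_apply, smul_eq_mul]
  · exact measurableSet_eq_fun (measurable_ev_prod (hw.smul (hX.sub hY)))
      ((hw.comp measurable_snd).mul ((measurable_ev_prod hX).sub (measurable_ev_prod hY)))

/-- The constant in the performance gap, for a signal with second moment `K`. -/
def gapConst (c : Constants) (L ε K : ℝ) : ℝ :=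
  (2 * (1 + √c.T)) ^ 2 / (2 * (2 * L⁻¹ - ε)) * (((2 * L⁻¹ - ε) ^ 2)⁻¹ * K)

/-- The assumptions on the noise, relative to a flow of information. -/
structure NoiseSetting (c : Constants) (P : Measure Ω) (𝒢 : ℝ → MeasurableSpace Ω)
    (A M : ℝ → Ω → ℝ) : Prop where
  meas_M : Measurable fun z : ℝ × Ω =>
    (Icc 0 c.T).indicator (fun s => M s z.2 - M c.T z.2) z.1
  memLp_M : MemLp (fun z : ℝ × Ω => (Icc 0 c.T).indicator (fun s => M s z.2 - M c.T z.2) z.1) 2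
    ((leb c.T).prod P)
  condExp_M : ∀ᵐ t ∂(leb c.T), P[fun ω => M t ω - M c.T ω | 𝒢 t] =ᵐ[P] 0
  integrable_terminal : Integrable (fun ω => A c.T ω + M c.T ω) P

namespace Setting

variable (S : Setting ℱ c P 𝒢 A u θ L ε) (N : NoiseSetting c P 𝒢 A M)
include S

theorem ae_payoff_eq (N : NoiseSetting c P 𝒢 A M) (θs : Param c.T) :
    ∀ᵐ ω ∂P, payoff c θs A M u ω = payoffForm c θs (A c.T ω + M c.T ω)
      (path c.T (fun t ω => A t ω - A c.T ω) ω + path c.T (fun t ω => M t ω - M c.T ω) ω)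
      (path c.T u ω) := by
  filter_upwards [ae_memLp_of_prod (u := u) (S.control.memLp_prod c.T_pos.le S.le),
    ae_memLp_of_prod (u := fun t ω => A t ω - A c.T ω) S.memLp_A,
    ae_memLp_of_prod (u := fun t ω => M t ω - M c.T ω) N.memLp_M] with ω h1 h2 h3
  exact payoff_eq c θs h1 h2 h3

theorem ae_ev_control :
    ∀ᵐ t ∂(leb c.T), ∀ᵐ ω ∂P, ev (path c.T u ω) t = u t ω :=
  ae_ev_path (S.control.measurable_prod c.T_pos.le S.le) (S.control.memLp_prod c.T_pos.le S.le)

theorem integrable_payoffForm (N : NoiseSetting c P 𝒢 A M) (θs : Param c.T)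
    (hV2 : MemLp V 2 P) : Integrable (fun ω => payoffForm c θs (A c.T ω + M c.T ω)
      (path c.T (fun t ω => A t ω - A c.T ω) ω + path c.T (fun t ω => M t ω - M c.T ω) ω)
      (V ω)) P := by
  have h1 := integrable_inner_L2 ((S.memLp_Z.add
    (memLp_path (u := fun t ω => M t ω - M c.T ω) N.meas_M N.memLp_M)).add
    (memLp_const (driftVec c))) hV2
  have h2 := integrable_inner_L2 ((Dop c θs 0).comp_memLp' hV2) hV2
  exact ((((N.integrable_terminal.const_mul c.q).add h1).sub (h2.const_mul (1 / 2))).sub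
    (integrable_const (c.φ * c.q ^ 2 * c.T))).sub (integrable_const (c.ϱ * c.q ^ 2))

theorem integrable_payoff (N : NoiseSetting c P 𝒢 A M) (θs : Param c.T) :
    Integrable (payoff c θs A M u) P :=
  (S.integrable_payoffForm N θs S.memLp_U).congr
    ((S.ae_payoff_eq N θs).mono fun _ hω => hω.symm)

/-- Exact second-order expansion at `U`. The full gradient under `θs` is the noise increment plus
the noise-free gradient under `θ` plus the mismatch `(D^θ - D^θs) U`. -/
theorem ae_payoff_sub_eq (N : NoiseSetting c P 𝒢 A M) (θs : Param c.T) (V : Ω → L2 c.T) :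
    ∀ᵐ ω ∂P, payoffForm c θs (A c.T ω + M c.T ω)
      (path c.T (fun t ω => A t ω - A c.T ω) ω + path c.T (fun t ω => M t ω - M c.T ω) ω)
      (V ω) - payoff c θs A M u ω =
      inner ℝ (path c.T (fun t ω => M t ω - M c.T ω) ω) (V ω - path c.T u ω) +
      inner ℝ (gradVec c θ A u ω) (V ω - path c.T u ω) +
      (inner ℝ ((Dop c (θ ω) 0 - Dop c θs 0) (path c.T u ω)) (V ω - path c.T u ω) -
        1 / 2 * inner ℝ (Dop c θs 0 (V ω - path c.T u ω)) (V ω - path c.T u ω)) := by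
  filter_upwards [S.ae_payoff_eq N θs] with ω h2
  rw [h2, gradVec, payoffForm, payoffForm]
  generalize V ω = V
  generalize path c.T u ω = U
  have h3 : inner ℝ (Dop c θs 0 V) U = inner ℝ (Dop c θs 0 U) V := by
    rw [inner_Dop_comm, real_inner_comm]
  simp only [inner_add_left, inner_sub_left, inner_sub_right, map_sub, sub_apply]
  linarith [h3]

/-- Testing the first-order condition with `w U` itself and using coercivity gives a weighted energy
bound for `U`. The weight is kept because it will be the squared parameter error, which is known
initially; this allows `K` to be factored out. -/
theorem setIntegral_norm_sq_le (hE : MeasurableSet[ℱ] E) (hg : IsGreedyOn c P 𝒢 A θ E u)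
    {w : Ω → ℝ} (hw : Measurable[ℱ] w) (hw0 : ∀ ω, 0 ≤ w ω) {B : ℝ} (hwB : ∀ ω, w ω ≤ B)
    {K : ℝ} (hK : P[fun ω => ‖path c.T (fun t ω => A t ω - A c.T ω) ω + driftVec c‖ ^ 2 | ℱ] =ᵐ[P]
      fun _ => K) :
    ∫ ω in E, w ω * ‖path c.T u ω‖ ^ 2 ∂P ≤ ((2 * L⁻¹ - ε) ^ 2)⁻¹ * K * ∫ ω in E, w ω ∂P := by
  set μ := 2 * L⁻¹ - ε with hμ
  have hμ0 : 0 < μ := S.coercive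
  have hwm : Measurable w := hw.mono S.le_base le_rfl
  have hwb : ∀ᵐ ω ∂P, ‖w ω‖ ≤ B := Eventually.of_forall fun ω => by
    rw [Real.norm_of_nonneg (hw0 ω)]; exact hwB ω
  have hZ2 : MemLp (fun ω => path c.T (fun t ω => A t ω - A c.T ω) ω + driftVec c) 2 P :=
    S.memLp_Z.add (memLp_const _)
  have hU2 := S.memLp_U
  have hbdd : ∀ {f : Ω → ℝ}, Integrable f P → Integrable (fun ω => w ω * f ω) P := fun hf =>
    hf.bdd_mul hwm.aestronglyMeasurable hwb
  have hwU : MemLp (fun ω => w ω • path c.T u ω) 2 P := by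
    refine (hU2.norm.const_mul B).mono (hwm.smul S.measurable_U).aestronglyMeasurable ?_
    filter_upwards [hwb] with ω hω
    rw [norm_smul, norm_mul, norm_norm]
    exact mul_le_mul_of_nonneg_right (hω.trans (le_abs_self B)) (norm_nonneg _)
  have hfoc := S.setIntegral_inner_gradVec_eq_zero hE hg (hwm.smul S.measurable_U) hwU ?_
  swap
  · filter_upwards [S.ae_ev_control, ae_leb_mem c.T,
      ae_ev_comp (P := P) S.measurable_U (measurable_const (a := (0 : L2 c.T))) hwm,
      ev_ae_eq (0 : L2 c.T), Lp.coeFn_zero ℝ 2 (leb c.T)] with t h1 h2 h3 h4 h5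
    refine ⟨_, Measurable.stronglyMeasurable
      (Measurable.mul (hw.mono (S.initial t h2) le_rfl) (S.control.measurable h2)), ?_⟩
    filter_upwards [h1, h3] with ω h6 h7
    rw [sub_zero, h6, h4, h5, Pi.zero_apply, sub_zero] at h7
    exact h7
  change ∫ ω in E, inner ℝ (gradVec c θ A u ω) (w ω • path c.T u ω) ∂P = 0 at hfoc
  have iY : Integrable (fun ω => w ω * ‖path c.T (fun t ω => A t ω - A c.T ω) ω + driftVec c‖ ^ 2) P :=
    hbdd hZ2.norm.integrable_sq
  have iU : Integrable (fun ω => w ω * ‖path c.T u ω‖ ^ 2) P := hbdd hU2.norm.integrable_sq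
  have hle : ∫ ω in E, inner ℝ (gradVec c θ A u ω) (w ω • path c.T u ω) ∂P ≤
      ∫ ω in E, (1 / (2 * μ) * (w ω * ‖path c.T (fun t ω => A t ω - A c.T ω) ω + driftVec c‖ ^ 2) -
        μ / 2 * (w ω * ‖path c.T u ω‖ ^ 2)) ∂P := by
    refine integral_mono (integrable_inner_L2 S.memLp_gradVec hwU).integrableOn
      ((iY.const_mul _).sub (iU.const_mul _)).integrableOn fun ω => ?_
    have h1 := Dop_coercive (S.mem_θ ω) S.ε_nonneg 0 (path c.T u ω)
    have h2 := real_inner_le_norm (path c.T (fun t ω => A t ω - A c.T ω) ω + driftVec c)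
      (path c.T u ω)
    simp only [gradVec, inner_smul_right, inner_sub_left]
    set y := ‖path c.T (fun t ω => A t ω - A c.T ω) ω + driftVec c‖
    set x := ‖path c.T u ω‖
    have h3 : y * x ≤ 1 / (2 * μ) * y ^ 2 + μ / 2 * x ^ 2 := by
      have h4 : 0 ≤ 1 / (2 * μ) * (y - μ * x) ^ 2 := by positivity
      have h5 : 1 / (2 * μ) * (y - μ * x) ^ 2 = 1 / (2 * μ) * y ^ 2 + μ / 2 * x ^ 2 - y * x := by
        field_simp
        ring
      linarith
    have h6 := mul_le_mul_of_nonneg_left (h2.trans h3) (hw0 ω)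
    have h7 := mul_le_mul_of_nonneg_left h1 (hw0 ω)
    rw [mul_sub]
    linarith [h6, h7]
  have hYK : ∫ ω in E, w ω * ‖path c.T (fun t ω => A t ω - A c.T ω) ω + driftVec c‖ ^ 2 ∂P =
      K * ∫ ω in E, w ω ∂P := by
    rw [← setIntegral_condExp S.le_base iY hE, ← integral_const_mul]
    refine setIntegral_congr_ae (S.le_base _ hE) ?_
    filter_upwards [condExp_stronglyMeasurable_mul_of_bound S.le_base
      (Measurable.stronglyMeasurable hw) hZ2.norm.integrable_sq B hwb, hK] with ω h1 h2 _
    have h3 : (w * fun ω => ‖path c.T (fun t ω => A t ω - A c.T ω) ω + driftVec c‖ ^ 2) = fun ω =>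
      w ω * ‖path c.T (fun t ω => A t ω - A c.T ω) ω + driftVec c‖ ^ 2 := rfl
    rw [← h3, h1, Pi.mul_apply, h2, mul_comm]
  rw [hfoc, integral_sub (iY.const_mul _).integrableOn (iU.const_mul _).integrableOn,
    integral_const_mul, integral_const_mul, hYK] at hle
  have h1 : μ / 2 * ∫ ω in E, w ω * ‖path c.T u ω‖ ^ 2 ∂P ≤ 1 / (2 * μ) * (K * ∫ ω in E, w ω ∂P) := by
    linarith
  have h2 : (μ ^ 2)⁻¹ * K * ∫ ω in E, w ω ∂P = 2 / μ * (1 / (2 * μ) * (K * ∫ ω in E, w ω ∂P)) := by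
    field_simp
  rw [h2]
  calc _ = 2 / μ * (μ / 2 * ∫ ω in E, w ω * ‖path c.T u ω‖ ^ 2 ∂P) := by field_simp
    _ ≤ _ := mul_le_mul_of_nonneg_left h1 (by positivity)

/-- Integrated over an initial event, the noise and gradient terms of the expansion vanish because
`V - U` is adapted. The mismatch is maximised against the concave quadratic in `‖V - U‖`, and the
energy bound disposes of the remaining `‖U‖²`. -/
theorem setIntegral_payoff_sub_le (N : NoiseSetting c P 𝒢 A M)
    (hθs : θs ∈ admissibleParams c.T L ε) (hE : MeasurableSet[ℱ] E)
    (hg : IsGreedyOn c P 𝒢 A θ E u) (hV : Measurable V) (hV2 : MemLp V 2 P)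
    (hVm : ∀ᵐ t ∂(leb c.T), AEStronglyMeasurable[𝒢 t] (fun ω => ev (V ω) t) P)
    {K : ℝ} (hK : P[fun ω => ‖path c.T (fun t ω => A t ω - A c.T ω) ω + driftVec c‖ ^ 2 | ℱ] =ᵐ[P]
      fun _ => K) :
    ∫ ω in E, (payoffForm c θs (A c.T ω + M c.T ω)
      (path c.T (fun t ω => A t ω - A c.T ω) ω + path c.T (fun t ω => M t ω - M c.T ω) ω)
      (V ω) - payoff c θs A M u ω) ∂P ≤
      gapConst c L ε K * ∫ ω in E, ‖θ ω - θs‖ ^ 2 ∂P := by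
  set μ := 2 * L⁻¹ - ε with hμ
  have hμ0 : 0 < μ := S.coercive
  have hEm := S.le_base _ hE
  have hd : Measurable fun ω => V ω - path c.T u ω := hV.sub S.measurable_U
  have hd2 : MemLp (fun ω => V ω - path c.T u ω) 2 P := hV2.sub S.memLp_U
  have hdm : ∀ᵐ t ∂(leb c.T),
      AEStronglyMeasurable[𝒢 t] (fun ω => ev (V ω - path c.T u ω) t) P := by
    filter_upwards [S.ae_ev_control, hVm, ae_leb_mem c.T,
      ae_ev_comp (P := P) hV S.measurable_U (measurable_const (a := (1 : ℝ)))] with t h1 h2 h3 h4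
    obtain ⟨f, hf, hfe⟩ := h2
    refine ⟨_, hf.sub (Measurable.stronglyMeasurable (S.control.measurable h3)), ?_⟩
    filter_upwards [h1, hfe, h4] with ω e1 e2 e3
    rw [one_smul, one_mul, e1, e2] at e3
    exact e3
  have hNm := measurable_path (u := fun t ω => M t ω - M c.T ω) N.meas_M
  have hN2 := memLp_path (u := fun t ω => M t ω - M c.T ω) N.meas_M N.memLp_M
  have hN0 : ∫ ω in E, inner ℝ (path c.T (fun t ω => M t ω - M c.T ω) ω)
      (V ω - path c.T u ω) ∂P = 0 := by
    have hz := integral_inner_eq_zero_of_condExp S.le hNm hN2 (hd.indicator hEm)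
      (hd2.indicator hEm) ?_ ?_
    · rw [← hz, ← integral_indicator hEm]
      refine integral_congr_ae (Eventually.of_forall fun ω => ?_)
      by_cases hω : ω ∈ E
      · simp only [indicator_of_mem hω]
      · simp only [indicator_of_notMem hω, inner_zero_right]
    · filter_upwards [hdm, ae_leb_mem c.T, ev_ae_eq (0 : L2 c.T), Lp.coeFn_zero ℝ 2 (leb c.T)]
        with t h1 h2 h3 h4
      obtain ⟨f, hf, hfe⟩ := h1
      refine ⟨E.indicator f, hf.indicator (S.initial t h2 _ hE), ?_⟩
      filter_upwards [hfe] with ω h5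
      by_cases hω : ω ∈ E
      · simp only [indicator_of_mem hω, h5]
      · simp only [indicator_of_notMem hω, h3, h4, Pi.zero_apply]
    · filter_upwards [ae_ev_path (u := fun t ω => M t ω - M c.T ω) N.meas_M N.memLp_M,
        N.condExp_M] with t h1 h2
      exact (condExp_congr_ae h1).trans h2
  have hF := S.setIntegral_inner_gradVec_eq_zero hE hg hd hd2 hdm
  set w : Ω → ℝ := fun ω => ‖θ ω - θs‖ ^ 2 with hw
  have hwℱ : Measurable[ℱ] w := by
    have : Continuous fun x : Param c.T => ‖x - θs‖ ^ 2 := by fun_prop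
    exact this.measurable.comp S.meas_θ
  have hLn : ∀ x ∈ admissibleParams c.T L ε, ‖x‖ ≤ L := fun x hx => by
    refine max_le ?_ hx.2.2.1
    rw [Real.norm_of_nonneg ((inv_nonneg.2 S.L_pos.le).trans hx.1)]
    exact hx.2.1
  have hwB : ∀ ω, w ω ≤ (L + L) ^ 2 := fun ω => by
    have := (norm_sub_le (θ ω) θs).trans (add_le_add (hLn _ (S.mem_θ ω)) (hLn _ hθs))
    simp only [hw]
    gcongr
  have hq := S.setIntegral_norm_sq_le hE hg hwℱ (fun ω => by positivity) hwB hK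
  have iw : Integrable (fun ω => w ω * ‖path c.T u ω‖ ^ 2) P :=
    S.memLp_U.norm.integrable_sq.bdd_mul (hwℱ.mono S.le_base le_rfl).aestronglyMeasurable
      (Eventually.of_forall fun ω => by
        rw [Real.norm_of_nonneg (by positivity : 0 ≤ w ω)]; exact hwB ω)
  have i1 := integrable_inner_L2 hN2 hd2
  have i2 := integrable_inner_L2 S.memLp_gradVec hd2
  set D := 2 * (1 + √c.T) with hD
  calc ∫ ω in E, (payoffForm c θs (A c.T ω + M c.T ω)
      (path c.T (fun t ω => A t ω - A c.T ω) ω + path c.T (fun t ω => M t ω - M c.T ω) ω)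
      (V ω) - payoff c θs A M u ω) ∂P
      ≤ ∫ ω in E, (inner ℝ (path c.T (fun t ω => M t ω - M c.T ω) ω)
          (V ω - path c.T u ω) +
        inner ℝ (gradVec c θ A u ω) (V ω - path c.T u ω) +
        D ^ 2 / (2 * μ) * (w ω * ‖path c.T u ω‖ ^ 2)) ∂P := by
        refine integral_mono_ae ((S.integrable_payoffForm N θs hV2).sub
          (S.integrable_payoff N θs)).integrableOn
          ((i1.add i2).add (iw.const_mul _)).integrableOn (ae_restrict_of_ae ?_)
        filter_upwards [S.ae_payoff_sub_eq N θs V] with ω hω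
        rw [hω]
        refine add_le_add_right ?_ _
        have h1 := Dop_coercive hθs S.ε_nonneg 0 (V ω - path c.T u ω)
        have h2 := real_inner_le_norm ((Dop c (θ ω) 0 - Dop c θs 0) (path c.T u ω))
          (V ω - path c.T u ω)
        have h3 := ContinuousLinearMap.le_of_opNorm_le _ (norm_Dop_sub_le_norm c (θ ω) θs)
          (path c.T u ω)
        set y := ‖V ω - path c.T u ω‖
        have h4 := h2.trans (mul_le_mul_of_nonneg_right h3 (norm_nonneg _ : 0 ≤ y))
        -- Completing the square in `y = ‖V - U‖`.
        have h5 : D ^ 2 / (2 * μ) * (w ω * ‖path c.T u ω‖ ^ 2) + μ / 2 * y ^ 2 -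
            D * ‖θ ω - θs‖ * ‖path c.T u ω‖ * y =
            1 / (2 * μ) * (D * ‖θ ω - θs‖ * ‖path c.T u ω‖ - μ * y) ^ 2 := by
          simp only [hw]
          field_simp
          ring
        have h6 : 0 ≤ 1 / (2 * μ) * (D * ‖θ ω - θs‖ * ‖path c.T u ω‖ - μ * y) ^ 2 := by positivity
        linarith
    _ = D ^ 2 / (2 * μ) * ∫ ω in E, w ω * ‖path c.T u ω‖ ^ 2 ∂P := by
        have i12 : Integrable (fun ω => inner ℝ (path c.T (fun t ω => M t ω - M c.T ω) ω)
          (V ω - path c.T u ω) +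
          inner ℝ (gradVec c θ A u ω) (V ω - path c.T u ω)) P := i1.add i2
        rw [integral_add i12.integrableOn (iw.const_mul _).integrableOn,
          integral_add i1.integrableOn i2.integrableOn, hN0, hF, integral_const_mul]
        ring
    _ ≤ D ^ 2 / (2 * μ) * ((μ ^ 2)⁻¹ * K * ∫ ω in E, w ω ∂P) :=
        mul_le_mul_of_nonneg_left hq (by positivity)
    _ = _ := by rw [gapConst]; ring

/-- The conditional performance gap of the greedy strategy is quadratic in the error of the
parameter. -/
theorem sub_condExp_payoff_le (N : NoiseSetting c P 𝒢 A M)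
    (hθs : θs ∈ admissibleParams c.T L ε) (hE : MeasurableSet[ℱ] E)
    (hg : IsGreedyOn c P 𝒢 A θ E u) (hV : Measurable V) (hV2 : MemLp V 2 P)
    (hVm : ∀ᵐ t ∂(leb c.T), AEStronglyMeasurable[𝒢 t] (fun ω => ev (V ω) t) P)
    {K : ℝ} (hK : P[fun ω => ‖path c.T (fun t ω => A t ω - A c.T ω) ω + driftVec c‖ ^ 2 | ℱ] =ᵐ[P]
      fun _ => K) {J : ℝ} (hJ : P[fun ω => payoffForm c θs (A c.T ω + M c.T ω)
      (path c.T (fun t ω => A t ω - A c.T ω) ω + path c.T (fun t ω => M t ω - M c.T ω) ω)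
      (V ω) | ℱ] =ᵐ[P] fun _ => J) :
    ∀ᵐ ω ∂P, ω ∈ E →
      J - (P[payoff c θs A M u | ℱ]) ω ≤ gapConst c L ε K * ‖θ ω - θs‖ ^ 2 := by
  have hwℱ : Measurable[ℱ] fun ω => ‖θ ω - θs‖ ^ 2 := by
    have : Continuous fun x : Param c.T => ‖x - θs‖ ^ 2 := by fun_prop
    exact this.measurable.comp S.meas_θ
  set f : Ω → ℝ := fun ω => J - (P[payoff c θs A M u | ℱ]) ω with hf
  set b : Ω → ℝ := fun ω => gapConst c L ε K * ‖θ ω - θs‖ ^ 2 with hb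
  have hbm : Measurable[ℱ] b := hwℱ.const_mul _
  have hfm : Measurable[ℱ] f := measurable_const.sub stronglyMeasurable_condExp.measurable
  -- The part of `E` where the claim fails is itself an initial event, so the integrated inequality
  -- applies to it and forces it to be null.
  set F : Set Ω := E ∩ {ω | b ω < f ω} with hF
  have hFm : MeasurableSet[ℱ] F := hE.inter (measurableSet_lt hbm hfm)
  have hFm' := S.le_base _ hFm
  have hgF : IsGreedyOn c P 𝒢 A θ F u := by
    filter_upwards [hg] with t ht
    filter_upwards [ht] with ω hω h
    exact hω h.1
  have h1 := S.setIntegral_payoff_sub_le N hθs hFm hgF hV hV2 hVm hK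
  have iv := S.integrable_payoffForm N θs hV2
  have iu := S.integrable_payoff N θs
  have ib : Integrable b P := by
    obtain ⟨B, hB⟩ : ∃ B, ∀ ω, ‖θ ω - θs‖ ≤ B := by
      have hLn : ∀ x ∈ admissibleParams c.T L ε, ‖x‖ ≤ L := fun x hx => by
        refine max_le ?_ hx.2.2.1
        rw [Real.norm_of_nonneg ((inv_nonneg.2 S.L_pos.le).trans hx.1)]
        exact hx.2.1
      exact ⟨L + L, fun ω => (norm_sub_le (θ ω) θs).trans
        (add_le_add (hLn _ (S.mem_θ ω)) (hLn _ hθs))⟩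
    refine Integrable.const_mul (Integrable.of_bound
      (hwℱ.mono S.le_base le_rfl).aestronglyMeasurable (B ^ 2) (Eventually.of_forall fun ω => ?_)) _
    rw [norm_pow, norm_norm]
    exact pow_le_pow_left₀ (norm_nonneg _) (hB ω) 2
  have iF : Integrable f P := (integrable_const J).sub integrable_condExp
  have h2 : ∫ ω in F, f ω ∂P ≤ ∫ ω in F, b ω ∂P := by
    rw [integral_const_mul]
    refine le_trans (le_of_eq ?_) h1
    rw [integral_sub iv.integrableOn iu.integrableOn, ← setIntegral_condExp S.le_base iv hFm,
      ← setIntegral_condExp S.le_base iu hFm, hf,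
      integral_sub (integrable_const J).integrableOn integrable_condExp.integrableOn]
    congr 1
    exact (setIntegral_congr_ae hFm' (hJ.mono fun ω hω _ => hω)).symm
  have h3 : ∫ ω in F, (f ω - b ω) ∂P = 0 := by
    refine le_antisymm ?_ (setIntegral_nonneg hFm' fun ω hω => (sub_pos.2 hω.2).le)
    rw [integral_sub iF.integrableOn ib.integrableOn]
    linarith
  have h4 := (setIntegral_eq_zero_iff_of_nonneg_ae (ae_restrict_of_forall_mem hFm'
    fun ω hω => (sub_pos.2 hω.2).le) (iF.sub ib).integrableOn).1 h3
  rw [EventuallyEq, ae_restrict_iff' hFm'] at h4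
  filter_upwards [h4] with ω hω hωE
  by_contra hcon
  have h5 : b ω < f ω := not_le.1 hcon
  have h6 := hω ⟨hωE, h5⟩
  simp only [Pi.zero_apply] at h6
  linarith

end Setting

end Gap

end Liquidation

namespace Liquidation

/-! ### Path space -/

section PathSpace

variable {c : Constants}

/-- The points `(⌊nt⌋ + 1)/n`, truncated to `[0,T]`. -/
def tick (c : Constants) (n : ℕ) (t : ℝ) : Icc (0 : ℝ) c.T :=
  projIcc 0 c.T c.T_pos.le ((⌊(n : ℝ) * t⌋ + 1) / n)

/-- A jointly measurable evaluation of right-continuous paths. -/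
def evalRight (c : Constants) (x : Icc (0 : ℝ) c.T → ℝ) (t : ℝ) : ℝ :=
  limsup (fun n : ℕ => x (tick c n t)) atTop

/-- Each approximation depends on the time only through the integer `⌊nt⌋`, so only countably many
coordinates of the path are involved. This gives joint measurability for the product σ-algebra on
path space. -/
theorem measurable_evalRight (c : Constants) :
    Measurable fun z : (Icc (0 : ℝ) c.T → ℝ) × ℝ => evalRight c z.1 z.2 := by
  unfold evalRight
  refine Measurable.limsup fun n => ?_
  have h1 : Measurable fun z : (Icc (0 : ℝ) c.T → ℝ) × ℤ =>
      z.1 (projIcc 0 c.T c.T_pos.le (((z.2 : ℤ) + 1 : ℝ) / n)) :=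
    measurable_from_prod_countable_left fun k =>
      (measurable_pi_apply (projIcc 0 c.T c.T_pos.le (((k : ℤ) + 1 : ℝ) / n)) :
        Measurable fun x : Icc (0 : ℝ) c.T → ℝ => x _)
  have h2 : Measurable fun z : (Icc (0 : ℝ) c.T → ℝ) × ℝ => ((z.1, ⌊(n : ℝ) * z.2⌋) :
      (Icc (0 : ℝ) c.T → ℝ) × ℤ) :=
    measurable_fst.prodMk (Int.measurable_floor.comp (measurable_snd.const_mul _))
  exact h1.comp h2

/-- Before truncation the ticks lie strictly to the right of `t` and converge to it, so
right-continuity applies for `t < T`. At `t = T` truncation makes them equal to `T`. -/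
theorem evalRight_eq {x : ℝ → ℝ} (hx : IsCadlagOn c.T x) {t : ℝ} (ht : t ∈ Icc 0 c.T) :
    evalRight c (fun s => x s) t = x t := by
  have hge : ∀ n : ℕ, 0 < n → t ≤ (⌊(n : ℝ) * t⌋ + 1) / n := fun n hn => by
    have h1 := Int.lt_floor_add_one ((n : ℝ) * t)
    rw [le_div_iff₀ (by exact_mod_cast hn)]
    linarith
  have hle : ∀ n : ℕ, 0 < n → ((⌊(n : ℝ) * t⌋ + 1) / n : ℝ) ≤ t + 1 / n := fun n hn => by
    have h1 := Int.floor_le ((n : ℝ) * t)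
    have h2 : (0 : ℝ) < n := by exact_mod_cast hn
    rw [div_le_iff₀ h2, add_mul, one_div, inv_mul_cancel₀ h2.ne']
    linarith
  refine Tendsto.limsup_eq ?_
  rcases eq_or_lt_of_le ht.2 with h | h
  · refine tendsto_const_nhds.congr' ?_
    filter_upwards [eventually_gt_atTop 0] with n hn
    have h1 : tick c n t = ⟨c.T, right_mem_Icc.2 c.T_pos.le⟩ :=
      projIcc_of_right_le _ (h ▸ hge n hn)
    rw [h1, h]
  · have h1 : Tendsto (fun n : ℕ => ((tick c n t : Icc 0 c.T) : ℝ)) atTop (𝓝[≥] t) := by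
      refine tendsto_nhdsWithin_iff.2 ⟨?_, ?_⟩
      · have h2 : Tendsto (fun n : ℕ => ((⌊(n : ℝ) * t⌋ + 1) / n : ℝ)) atTop (𝓝 t) := by
          refine tendsto_of_tendsto_of_tendsto_of_le_of_le' tendsto_const_nhds
            (h := fun n : ℕ => t + 1 / (n : ℝ)) ?_ ?_ ?_
          · simpa using tendsto_const_nhds.add (tendsto_one_div_atTop_nhds_zero_nat (𝕜 := ℝ))
          · filter_upwards [eventually_gt_atTop 0] with n hn using hge n hn
          · filter_upwards [eventually_gt_atTop 0] with n hn using hle n hn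
        have h3 := ((continuous_subtype_val.comp
          (continuous_projIcc (h := c.T_pos.le))).tendsto t).comp h2
        rw [Function.comp_apply, projIcc_of_mem _ ht] at h3
        exact h3
      · filter_upwards [eventually_gt_atTop 0] with n hn
        simp only [tick, coe_projIcc, mem_Ici, le_max_iff, le_min_iff]
        exact Or.inr ⟨ht.2, hge n hn⟩
    exact (hx.1 t ⟨ht.1, h⟩).tendsto.comp h1

/-- The space of pairs of paths on `[0,T]`. -/
abbrev PairPath (c : Constants) : Type := Icc (0 : ℝ) c.T → ℝ × ℝ

/-- The pair of paths of the processes `A` and `M`. -/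
def pairPath (c : Constants) {Ω : Type*} (A M : ℝ → Ω → ℝ) (ω : Ω) : PairPath c :=
  fun t => (A t ω, M t ω)

/-- The terminal time as a point of `[0,T]`. -/
def endpoint (c : Constants) : Icc (0 : ℝ) c.T := ⟨c.T, right_mem_Icc.2 c.T_pos.le⟩

/-- The increments up to the terminal time, as a function of the path. -/
def increment (c : Constants) (x : Icc (0 : ℝ) c.T → ℝ) : L2 c.T :=
  toL2 c.T fun t => evalRight c x t - x (endpoint c)

theorem measurable_increment (c : Constants) : Measurable (increment c) :=
  measurable_toL2 ((measurable_evalRight c).sub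
    ((measurable_pi_apply (endpoint c)).comp measurable_fst))

theorem path_increment {Ω : Type*} {A : ℝ → Ω → ℝ} (hA : ∀ ω, IsCadlagOn c.T fun t => A t ω) (ω : Ω) :
    path c.T (fun t ω => A t ω - A c.T ω) ω = increment c fun t => A t ω := by
  refine toL2_congr ?_
  filter_upwards [ae_leb_mem c.T] with t ht
  rw [evalRight_eq (x := fun t => A t ω) (hA ω) ht]
  rfl

theorem measurable_indicator_increment {Ω : Type*} [MeasurableSpace Ω] {A : ℝ → Ω → ℝ}
    (hA : ∀ ω, IsCadlagOn c.T fun t => A t ω) (hm : ∀ t ∈ Icc 0 c.T, Measurable (A t)) :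
    Measurable fun z : ℝ × Ω => (Icc 0 c.T).indicator (fun s => A s z.2 - A c.T z.2) z.1 := by
  have h1 : Measurable fun ω => (fun t : Icc (0 : ℝ) c.T => A t ω) :=
    measurable_pi_lambda _ fun t => hm t t.2
  have h2 : Measurable fun z : ℝ × Ω => evalRight c (fun t => A t z.2) z.1 - A c.T z.2 :=
    ((measurable_evalRight c).comp ((h1.comp measurable_snd).prodMk measurable_fst)).sub
      ((hm c.T (right_mem_Icc.2 c.T_pos.le)).comp measurable_snd)
  convert (h2.indicator (measurable_fst measurableSet_Icc : MeasurableSet (Prod.fst ⁻¹' Icc 0 c.T)))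
    using 1
  ext z
  by_cases hz : z.1 ∈ Icc 0 c.T
  · rw [indicator_of_mem hz, indicator_of_mem (show z ∈ Prod.fst ⁻¹' Icc 0 c.T from hz),
      evalRight_eq (x := fun t => A t z.2) (hA z.2) hz]
  · rw [indicator_of_notMem hz, indicator_of_notMem (show z ∉ Prod.fst ⁻¹' Icc 0 c.T from hz)]

/-- The expected squared increments, as a functional of the path. -/
def incrementEnergy (c : Constants) (x : Icc (0 : ℝ) c.T → ℝ) : ℝ≥0∞ :=
  ∫⁻ t, ‖evalRight c x t - x (endpoint c)‖ₑ ^ 2 ∂(leb c.T)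

theorem measurable_incrementEnergy (c : Constants) : Measurable (incrementEnergy c) :=
  Measurable.lintegral_prod_right' (f := fun z : (Icc (0 : ℝ) c.T → ℝ) × ℝ =>
    ‖evalRight c z.1 z.2 - z.1 (endpoint c)‖ₑ ^ 2) <|
    (((measurable_evalRight c).sub ((measurable_pi_apply (endpoint c)).comp
      measurable_fst)).enorm).pow_const 2

theorem incrementEnergy_eq {Ω : Type*} {A : ℝ → Ω → ℝ} (hA : ∀ ω, IsCadlagOn c.T fun t => A t ω)
    (ω : Ω) : ∫⁻ t, ‖A t ω - A c.T ω‖ₑ ^ 2 ∂(leb c.T) = incrementEnergy c fun t => A t ω := by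
  refine lintegral_congr_ae ?_
  filter_upwards [ae_leb_mem c.T] with t ht
  rw [evalRight_eq (x := fun t => A t ω) (hA ω) ht]
  rfl

end PathSpace

/-! ### Moments of the price model -/

section Model

variable {c : Constants} {Ω₀ : Type*} [mΩ₀ : MeasurableSpace Ω₀] {P₀ : Measure Ω₀}
  [IsProbabilityMeasure P₀] {𝓕 : Filtration ℝ≥0 mΩ₀} {A₀ M₀ : ℝ → Ω₀ → ℝ}

namespace IsPriceModel

variable (h : IsPriceModel c.T P₀ 𝓕 A₀ M₀)
include h

theorem measurable_A {t : ℝ} (ht : t ∈ Icc 0 c.T) : Measurable (A₀ t) := by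
  have h1 : Measurable fun ω => A₀ (min (t.toNNReal : ℝ) c.T) ω :=
    ((h.predictable.stronglyAdapted t.toNNReal).mono (𝓕.le _)).measurable
  rwa [Real.coe_toNNReal t ht.1, min_eq_left ht.2] at h1

theorem measurable_M {t : ℝ} (ht : t ∈ Icc 0 c.T) : Measurable (M₀ t) := by
  have h1 : Measurable fun ω => M₀ (min (t.toNNReal : ℝ) c.T) ω :=
    ((h.martingale.1 t.toNNReal).mono (𝓕.le _)).measurable
  rwa [Real.coe_toNNReal t ht.1, min_eq_left ht.2] at h1

theorem condExp_M {t : ℝ} (ht : t ∈ Icc 0 c.T) : P₀[M₀ c.T | 𝓕 t.toNNReal] =ᵐ[P₀] M₀ t := by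
  have h1 : P₀[fun ω => M₀ (min (c.T.toNNReal : ℝ) c.T) ω | 𝓕 t.toNNReal] =ᵐ[P₀]
      fun ω => M₀ (min (t.toNNReal : ℝ) c.T) ω :=
    h.martingale.2 _ _ (Real.toNNReal_le_toNNReal ht.2)
  rwa [Real.coe_toNNReal t ht.1, min_eq_left ht.2, Real.coe_toNNReal _ c.T_pos.le, min_self] at h1

theorem integral_M {t : ℝ} (ht : t ∈ Icc 0 c.T) : ∫ ω, M₀ t ω ∂P₀ = 0 := by
  have h0 := h.condExp_M (left_mem_Icc.2 c.T_pos.le)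
  rw [← integral_congr_ae (h.condExp_M ht), integral_condExp (𝓕.le _), ← h.mean_M,
    ← integral_congr_ae h0, integral_condExp (𝓕.le _)]

theorem memLp_M {t : ℝ} (ht : t ∈ Icc 0 c.T) : MemLp (M₀ t) 2 P₀ :=
  (MemLp.condExp (by norm_num) h.sq_M).ae_eq (h.condExp_M ht)

theorem lintegral_sq_M_le {t : ℝ} (ht : t ∈ Icc 0 c.T) :
    eLpNorm (M₀ t) 2 P₀ ≤ eLpNorm (M₀ c.T) 2 P₀ := by
  rw [← eLpNorm_congr_ae (h.condExp_M ht)]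
  exact eLpNorm_condExp_le_eLpNorm _ (by norm_num)

theorem lintegral_increment_A_lt_top :
    ∫⁻ ω, ∫⁻ t, ‖A₀ t ω - A₀ c.T ω‖ₑ ^ 2 ∂(leb c.T) ∂P₀ < ∞ := by
  refine lt_of_le_of_lt (lintegral_mono fun ω => (?_ : _ ≤
    ENNReal.ofReal c.T * eVariationOn (fun t => A₀ t ω) (Icc 0 c.T) ^ 2)) ?_
  · refine (lintegral_mono_ae (g := fun _ => eVariationOn (fun t => A₀ t ω) (Icc 0 c.T) ^ 2)
      ?_).trans ?_
    · filter_upwards [ae_leb_mem c.T] with t ht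
      rw [← edist_eq_enorm_sub]
      gcongr
      exact eVariationOn.edist_le _ ht (right_mem_Icc.2 c.T_pos.le)
    · rw [lintegral_const, mul_comm]
      simp
  · rw [lintegral_const_mul' _ _ ENNReal.ofReal_ne_top]
    exact ENNReal.mul_lt_top ENNReal.ofReal_lt_top h.variation_A

theorem memLp_A_terminal : MemLp (A₀ c.T) 2 P₀ := by
  have hT := right_mem_Icc.2 c.T_pos.le
  have h0 := left_mem_Icc.2 c.T_pos.le
  have h1 : MemLp (fun ω => A₀ c.T ω - A₀ 0 ω) 2 P₀ := by
    refine memLp_two_of_lintegral ((h.measurable_A hT).sub (h.measurable_A h0)).aestronglyMeasurable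
      (lt_of_le_of_lt (lintegral_mono fun ω => ?_) h.variation_A)
    rw [← edist_eq_enorm_sub]
    gcongr
    exact eVariationOn.edist_le _ hT h0
  convert h1.add h.sq_A using 1
  ext ω
  simp

theorem lintegral_increment_M_lt_top :
    ∫⁻ ω, ∫⁻ t, ‖M₀ t ω - M₀ c.T ω‖ₑ ^ 2 ∂(leb c.T) ∂P₀ < ∞ := by
  have hT := right_mem_Icc.2 c.T_pos.le
  have e1 : ∫⁻ ω, ∫⁻ t, ‖M₀ t ω - M₀ c.T ω‖ₑ ^ 2 ∂(leb c.T) ∂P₀ =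
      ∫⁻ ω, ∫⁻ t, ‖(Icc 0 c.T).indicator (fun s => M₀ s ω - M₀ c.T ω) t‖ₑ ^ 2 ∂(leb c.T) ∂P₀ := by
    refine lintegral_congr fun ω => lintegral_congr_ae ?_
    filter_upwards [ae_leb_mem c.T] with t ht
    rw [indicator_of_mem ht]
  have hm := (measurable_indicator_increment h.cadlag_M fun t ht => h.measurable_M ht)
  rw [e1, lintegral_lintegral_swap (((hm.comp measurable_swap).enorm.pow_const 2).aemeasurable)]
  have hle : ∀ t ∈ Icc 0 c.T, ∫⁻ ω, ‖(Icc 0 c.T).indicator (fun s => M₀ s ω - M₀ c.T ω) t‖ₑ ^ 2 ∂P₀ ≤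
      (2 * eLpNorm (M₀ c.T) 2 P₀) ^ 2 := by
    intro t ht
    simp only [indicator_of_mem ht]
    have h1 : eLpNorm (fun ω => M₀ t ω - M₀ c.T ω) 2 P₀ ≤ 2 * eLpNorm (M₀ c.T) 2 P₀ := by
      refine (eLpNorm_sub_le (h.memLp_M ht).1 h.sq_M.1 (by norm_num)).trans ?_
      rw [two_mul]
      exact add_le_add_left (h.lintegral_sq_M_le ht) _
    calc _ = eLpNorm (fun ω => M₀ t ω - M₀ c.T ω) 2 P₀ ^ 2 := by
          rw [eLpNorm_eq_lintegral_rpow_enorm_toReal (by norm_num) (by norm_num)]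
          simp only [ENNReal.toReal_ofNat, ENNReal.rpow_ofNat]
          rw [← ENNReal.rpow_natCast, ← ENNReal.rpow_mul]
          norm_num
      _ ≤ _ := by gcongr
  refine lt_of_le_of_lt (lintegral_mono_ae (g := fun _ => (2 * eLpNorm (M₀ c.T) 2 P₀) ^ 2) ?_) ?_
  · filter_upwards [ae_leb_mem c.T] with t ht using hle t ht
  · rw [lintegral_const]
    refine ENNReal.mul_lt_top ?_ (measure_lt_top _ _)
    exact ENNReal.pow_lt_top (ENNReal.mul_lt_top (by norm_num) h.sq_M.2)

end IsPriceModel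

end Model

end Liquidation

namespace Liquidation

/-! ### Null events and independence -/

section Null

variable {Ω : Type*} {m m₁ m₂ m₃ : MeasurableSpace Ω} [mΩ : MeasurableSpace Ω] {P : Measure Ω}
  [IsProbabilityMeasure P]

theorem nullSigma_le : nullSigma P ≤ mΩ :=
  MeasurableSpace.generateFrom_le fun _ hs => hs.1

/-- The sets that agree almost surely with a set of `m` form a σ-algebra, which contains the null
events. -/
theorem exists_ae_eq_of_sup_nullSigma {s : Set Ω} (hs : MeasurableSet[nullSigma P ⊔ m] s) :
    ∃ t, MeasurableSet[m] t ∧ s =ᵐ[P] t := by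
  have h : nullSigma P ⊔ m ≤ eventuallyMeasurableSpace m (ae P) := by
    refine sup_le (MeasurableSpace.generateFrom_le fun t ht => ?_)
      fun t ht => ⟨t, ht, EventuallyEq.rfl⟩
    exact ⟨∅, @MeasurableSet.empty _ m, ae_eq_empty.2 ht.2⟩
  exact h s hs

theorem Indep.sup_nullSigma (h : Indep m₁ m₂ P) : Indep m₁ (nullSigma P ⊔ m₂) P := by
  rw [Indep_iff] at h ⊢
  intro s t hs ht
  obtain ⟨t', ht', he⟩ := exists_ae_eq_of_sup_nullSigma ht
  rw [measure_congr he, ← h s t' hs ht']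
  exact measure_congr (EventuallyEq.rfl.inter he)

/-- It suffices to test on the intersections `a ∩ b`, a π-system generating `m₃ ⊔ m₂`. There the
joint probability factors by first splitting off `m₃` and then separating `m₁` from `m₂`. -/
theorem Indep.sup_right (h1 : m₁ ≤ mΩ) (h2 : m₂ ≤ mΩ) (h3 : m₃ ≤ mΩ) (h12 : Indep m₁ m₂ P)
    (h123 : Indep (m₁ ⊔ m₂) m₃ P) : Indep m₁ (m₃ ⊔ m₂) P := by
  rw [Indep_iff] at h12 h123
  refine IndepSets.indep (p1 := {s | MeasurableSet[m₁] s})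
    (p2 := {s | ∃ a b, MeasurableSet[m₃] a ∧ MeasurableSet[m₂] b ∧ s = a ∩ b}) h1 (sup_le h3 h2)
    (@MeasurableSpace.isPiSystem_measurableSet Ω m₁) ?_
    (@MeasurableSpace.generateFrom_measurableSet Ω m₁).symm ?_ ?_
  · rintro _ ⟨a, b, ha, hb, rfl⟩ _ ⟨a', b', ha', hb', rfl⟩ -
    exact ⟨a ∩ a', b ∩ b', ha.inter ha', hb.inter hb', by rw [inter_inter_inter_comm]⟩
  · refine le_antisymm (sup_le (fun a ha => ?_) fun b hb => ?_)
      (MeasurableSpace.generateFrom_le ?_)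
    · exact MeasurableSpace.measurableSet_generateFrom
        ⟨a, univ, ha, @MeasurableSet.univ _ m₂, (inter_univ a).symm⟩
    · exact MeasurableSpace.measurableSet_generateFrom
        ⟨univ, b, @MeasurableSet.univ _ m₃, hb, (univ_inter b).symm⟩
    · rintro _ ⟨a, b, ha, hb, rfl⟩
      exact MeasurableSet.inter ((le_sup_left : m₃ ≤ m₃ ⊔ m₂) a ha)
        ((le_sup_right : m₂ ≤ m₃ ⊔ m₂) b hb)
  · rw [IndepSets_iff]
    rintro s _ hs ⟨a, b, ha, hb, rfl⟩
    have hs' : MeasurableSet[m₁ ⊔ m₂] s := (le_sup_left : m₁ ≤ m₁ ⊔ m₂) s hs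
    have hb' : MeasurableSet[m₁ ⊔ m₂] b := (le_sup_right : m₂ ≤ m₁ ⊔ m₂) b hb
    have e1 : s ∩ (a ∩ b) = (s ∩ b) ∩ a := by rw [inter_comm a b, inter_assoc]
    rw [e1, inter_comm a b, h123 (s ∩ b) a (hs'.inter hb') ha, h12 s b hs hb, h123 b a hb' ha,
      mul_assoc]

/-- Conditioning on `m` and on `m` augmented by null events gives the same result, and the latter
fixes `f`. -/
theorem aestronglyMeasurable_of_sup_nullSigma {E : Type*} [NormedAddCommGroup E] [NormedSpace ℝ E]
    [CompleteSpace E] (hm : m ≤ mΩ) {f : Ω → E} (hf : StronglyMeasurable[nullSigma P ⊔ m] f)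
    (hi : Integrable f P) : AEStronglyMeasurable[m] f P := by
  have h1 : P[f | m] =ᵐ[P] P[f | nullSigma P ⊔ m] := by
    refine ae_eq_condExp_of_forall_setIntegral_eq (sup_le nullSigma_le hm) hi
      (fun s _ _ => integrable_condExp.integrableOn) (fun s hs _ => ?_)
      ⟨_, stronglyMeasurable_condExp.mono le_sup_right, EventuallyEq.rfl⟩
    obtain ⟨t, ht, he⟩ := exists_ae_eq_of_sup_nullSigma hs
    rw [setIntegral_congr_set he, setIntegral_condExp hm hi ht, setIntegral_congr_set he]
  rw [condExp_of_stronglyMeasurable (sup_le nullSigma_le hm) hf hi] at h1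
  exact ⟨_, stronglyMeasurable_condExp, h1.symm⟩

end Null

/-! ### Measurability of the price under a progressive control -/

section Price

variable {Ω : Type*} [MeasurableSpace Ω]

theorem measurable_price {T : ℝ} (θ : Param T) {A M u : ℝ → Ω → ℝ} {t : ℝ} (ht : 0 ≤ t)
    (hA : Measurable (A t)) (hM : Measurable (M t))
    (hu : Measurable fun p : Icc 0 t × Ω => u p.1 p.2) : Measurable (price θ A M u t) := by
  have h1 := measurable_indicator_of_subtype hu
  have h2 : Measurable (u t) :=
    hu.comp (g := fun p : Icc 0 t × Ω => u p.1 p.2) (f := fun ω => (⟨t, ht, le_rfl⟩, ω))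
      (measurable_const.prodMk measurable_id)
  have h3 : Measurable fun ω => ∫ s in (0 : ℝ)..t, θ.2 (t - s) * u s ω := by
    have h4 : (fun ω => ∫ s in (0 : ℝ)..t, θ.2 (t - s) * u s ω) = fun ω =>
        ∫ s, θ.2 (t - s) * (Icc 0 t).indicator (fun s => u s ω) s ∂(leb t) := by
      ext ω
      rw [integral_leb_eq ht]
      refine integral_congr_ae ?_
      filter_upwards [ae_leb_mem t] with s hs
      rw [indicator_of_mem hs]
    rw [h4]
    exact measurable_integral_leb (f := fun z : Ω × ℝ =>
      θ.2 (t - z.2) * (Icc 0 t).indicator (fun s => u s z.1) z.2)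
      (((Lp.stronglyMeasurable θ.2).measurable.comp (measurable_const.sub measurable_snd)).mul
        (h1.comp measurable_swap))
  exact ((hA.add hM).sub (h2.const_mul _)).sub h3

end Price

/-! ### The information in the learning episodes -/

section Copies

variable {Ω₀ Ω : Type*} [mΩ₀ : MeasurableSpace Ω₀] [mΩ : MeasurableSpace Ω]
  {P₀ : Measure Ω₀} [IsProbabilityMeasure P₀] {P : Measure Ω} [IsProbabilityMeasure P]
  {c : Constants} {𝓕 : Filtration ℝ≥0 mΩ₀} {A₀ M₀ : ℝ → Ω₀ → ℝ} {A M u : ℕ → ℝ → Ω → ℝ}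
  {θs : Param c.T}

/-- The information carried by the signals and noises of the first `k` episodes. -/
def historySigma (c : Constants) (P : Measure Ω) (A M : ℕ → ℝ → Ω → ℝ) (k : ℕ) :
    MeasurableSpace Ω :=
  nullSigma P ⊔ ⨆ j ∈ Finset.Icc 1 k, MeasurableSpace.comap (pairPath c (A j) (M j)) inferInstance

/-- The information carried by a path. -/
def pathSigma (c : Constants) (A : ℝ → Ω → ℝ) : MeasurableSpace Ω :=
  MeasurableSpace.comap (fun ω (t : Icc (0 : ℝ) c.T) => A t ω) inferInstance

theorem measurable_pathSigma (A : ℝ → Ω → ℝ) {t : ℝ} (ht : t ∈ Icc 0 c.T) :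
    Measurable[pathSigma c A] (A t) :=
  (measurable_pi_apply (⟨t, ht⟩ : Icc (0 : ℝ) c.T)).comp
    (comap_measurable fun ω (t : Icc (0 : ℝ) c.T) => A t ω)

theorem historySigma_mono {j k : ℕ} (h : j ≤ k) :
    historySigma c P A M j ≤ historySigma c P A M k :=
  sup_le_sup_left (biSup_mono fun _ hi => Finset.Icc_subset_Icc_right h hi) _

theorem comap_le_historySigma {j k : ℕ} (h1 : 1 ≤ j) (h : j ≤ k) :
    MeasurableSpace.comap (pairPath c (A j) (M j)) inferInstance ≤ historySigma c P A M k :=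
  le_sup_of_le_right (le_biSup (fun j => MeasurableSpace.comap (pairPath c (A j) (M j)) inferInstance)
    (Finset.mem_Icc.2 ⟨h1, h⟩))

theorem measurable_pair_fst (A M : ℝ → Ω → ℝ) :
    Measurable[MeasurableSpace.comap (pairPath c A M) inferInstance]
      fun ω (t : Icc (0 : ℝ) c.T) => A t ω :=
  (measurable_pi_lambda (fun (x : PairPath c) t => (x t).1)
    fun t => measurable_fst.comp (measurable_pi_apply t)).comp (comap_measurable (pairPath c A M))

theorem measurable_pair_snd (A M : ℝ → Ω → ℝ) :
    Measurable[MeasurableSpace.comap (pairPath c A M) inferInstance]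
      fun ω (t : Icc (0 : ℝ) c.T) => M t ω :=
  (measurable_pi_lambda (fun (x : PairPath c) t => (x t).2)
    fun t => measurable_snd.comp (measurable_pi_apply t)).comp (comap_measurable (pairPath c A M))

theorem pathSigma_fst_le (A M : ℝ → Ω → ℝ) :
    pathSigma c A ≤ MeasurableSpace.comap (pairPath c A M) inferInstance :=
  (measurable_pair_fst A M).comap_le

theorem pathSigma_snd_le (A M : ℝ → Ω → ℝ) :
    pathSigma c M ≤ MeasurableSpace.comap (pairPath c A M) inferInstance :=
  (measurable_pair_snd A M).comap_le

theorem withSignal_le_pathSigma (ℋ : MeasurableSpace Ω) (A : ℝ → Ω → ℝ) {t : ℝ} (ht : t ≤ c.T) :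
    withSignal ℋ A t ≤ ℋ ⊔ pathSigma c A :=
  sup_le_sup_left (iSup₂_le fun _ hs =>
    (measurable_pathSigma A ⟨hs.1, hs.2.trans ht⟩).comap_le) _

theorem withSignal_mono (ℋ : MeasurableSpace Ω) (A : ℝ → Ω → ℝ) {s t : ℝ} (h : s ≤ t) :
    withSignal ℋ A s ≤ withSignal ℋ A t :=
  sup_le_sup_left (biSup_mono fun _ hr => Icc_subset_Icc_right h hr) _

theorem episodeSigma_le {m : ℕ} (hm : 1 ≤ m)
    (h : obsSigma P θs A M u (m - 1) ≤ historySigma c P A M (m - 1)) {t : ℝ} (ht : t ≤ c.T) :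
    episodeSigma P θs A M u m t ≤ historySigma c P A M m :=
  (withSignal_le_pathSigma _ _ ht).trans (sup_le (h.trans (historySigma_mono (Nat.sub_le _ _)))
    ((pathSigma_fst_le _ (M m)).trans (comap_le_historySigma hm le_rfl)))

/-- By induction: the price of an episode is built from its signal, its noise and a control adapted
to earlier observations and the signal. The observed information depends on the controls, whereas
the larger history is exogenous, and it is for the latter that independence is available. -/
theorem obsSigma_le_historySigma
    (hu : ∀ m, 1 ≤ m → IsControl c.T P (episodeSigma P θs A M u m) (u m)) (m : ℕ) :
    obsSigma P θs A M u m ≤ historySigma c P A M m := by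
  induction m with
  | zero => exact le_sup_left
  | succ m ih =>
    have h1 : 1 ≤ m + 1 := Nat.le_add_left 1 m
    have hA : ∀ t ∈ Icc 0 c.T, Measurable[historySigma c P A M (m + 1)] (A (m + 1) t) :=
      fun t ht => (measurable_pathSigma _ ht).mono
        ((pathSigma_fst_le _ (M (m + 1))).trans (comap_le_historySigma h1 le_rfl)) le_rfl
    have hM : ∀ t ∈ Icc 0 c.T, Measurable[historySigma c P A M (m + 1)] (M (m + 1) t) :=
      fun t ht => (measurable_pathSigma _ ht).mono
        ((pathSigma_snd_le (A (m + 1)) _).trans (comap_le_historySigma h1 le_rfl)) le_rfl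
    refine sup_le (ih.trans (historySigma_mono (Nat.le_succ m))) (iSup₂_le fun t ht => sup_le ?_ ?_)
    · refine Measurable.comap_le ?_
      refine @measurable_price Ω (historySigma c P A M (m + 1)) _ θs (A (m + 1)) (M (m + 1))
        (u (m + 1)) t ht.1 (hA t ht) (hM t ht) ?_
      refine ((hu (m + 1) h1).progressive t ht).mono ?_ le_rfl
      exact sup_le_sup_left (MeasurableSpace.comap_mono (episodeSigma_le h1 ih ht.2)) _
    · exact (hA t ht).comap_le

variable (hc : AreCopies c.T P₀ A₀ M₀ P A M)
include hc

theorem AreCopies.measurable_pairPath {m : ℕ} (hm : 1 ≤ m) :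
    Measurable (pairPath c (A m) (M m)) :=
  measurable_pi_lambda _ fun t => (hc.meas_A m hm t t.2).prodMk (hc.meas_M m hm t t.2)

theorem AreCopies.historySigma_le (k : ℕ) : historySigma c P A M k ≤ mΩ :=
  sup_le nullSigma_le (iSup₂_le fun _ hj => (hc.measurable_pairPath (Finset.mem_Icc.1 hj).1).comap_le)

theorem AreCopies.identDistrib {m : ℕ} (hm : 1 ≤ m) :
    IdentDistrib (pairPath c (A m) (M m)) (pairPath c A₀ M₀) P P₀ := hc.law m hm

theorem AreCopies.indep_history {m : ℕ} (hm : 1 ≤ m) :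
    Indep (MeasurableSpace.comap (pairPath c (A m) (M m)) inferInstance)
      (historySigma c P A M (m - 1)) P := by
  obtain ⟨n, rfl⟩ : ∃ n : ℕ+, (n : ℕ) = m := ⟨⟨m, hm⟩, rfl⟩
  have h1 : iIndep (fun j : ℕ+ => MeasurableSpace.comap (pairPath c (A j) (M j)) inferInstance) P :=
    hc.indep
  have h2 := indep_iSup_of_disjoint (fun j => (hc.measurable_pairPath j.2).comap_le) h1
    (S := {n}) (T := {j | (j : ℕ) ≤ n - 1}) (Set.disjoint_left.2 fun j hj hj' => by
      rw [mem_singleton_iff] at hj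
      subst hj
      have : (j : ℕ) ≤ j - 1 := hj'
      omega)
  refine Indep.sup_nullSigma (indep_of_indep_of_le_left (indep_of_indep_of_le_right h2 ?_) ?_)
  · refine iSup₂_le fun j hj => ?_
    rw [Finset.mem_Icc] at hj
    exact le_biSup (fun j : ℕ+ => MeasurableSpace.comap (pairPath c (A j) (M j)) inferInstance)
      (show (⟨j, Nat.lt_of_succ_le hj.1⟩ : ℕ+) ∈ {j : ℕ+ | (j : ℕ) ≤ n - 1} from hj.2)
  · exact le_biSup (fun j : ℕ+ => MeasurableSpace.comap (pairPath c (A j) (M j)) inferInstance)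
      (mem_singleton n)

/-- The noise is independent of the signal of the same episode, and the pair is independent of the
history. Consequently the noise increments average out under the information of the episode. -/
theorem AreCopies.indep_noise (h₀ : IsPriceModel c.T P₀ 𝓕 A₀ M₀) {m : ℕ} (hm : 1 ≤ m) :
    Indep (pathSigma c (M m)) (historySigma c P A M (m - 1) ⊔ pathSigma c (A m)) P := by
  have hle := (hc.measurable_pairPath hm).comap_le
  refine Indep.sup_right ((pathSigma_snd_le _ _).trans hle) ((pathSigma_fst_le _ _).trans hle)
    (hc.historySigma_le _) ?_ (indep_of_indep_of_le_left (hc.indep_history hm)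
      (sup_le (pathSigma_snd_le _ _) (pathSigma_fst_le _ _)))
  have h1 : Measurable fun x : PairPath c => ((fun t => (x t).1, fun t => (x t).2) :
      (Icc (0 : ℝ) c.T → ℝ) × (Icc (0 : ℝ) c.T → ℝ)) :=
    (measurable_pi_lambda _ fun t => measurable_fst.comp (measurable_pi_apply t)).prodMk
      (measurable_pi_lambda _ fun t => measurable_snd.comp (measurable_pi_apply t))
  exact (indepFun_of_identDistrib_pair h₀.indep ((hc.identDistrib hm).symm.comp h1)).symm

end Copies

end Liquidation

namespace Liquidation

/-! ### Performance in a learning episode -/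

section Factor

variable {Ω : Type*} [mΩ : MeasurableSpace Ω] {P : Measure Ω} [IsProbabilityMeasure P]
  {c : Constants} {A u : ℝ → Ω → ℝ}

/-- The path of a process on `[0,T]`. -/
def pathOf (c : Constants) (A : ℝ → Ω → ℝ) (ω : Ω) : Icc (0 : ℝ) c.T → ℝ := fun t => A t ω

/-- The path of a process on `[0,t]`. -/
def stoppedPath (t : ℝ) (A : ℝ → Ω → ℝ) (ω : Ω) : Icc (0 : ℝ) t → ℝ := fun s => A s ω

theorem iSup_comap_eq (A : ℝ → Ω → ℝ) (t : ℝ) :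
    ⨆ s ∈ Icc (0 : ℝ) t, MeasurableSpace.comap (A s) inferInstance =
      MeasurableSpace.comap (stoppedPath t A) inferInstance := by
  rw [MeasurableSpace.pi, MeasurableSpace.comap_iSup, iSup_subtype]
  simp only [MeasurableSpace.comap_comp]
  rfl

theorem withSignal_eq (ℋ : MeasurableSpace Ω) (A : ℝ → Ω → ℝ) (t : ℝ) :
    withSignal ℋ A t = ℋ ⊔ MeasurableSpace.comap (stoppedPath t A) inferInstance := by
  rw [withSignal, iSup_comap_eq]

theorem measurable_stoppedPath (hA : ∀ t ∈ Icc 0 c.T, Measurable (A t)) {t : ℝ} (ht : t ≤ c.T) :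
    Measurable (stoppedPath t A) :=
  measurable_pi_lambda _ fun s => hA s ⟨s.2.1, s.2.2.trans ht⟩

theorem withSignal_nullSigma_le (hA : ∀ t ∈ Icc 0 c.T, Measurable (A t)) {t : ℝ} (ht : t ≤ c.T) :
    withSignal (nullSigma P) A t ≤ mΩ := by
  rw [withSignal_eq]
  exact sup_le nullSigma_le (measurable_stoppedPath hA ht).comap_le

/-- A control that is adapted to a signal is a functional of the path of the signal. -/
theorem exists_functional (hA : ∀ t ∈ Icc 0 c.T, Measurable (A t))
    (hu : IsControl c.T P (withSignal (nullSigma P) A) u) :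
    ∃ Ψ : (Icc (0 : ℝ) c.T → ℝ) → L2 c.T, Measurable Ψ ∧
      (∀ᵐ ω ∂P, path c.T u ω = Ψ (pathOf c A ω)) ∧
      ∀ᵐ t ∂(leb c.T), ∃ ψ : (Icc (0 : ℝ) t → ℝ) → ℝ, Measurable ψ ∧
        ∀ᵐ ω ∂P, ev (Ψ (pathOf c A ω)) t = ψ (stoppedPath t A ω) := by
  have hT := right_mem_Icc.2 c.T_pos.le
  have hle : ∀ t ∈ Icc 0 c.T, withSignal (nullSigma P) A t ≤ mΩ := fun t ht =>
    withSignal_nullSigma_le hA ht.2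
  have hm2 := hu.memLp_prod c.T_pos.le hle
  have hm1 := hu.measurable_prod c.T_pos.le hle
  have h1 : Measurable[withSignal (nullSigma P) A c.T] (path c.T u) :=
    @measurable_path Ω (withSignal (nullSigma P) A c.T) c.T u (hu.measurable_indicator hT)
  rw [withSignal_eq] at h1
  -- Null events are discarded first; the Doob–Dynkin factorisation then yields a functional of the
  -- path.
  obtain ⟨g, hg, hge⟩ := aestronglyMeasurable_of_sup_nullSigma
    (measurable_stoppedPath hA le_rfl).comap_le (Measurable.stronglyMeasurable h1)
    ((memLp_path hm1 hm2).integrable (by norm_num))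
  obtain ⟨Ψ, hΨ, rfl⟩ := hg.exists_eq_measurable_comp
  refine ⟨Ψ, hΨ.measurable, hge, ?_⟩
  filter_upwards [ae_ev_path hm1 hm2, ae_leb_mem c.T, memLp_prod_section hm2] with t h2 ht h3
  have h4 : Measurable[withSignal (nullSigma P) A t] (u t) := hu.measurable ht
  rw [withSignal_eq] at h4
  have h5 : Integrable (u t) P := by
    have := h3.integrable (q := 2) (by norm_num)
    simpa only [indicator_of_mem ht] using this
  -- The same reduction on `[0,t]` shows that the functional is non-anticipative.
  obtain ⟨g, hg, hge'⟩ := aestronglyMeasurable_of_sup_nullSigma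
    (measurable_stoppedPath hA ht.2).comap_le (Measurable.stronglyMeasurable h4) h5
  obtain ⟨ψ, hψ, rfl⟩ := hg.exists_eq_measurable_comp
  refine ⟨ψ, hψ.measurable, ?_⟩
  filter_upwards [hge, hge', h2] with ω e1 e2 e3
  rw [e1] at e3
  exact e3.trans e2

end Factor

/-! ### Conditional payoffs in a single episode -/

section Episode

variable {Ω₀ Ω : Type*} [mΩ₀ : MeasurableSpace Ω₀] [mΩ : MeasurableSpace Ω]
  {P₀ : Measure Ω₀} [IsProbabilityMeasure P₀] {P : Measure Ω} [IsProbabilityMeasure P]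
  {c : Constants} {𝓕 : Filtration ℝ≥0 mΩ₀} {A₀ M₀ : ℝ → Ω₀ → ℝ} {A M u : ℕ → ℝ → Ω → ℝ}
  {θs : Param c.T} {m : ℕ}

theorem measurable_fst_path (c : Constants) :
    Measurable fun (x : PairPath c) (t : Icc (0 : ℝ) c.T) => (x t).1 :=
  measurable_pi_lambda _ fun t => measurable_fst.comp (measurable_pi_apply t)

theorem measurable_snd_path (c : Constants) :
    Measurable fun (x : PairPath c) (t : Icc (0 : ℝ) c.T) => (x t).2 :=
  measurable_pi_lambda _ fun t => measurable_snd.comp (measurable_pi_apply t)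

/-- The payoff as a function of the pair of paths of signal and noise and of the strategy. -/
def payoffPath (c : Constants) (θ : Param c.T) (x : PairPath c) (U : L2 c.T) : ℝ :=
  payoffForm c θ ((x (endpoint c)).1 + (x (endpoint c)).2)
    (increment c (fun t => (x t).1) + increment c fun t => (x t).2) U

theorem measurable_payoffPath (c : Constants) (θ : Param c.T) {U : PairPath c → L2 c.T}
    (hU : Measurable U) : Measurable fun x => payoffPath c θ x (U x) := by
  have h1 : Measurable fun x : PairPath c => increment c (fun t => (x t).1) +
      increment c fun t => (x t).2 :=
    ((measurable_increment c).comp (measurable_fst_path c)).add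
      ((measurable_increment c).comp (measurable_snd_path c))
  have h2 : Measurable fun x : PairPath c => (x (endpoint c)).1 + (x (endpoint c)).2 :=
    (measurable_fst.comp (measurable_pi_apply _)).add (measurable_snd.comp (measurable_pi_apply _))
  exact ((((h2.const_mul c.q).add ((h1.add_const _).inner hU)).sub
    (((Dop c θ 0).continuous.measurable.comp hU).inner hU |>.const_mul _)).sub_const _).sub_const _

theorem payoffForm_eq_payoffPath {Ω : Type*} {A M : ℝ → Ω → ℝ}
    (hA : ∀ ω, IsCadlagOn c.T fun t => A t ω)
    (hM : ∀ ω, IsCadlagOn c.T fun t => M t ω) (θ : Param c.T) (ω : Ω) (U : L2 c.T) :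
    payoffForm c θ (A c.T ω + M c.T ω)
      (path c.T (fun t ω => A t ω - A c.T ω) ω + path c.T (fun t ω => M t ω - M c.T ω) ω) U =
      payoffPath c θ (pairPath c A M ω) U := by
  rw [path_increment hA, path_increment hM]
  rfl

variable (h₀ : IsPriceModel c.T P₀ 𝓕 A₀ M₀) (hc : AreCopies c.T P₀ A₀ M₀ P A M)

include hc in
theorem AreCopies.obsSigma_le
    (hu : ∀ m, 1 ≤ m → IsControl c.T P (episodeSigma P θs A M u m) (u m)) (k : ℕ) :
    obsSigma P θs A M u k ≤ mΩ :=
  (obsSigma_le_historySigma hu k).trans (hc.historySigma_le k)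

include hc in
theorem AreCopies.condExp_functional
    (hu : ∀ m, 1 ≤ m → IsControl c.T P (episodeSigma P θs A M u m) (u m)) (hm : 1 ≤ m)
    {Φ : PairPath c → ℝ} (hΦ : Measurable Φ) :
    P[fun ω => Φ (pairPath c (A m) (M m) ω) | obsSigma P θs A M u (m - 1)] =ᵐ[P]
      fun _ => ∫ ω, Φ (pairPath c A₀ M₀ ω) ∂P₀ := by
  have h1 : Measurable[MeasurableSpace.comap (pairPath c (A m) (M m)) inferInstance]
      fun ω => Φ (pairPath c (A m) (M m) ω) := hΦ.comp (comap_measurable _)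
  refine (condExp_indep_eq (hc.measurable_pairPath hm).comap_le (hc.obsSigma_le hu _)
    (Measurable.stronglyMeasurable h1) (indep_of_indep_of_le_right (hc.indep_history hm)
      (obsSigma_le_historySigma hu _))).trans ?_
  exact Eventually.of_forall fun _ => ((hc.identDistrib hm).comp hΦ).integral_eq

include h₀ hc

theorem AreCopies.lintegral_increment_A (hm : 1 ≤ m) :
    ∫⁻ ω, ∫⁻ t, ‖A m t ω - A m c.T ω‖ₑ ^ 2 ∂(leb c.T) ∂P < ∞ := by
  have h1 := h₀.lintegral_increment_A_lt_top
  simp only [incrementEnergy_eq h₀.cadlag_A] at h1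
  simp only [incrementEnergy_eq (hc.cadlag_A m hm)]
  have h2 := ((hc.identDistrib hm).comp ((measurable_incrementEnergy c).comp
    (measurable_fst_path c))).lintegral_eq
  exact lt_of_eq_of_lt h2 h1

theorem AreCopies.lintegral_increment_M (hm : 1 ≤ m) :
    ∫⁻ ω, ∫⁻ t, ‖M m t ω - M m c.T ω‖ₑ ^ 2 ∂(leb c.T) ∂P < ∞ := by
  have h1 := h₀.lintegral_increment_M_lt_top
  simp only [incrementEnergy_eq h₀.cadlag_M] at h1
  simp only [incrementEnergy_eq (hc.cadlag_M m hm)]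
  have h2 := ((hc.identDistrib hm).comp ((measurable_incrementEnergy c).comp
    (measurable_snd_path c))).lintegral_eq
  exact lt_of_eq_of_lt h2 h1

theorem AreCopies.memLp_A_terminal (hm : 1 ≤ m) : MemLp (A m c.T) 2 P :=
  ((hc.identDistrib hm).comp (measurable_fst.comp
    (measurable_pi_apply (endpoint c)) : Measurable fun x : PairPath c =>
      (x (endpoint c)).1)).memLp_iff.2 h₀.memLp_A_terminal

theorem AreCopies.identDistrib_M (hm : 1 ≤ m) {t : ℝ} (ht : t ∈ Icc 0 c.T) :
    IdentDistrib (M m t) (M₀ t) P P₀ :=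
  (hc.identDistrib hm).comp (measurable_snd.comp
    (measurable_pi_apply (⟨t, ht⟩ : Icc (0 : ℝ) c.T)) : Measurable fun x : PairPath c =>
      (x ⟨t, ht⟩).2)

theorem AreCopies.memLp_M (hm : 1 ≤ m) {t : ℝ} (ht : t ∈ Icc 0 c.T) : MemLp (M m t) 2 P :=
  (hc.identDistrib_M h₀ hm ht).memLp_iff.2 (h₀.memLp_M ht)

theorem AreCopies.integral_M (hm : 1 ≤ m) {t : ℝ} (ht : t ∈ Icc 0 c.T) : ∫ ω, M m t ω ∂P = 0 :=
  (hc.identDistrib_M h₀ hm ht).integral_eq.trans (h₀.integral_M ht)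

theorem AreCopies.memLp_increment_A (hm : 1 ≤ m) :
    MemLp (fun z : ℝ × Ω => (Icc 0 c.T).indicator (fun s => A m s z.2 - A m c.T z.2) z.1) 2
    ((leb c.T).prod P) :=
  memLp_indicator_of_lintegral (u := fun s ω => A m s ω - A m c.T ω)
    (measurable_indicator_increment (hc.cadlag_A m hm) (hc.meas_A m hm))
    (hc.lintegral_increment_A h₀ hm)

theorem AreCopies.memLp_increment_M (hm : 1 ≤ m) :
    MemLp (fun z : ℝ × Ω => (Icc 0 c.T).indicator (fun s => M m s z.2 - M m c.T z.2) z.1) 2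
    ((leb c.T).prod P) :=
  memLp_indicator_of_lintegral (u := fun s ω => M m s ω - M m c.T ω)
    (measurable_indicator_increment (hc.cadlag_M m hm) (hc.meas_M m hm))
    (hc.lintegral_increment_M h₀ hm)

theorem AreCopies.noiseSetting
    (hu : ∀ m, 1 ≤ m → IsControl c.T P (episodeSigma P θs A M u m) (u m)) (hm : 1 ≤ m) :
    NoiseSetting c P (episodeSigma P θs A M u m) (A m) (M m) where
  meas_M := measurable_indicator_increment (hc.cadlag_M m hm) (hc.meas_M m hm)
  memLp_M := hc.memLp_increment_M h₀ hm
  condExp_M := by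
    have hT := right_mem_Icc.2 c.T_pos.le
    filter_upwards [ae_leb_mem c.T] with t ht
    have h1 : Measurable[pathSigma c (M m)] fun ω => M m t ω - M m c.T ω :=
      (measurable_pathSigma (M m) ht).sub (measurable_pathSigma (M m) hT)
    have h2 := condExp_indep_eq (μ := P) ((pathSigma_snd_le (A m) (M m)).trans
      (hc.measurable_pairPath hm).comap_le)
      ((episodeSigma_le hm (obsSigma_le_historySigma hu _) ht.2).trans (hc.historySigma_le _))
      (Measurable.stronglyMeasurable h1) (indep_of_indep_of_le_right (hc.indep_noise h₀ hm)
        ((withSignal_le_pathSigma _ _ ht.2).trans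
          (sup_le_sup_right (obsSigma_le_historySigma hu _) _)))
    refine h2.trans (Eventually.of_forall fun _ => ?_)
    simp only [Pi.zero_apply]
    rw [integral_sub ((hc.memLp_M h₀ hm ht).integrable (by norm_num))
      ((hc.memLp_M h₀ hm hT).integrable (by norm_num)), hc.integral_M h₀ hm ht,
      hc.integral_M h₀ hm hT, sub_zero]
  integrable_terminal := ((hc.memLp_A_terminal h₀ hm).integrable (by norm_num)).add
    ((hc.memLp_M h₀ hm (right_mem_Icc.2 c.T_pos.le)).integrable (by norm_num))

/-- The performance gap in an exploitation episode. -/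
theorem AreCopies.exploitation_gap
    (hu : ∀ m, 1 ≤ m → IsControl c.T P (episodeSigma P θs A M u m) (u m)) (hm : 1 ≤ m)
    {L ε : ℝ} (hL : 0 < L) (hε : 0 ≤ ε) (hLε : 0 < 2 * L⁻¹ - ε)
    (hθs : θs ∈ admissibleParams c.T L ε) {us : ℝ → Ω₀ → ℝ}
    (hus : IsControl c.T P₀ (withSignal (nullSigma P₀) A₀) us) {θ : Ω → Param c.T}
    (hθ : Measurable[obsSigma P θs A M u (m - 1)] θ)
    (hg : IsGreedyOn c P (episodeSigma P θs A M u m) (A m) θ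
      {ω | θ ω ∈ admissibleParams c.T L ε} (u m)) :
    ∀ᵐ ω ∂P, θ ω ∈ admissibleParams c.T L ε →
      (∫ ω₀, payoff c θs A₀ M₀ us ω₀ ∂P₀) -
        (P[payoff c θs (A m) (M m) (u m) | obsSigma P θs A M u (m - 1)]) ω ≤
      gapConst c L ε (∫ ω, ‖increment c (pathOf c A₀ ω) + driftVec c‖ ^ 2 ∂P₀) *
        ‖θ ω - θs‖ ^ 2 := by
  classical
  set E : Set Ω := {ω | θ ω ∈ admissibleParams c.T L ε} with hE
  have hEm : MeasurableSet[obsSigma P θs A M u (m - 1)] E :=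
    hθ (isClosed_admissibleParams c L ε).measurableSet
  have hAm := fun t ht => h₀.measurable_A (t := t) ht
  obtain ⟨Ψ, hΨ, hΨe, hΨa⟩ := exists_functional hAm hus
  -- `Setting` requires an admissible parameter everywhere. Off `E` the true parameter serves as a
  -- harmless default, since the conclusion concerns `E` only.
  set θ' : Ω → Param c.T := E.piecewise θ fun _ => θs with hθ'
  have hobs := obsSigma_le_historySigma hu (m - 1)
  have S : Setting (obsSigma P θs A M u (m - 1)) c P (episodeSigma P θs A M u m) (A m) (u m) θ' L ε :=
    { le := fun t ht => (episodeSigma_le hm hobs ht.2).trans (hc.historySigma_le _)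
      mono := fun s _ t _ hst => withSignal_mono _ _ hst
      initial := fun t _ => le_sup_left
      meas_A := measurable_indicator_increment (hc.cadlag_A m hm) (hc.meas_A m hm)
      memLp_A := hc.memLp_increment_A h₀ hm
      control := hu m hm
      meas_θ := Measurable.piecewise hEm hθ measurable_const
      mem_θ := fun ω => by
        by_cases hω : ω ∈ E
        · rw [hθ', piecewise_eq_of_mem _ _ _ hω]; exact hω
        · rw [hθ', piecewise_eq_of_notMem _ _ _ hω]; exact hθs
      L_pos := hL
      ε_nonneg := hε
      coercive := hLε }
  have hg' : IsGreedyOn c P (episodeSigma P θs A M u m) (A m) θ' E (u m) := by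
    filter_upwards [hg] with t ht
    filter_upwards [ht] with ω hω hωE
    rw [hθ', piecewise_eq_of_mem _ _ _ hωE]
    exact hω hωE
  have hmA : Measurable (pathOf c (A m)) := measurable_pi_lambda _ fun t => hc.meas_A m hm t t.2
  have hAid : IdentDistrib (pathOf c (A m)) (pathOf c A₀) P P₀ :=
    (hc.identDistrib hm).comp (measurable_fst_path c)
  have hm2 := hus.memLp_prod c.T_pos.le fun t ht => withSignal_nullSigma_le hAm ht.2
  have hm1 := hus.measurable_prod c.T_pos.le fun t ht => withSignal_nullSigma_le hAm ht.2
  -- The comparison strategy applies to the signal of this episode the functional `Ψ` that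
  -- represents `us`. Its integrability, adaptedness and expected payoff follow from equality of
  -- laws.
  have hV2 : MemLp (fun ω => Ψ (pathOf c (A m) ω)) 2 P :=
    (hAid.comp hΨ).memLp_iff.2 ((memLp_path hm1 hm2).ae_eq hΨe)
  have hVm : ∀ᵐ t ∂(leb c.T), AEStronglyMeasurable[episodeSigma P θs A M u m t]
      (fun ω => ev (Ψ (pathOf c (A m) ω)) t) P := by
    filter_upwards [hΨa, ae_leb_mem c.T] with t h1 ht
    obtain ⟨ψ, hψ, hψe⟩ := h1
    have h2 : Measurable fun x : Icc (0 : ℝ) c.T → ℝ =>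
        ψ fun s : Icc (0 : ℝ) t => x ⟨s, s.2.1, s.2.2.trans ht.2⟩ :=
      hψ.comp (measurable_pi_lambda _ fun s => measurable_pi_apply _)
    have h3 : Measurable fun x : Icc (0 : ℝ) c.T → ℝ => ev (Ψ x) t :=
      measurable_ev_comp hΨ measurable_const
    have h4 : ∀ᵐ ω ∂P, ev (Ψ (pathOf c (A m) ω)) t = ψ (stoppedPath t (A m) ω) :=
      hAid.symm.ae_snd (measurableSet_eq_fun h3 h2) hψe
    have h5 : Measurable[episodeSigma P θs A M u m t] fun ω => ψ (stoppedPath t (A m) ω) := by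
      rw [episodeSigma, withSignal_eq]
      exact (hψ.comp (comap_measurable (stoppedPath t (A m)))).mono le_sup_right le_rfl
    exact ⟨_, Measurable.stronglyMeasurable h5, h4⟩
  have hJ : P[fun ω => payoffForm c θs (A m c.T ω + M m c.T ω)
      (path c.T (fun t ω => A m t ω - A m c.T ω) ω + path c.T (fun t ω => M m t ω - M m c.T ω) ω)
      (Ψ (pathOf c (A m) ω)) | obsSigma P θs A M u (m - 1)] =ᵐ[P] fun _ =>
      ∫ ω₀, payoff c θs A₀ M₀ us ω₀ ∂P₀ := by
    simp only [payoffForm_eq_payoffPath (hc.cadlag_A m hm) (hc.cadlag_M m hm)]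
    refine (hc.condExp_functional (A₀ := A₀) (M₀ := M₀) hu hm (measurable_payoffPath c θs
      (U := fun x => Ψ fun t => (x t).1) (hΨ.comp (measurable_fst_path c)))).trans ?_
    refine Eventually.of_forall fun _ => ?_
    refine integral_congr_ae ?_
    have e1 := memLp_indicator_of_lintegral (u := fun s ω => A₀ s ω - A₀ c.T ω)
      (measurable_indicator_increment h₀.cadlag_A hAm) h₀.lintegral_increment_A_lt_top
    have e2 := memLp_indicator_of_lintegral (u := fun s ω => M₀ s ω - M₀ c.T ω)
      (measurable_indicator_increment h₀.cadlag_M fun t ht => h₀.measurable_M ht)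
      h₀.lintegral_increment_M_lt_top
    filter_upwards [hΨe, ae_memLp_of_prod (u := us) hm2,
      ae_memLp_of_prod (u := fun t ω => A₀ t ω - A₀ c.T ω) e1,
      ae_memLp_of_prod (u := fun t ω => M₀ t ω - M₀ c.T ω) e2] with ω h1 h2 h3 h4
    rw [payoff_eq c θs h2 h3 h4, payoffForm_eq_payoffPath h₀.cadlag_A h₀.cadlag_M, h1]
    rfl
  have hK : P[fun ω => ‖path c.T (fun t ω => A m t ω - A m c.T ω) ω + driftVec c‖ ^ 2 |
      obsSigma P θs A M u (m - 1)] =ᵐ[P] fun _ =>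
      ∫ ω, ‖increment c (pathOf c A₀ ω) + driftVec c‖ ^ 2 ∂P₀ := by
    simp only [path_increment (hc.cadlag_A m hm)]
    exact hc.condExp_functional (A₀ := A₀) (M₀ := M₀) hu hm
      (Φ := fun x => ‖increment c (fun t => (x t).1) + driftVec c‖ ^ 2)
      (((((measurable_increment c).comp (measurable_fst_path c)).add_const _).norm).pow_const 2)
  have hmain := S.sub_condExp_payoff_le (hc.noiseSetting h₀ hu hm) hθs hEm hg' (hΨ.comp hmA) hV2 hVm
    hK hJ
  filter_upwards [hmain] with ω hω hωE
  have := hω hωE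
  rwa [hθ', piecewise_eq_of_mem _ _ _ (show ω ∈ E from hωE)] at this

/-- The conditional payoff in an exploration episode is constant. -/
theorem AreCopies.condExp_exploration
    (hu : ∀ m, 1 ≤ m → IsControl c.T P (episodeSigma P θs A M u m) (u m)) (hm : 1 ≤ m)
    {ue : ℝ → ℝ} (hue : MemLp ue 2 (leb c.T)) (hum : ∀ t ∈ Icc 0 c.T, ∀ ω, u m t ω = ue t) :
    P[payoff c θs (A m) (M m) (u m) | obsSigma P θs A M u (m - 1)] =ᵐ[P] fun _ =>
      ∫ ω, payoffPath c θs (pairPath c A₀ M₀ ω) (toL2 c.T ue) ∂P₀ := by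
  refine (condExp_congr_ae ?_).trans (hc.condExp_functional (A₀ := A₀) (M₀ := M₀) hu hm
    (measurable_payoffPath c θs (U := fun _ => toL2 c.T ue) measurable_const))
  filter_upwards [ae_memLp_of_prod (u := fun t ω => A m t ω - A m c.T ω) (hc.memLp_increment_A h₀ hm),
    ae_memLp_of_prod (u := fun t ω => M m t ω - M m c.T ω) (hc.memLp_increment_M h₀ hm)] with ω h1 h2
  have h3 : (fun t => u m t ω) =ᵐ[leb c.T] ue := by
    filter_upwards [ae_leb_mem c.T] with t ht using hum t ht ω
  rw [payoff_eq c θs (hue.ae_eq h3.symm) h1 h2,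
    payoffForm_eq_payoffPath (hc.cadlag_A m hm) (hc.cadlag_M m hm), path, toL2_congr h3]

end Episode

end Liquidation

namespace Liquidation

/-! ### Regularised least squares -/

section RidgeRegression

variable {H : Type*} [NormedAddCommGroup H] [InnerProductSpace ℝ H]

/-- The map `G ↦ (K G, √τ G)`. -/
def ridgeMap (K : H →L[ℝ] H) (τ : ℝ) : H →ₗ[ℝ] WithLp 2 (H × H) :=
  (WithLp.linearEquiv 2 ℝ (H × H)).symm.toLinearMap ∘ₗ
    K.toLinearMap.prod (√τ • LinearMap.id)

/-- The penalised loss is a squared distance in `H × H`, so that minimising it is an orthogonal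
projection. -/
theorem norm_sq_ridge (K : H →L[ℝ] H) {τ : ℝ} (hτ : 0 < τ) (y G : H) :
    ‖WithLp.toLp 2 (y, (0 : H)) + ridgeMap K τ G‖ ^ 2 = ‖y + K G‖ ^ 2 + τ * ‖G‖ ^ 2 := by
  have h1 : WithLp.toLp 2 (y, (0 : H)) + ridgeMap K τ G = WithLp.toLp 2 (y + K G, √τ • G) := by
    have : ridgeMap K τ G = WithLp.toLp 2 (K G, √τ • G) := rfl
    rw [this, ← WithLp.toLp_add, Prod.mk_add_mk, zero_add]
  rw [h1, WithLp.prod_norm_sq_eq_of_L2]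
  change ‖y + K G‖ ^ 2 + ‖√τ • G‖ ^ 2 = _
  rw [norm_smul, mul_pow, Real.norm_eq_abs, sq_abs, Real.sq_sqrt hτ.le]

/-- The minimiser of the regularised quadratic loss over a finite-dimensional subspace. -/
def ridge (K : H →L[ℝ] H) (τ : ℝ) (V : Submodule ℝ H) [FiniteDimensional ℝ V] (y : H) : H :=
  -((√τ)⁻¹ • ((V.map (ridgeMap K τ)).starProjection (WithLp.toLp 2 (y, (0 : H)))).snd)

/-- The estimator is defined by a choice of minimiser, which says nothing about measurability. This
closed form supplies it. -/
theorem continuous_ridge (K : H →L[ℝ] H) (τ : ℝ) (V : Submodule ℝ H) [FiniteDimensional ℝ V] :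
    Continuous (ridge K τ V) := by
  unfold ridge
  have h1 : Continuous fun y : H => WithLp.toLp 2 (y, (0 : H)) :=
    (WithLp.prod_continuous_toLp 2 H H).comp (continuous_id.prodMk continuous_const)
  have h2 : Continuous fun z : WithLp 2 (H × H) => z.snd :=
    continuous_snd.comp (WithLp.prod_continuous_ofLp 2 H H)
  exact ((h2.comp ((ContinuousLinearMap.continuous _).comp h1)).const_smul _).neg

/-- Pythagoras around the projection: the excess loss of `G` is `‖ridgeMap K τ (G₀ + G)‖²`, and `τ >
0` makes it vanish only at `-G₀`, whence existence and uniqueness. -/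
theorem eq_ridge_of_isMin (K : H →L[ℝ] H) {τ : ℝ} (hτ : 0 < τ) (V : Submodule ℝ H)
    [FiniteDimensional ℝ V] (y G : H) :
    (G ∈ V ∧ ∀ G' ∈ V, ‖y + K G‖ ^ 2 + τ * ‖G‖ ^ 2 ≤ ‖y + K G'‖ ^ 2 + τ * ‖G'‖ ^ 2) ↔
      G = ridge K τ V y := by
  set W := V.map (ridgeMap K τ) with hW
  set Y : WithLp 2 (H × H) := WithLp.toLp 2 (y, (0 : H)) with hY
  have hs : √τ ≠ 0 := (Real.sqrt_pos.2 hτ).ne'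
  have hsnd : ∀ G, (ridgeMap K τ G).snd = √τ • G := fun G => rfl
  obtain ⟨G₀, hG₀, he⟩ : ∃ G₀ ∈ V, ridgeMap K τ G₀ = W.starProjection Y :=
    W.starProjection_apply_mem Y
  have hr : ridge K τ V y = -G₀ := by
    rw [ridge]
    change -((√τ)⁻¹ • (W.starProjection Y).snd) = -G₀
    rw [← he, hsnd, smul_smul, inv_mul_cancel₀ hs, one_smul]
  have hpyth : ∀ G ∈ V, ‖y + K G‖ ^ 2 + τ * ‖G‖ ^ 2 =
      ‖Y - W.starProjection Y‖ ^ 2 + ‖ridgeMap K τ (G₀ + G)‖ ^ 2 := by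
    intro G hG
    rw [← norm_sq_ridge K hτ]
    have h1 : Y + ridgeMap K τ G = (Y - W.starProjection Y) + ridgeMap K τ (G₀ + G) := by
      rw [map_add, he]; abel
    rw [← hY, h1, norm_add_sq_real, W.starProjection_inner_eq_zero Y _
      (Submodule.mem_map_of_mem (V.add_mem hG₀ hG))]
    ring
  have hpos : ∀ G, τ * ‖G‖ ^ 2 ≤ ‖ridgeMap K τ G‖ ^ 2 := by
    intro G
    have h1 := norm_sq_ridge K hτ 0 G
    have h2 : (WithLp.toLp 2 ((0 : H), (0 : H))) = (0 : WithLp 2 (H × H)) := rfl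
    rw [h2, zero_add, zero_add] at h1
    rw [h1]
    have : 0 ≤ ‖K G‖ ^ 2 := by positivity
    linarith
  rw [hr]
  constructor
  · rintro ⟨hG, hmin⟩
    have h1 := hmin (-G₀) (V.neg_mem hG₀)
    rw [hpyth G hG, hpyth _ (V.neg_mem hG₀), add_neg_cancel, map_zero, norm_zero] at h1
    have h2 := hpos (G₀ + G)
    have h3 : τ * ‖G₀ + G‖ ^ 2 ≤ 0 := by linarith
    have h4 : ‖G₀ + G‖ ^ 2 = 0 := by
      have : 0 ≤ ‖G₀ + G‖ ^ 2 := by positivity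
      nlinarith
    have h5 : G₀ + G = 0 := by simpa using h4
    exact (neg_eq_of_add_eq_zero_right h5).symm
  · rintro rfl
    refine ⟨V.neg_mem hG₀, fun G' hG' => ?_⟩
    rw [hpyth _ (V.neg_mem hG₀), hpyth G' hG', add_neg_cancel, map_zero, norm_zero]
    have : 0 ≤ ‖ridgeMap K τ (G₀ + G')‖ ^ 2 := by positivity
    linarith

end RidgeRegression

/-! ### The least-squares estimator on piecewise constant functions -/

section Estimator

variable {T : ℝ}

/-- The indicator of the `i`-th interval of a partition. -/
def blockInd (T : ℝ) (p : ℕ → ℝ) (i : ℕ) : L2 T :=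
  toL2 T ((Ico (p i) (p (i + 1))).indicator fun _ => 1)

/-- The space of piecewise constant functions. -/
def blockSpace (T : ℝ) (N : ℕ) (p : ℕ → ℝ) : Submodule ℝ (L2 T) :=
  Submodule.span ℝ (range fun i : Fin N => blockInd T p i)

instance (T : ℝ) (N : ℕ) (p : ℕ → ℝ) : FiniteDimensional ℝ (blockSpace T N p) :=
  FiniteDimensional.span_of_finite ℝ (finite_range _)

theorem coeFn_finset_sum {ι : Type*} (s : Finset ι) (f : ι → L2 T) :
    (∑ i ∈ s, f i : L2 T) =ᵐ[leb T] fun t => ∑ i ∈ s, f i t := by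
  classical
  induction s using Finset.induction_on with
  | empty =>
    filter_upwards [Lp.coeFn_zero ℝ 2 (leb T)] with t ht
    rw [Finset.sum_empty, Finset.sum_empty, ht]
    rfl
  | insert i s hi ih =>
    rw [Finset.sum_insert hi]
    filter_upwards [Lp.coeFn_add (f i) (∑ i ∈ s, f i), ih] with t h1 h2
    rw [h1, Pi.add_apply, h2, Finset.sum_insert hi]

theorem memLp_block (p : ℕ → ℝ) (i : ℕ) :
    MemLp ((Ico (p i) (p (i + 1))).indicator fun _ => (1 : ℝ)) 2 (leb T) :=
  (memLp_const_leb T 1).indicator measurableSet_Ico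

theorem sum_block_coe (N : ℕ) (p v : ℕ → ℝ) :
    (∑ i ∈ Finset.range N, v i • blockInd T p i : L2 T) =ᵐ[leb T] fun t =>
      ∑ i ∈ Finset.range N, (Ico (p i) (p (i + 1))).indicator (fun _ => v i) t := by
  have h : ∀ i ∈ Finset.range N, ∀ᵐ t ∂(leb T), (v i • blockInd T p i : L2 T) t =
      (Ico (p i) (p (i + 1))).indicator (fun _ => v i) t := by
    intro i _
    filter_upwards [Lp.coeFn_smul (v i) (blockInd T p i), coeFn_toL2 (memLp_block p i)] with t h1 h2
    rw [h1, Pi.smul_apply, blockInd, h2]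
    by_cases ht : t ∈ Ico (p i) (p (i + 1)) <;> simp [ht]
  filter_upwards [coeFn_finset_sum (Finset.range N) fun i => v i • blockInd T p i,
    (Finset.range N).eventually_all.2 h] with t h1 h2
  rw [h1]
  exact Finset.sum_congr rfl h2

theorem mem_piecewiseConst {N : ℕ} {p : ℕ → ℝ} {f : L2 T} :
    f ∈ piecewiseConst T N p ↔ f ∈ blockSpace T N p := by
  rw [blockSpace, Submodule.mem_span_range_iff_exists_fun]
  constructor
  · rintro ⟨v, hv⟩
    refine ⟨fun i => v i, ?_⟩
    rw [← Finset.sum_range fun i => v i • blockInd T p i]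
    exact Lp.ext ((sum_block_coe N p v).trans hv.symm)
  · rintro ⟨v, rfl⟩
    refine ⟨fun i => if h : i < N then v ⟨i, h⟩ else 0, ?_⟩
    refine EventuallyEq.trans ?_ (sum_block_coe N p _)
    rw [Finset.sum_range]
    simp

variable {ue : ℝ → ℝ}

theorem IsExploration.continuousOn (h : IsExploration T ue) (hT : 0 ≤ T) :
    ContinuousOn ue (Icc 0 T) := by
  have := h.1.continuousOn
  rwa [uIcc_of_le hT] at this

theorem IsExploration.memLp (h : IsExploration T ue) (hT : 0 ≤ T) : MemLp ue 2 (leb T) := by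
  obtain ⟨C, hC⟩ := isCompact_Icc.exists_bound_of_continuousOn (h.continuousOn hT)
  exact MemLp.of_bound ((h.continuousOn hT).aestronglyMeasurable measurableSet_Icc) C
    (ae_leb fun t ht => hC t ht)

/-- The convolution operator of the exploration strategy. -/
def exploreOp (T : ℝ) (ue : ℝ → ℝ) : L2 T →L[ℝ] L2 T :=
  integralOp T fun t s => if s < t then ev (toL2 T ue) (t - s) else 0

theorem exploreOp_apply (h : MemLp ue 2 (leb T)) (G : L2 T) :
    exploreOp T ue G =ᵐ[leb T] fun t => ∫ s in (0 : ℝ)..t, ue (t - s) * G s := by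
  filter_upwards [integralOp_apply T _ (memLp_convKernel (measurable_ev_left (toL2 T ue))
    (memLp_ev _)) G, ae_leb_mem T] with t h1 ht
  rw [exploreOp, h1, intervalIntegral_eq_integral_leb ht]
  refine integral_congr_ae ?_
  filter_upwards [ae_translate_left ht.2 (ev_ae_eq_of_eq h)] with s hs
  split_ifs with hst
  · rw [hs hst]
  · rw [zero_mul]

theorem lseLoss_eq {E : Finset ℕ} {S A : ℕ → ℝ → ℝ} (hT : 0 ≤ T) (h : MemLp ue 2 (leb T))
    {y : ℕ → L2 T} (hy : ∀ m ∈ E, (fun t => S m t - A m t) =ᵐ[leb T] y m) (τ : ℝ) (G : L2 T) :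
    lseLoss T ue E S A τ G = 1 / (E.card : ℝ) * ∑ m ∈ E,
      ‖y m + (lseLambda ue E S A • toL2 T ue + exploreOp T ue G)‖ ^ 2 + τ * ‖G‖ ^ 2 := by
  rw [lseLoss]
  congr 2
  refine Finset.sum_congr rfl fun m hm => ?_
  rw [integral_leb_eq hT, norm_sq_L2_eq]
  refine integral_congr_ae ?_
  filter_upwards [hy m hm, exploreOp_apply h G, coeFn_toL2 h,
    Lp.coeFn_smul (lseLambda ue E S A) (toL2 T ue),
    Lp.coeFn_add (lseLambda ue E S A • toL2 T ue) (exploreOp T ue G),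
    Lp.coeFn_add (y m) (lseLambda ue E S A • toL2 T ue + exploreOp T ue G)] with t h1 h2 h3 h4 h5 h6
  rw [h6, Pi.add_apply, h5, Pi.add_apply, h4, Pi.smul_apply, h3, h2, ← h1, smul_eq_mul]
  ring

/-- The mean of the losses differs from the loss at the mean by a variance term free of `b`. So the
minimiser depends on the data only through their average. -/
theorem mean_norm_sq_eq {H : Type*} [NormedAddCommGroup H] [InnerProductSpace ℝ H]
    {ι : Type*} (E : Finset ι) (hE : E.Nonempty) (a : ι → H) (b : H) :
    1 / (E.card : ℝ) * ∑ m ∈ E, ‖a m + b‖ ^ 2 = ‖(1 / (E.card : ℝ)) • (∑ m ∈ E, a m) + b‖ ^ 2 +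
      (1 / (E.card : ℝ) * ∑ m ∈ E, ‖a m‖ ^ 2 - ‖(1 / (E.card : ℝ)) • ∑ m ∈ E, a m‖ ^ 2) := by
  have hc : (E.card : ℝ) ≠ 0 := by exact_mod_cast hE.card_pos.ne'
  simp only [norm_add_sq_real, Finset.sum_add_distrib, ← Finset.mul_sum, Finset.sum_const,
    nsmul_eq_mul, inner_smul_left, ← sum_inner]
  simp only [conj_trivial]
  field_simp
  ring

theorem lseKernel_eq {E : Finset ℕ} (hE : E.Nonempty) {S A : ℕ → ℝ → ℝ} (hT : 0 ≤ T)
    (h : MemLp ue 2 (leb T)) {y : ℕ → L2 T}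
    (hy : ∀ m ∈ E, (fun t => S m t - A m t) =ᵐ[leb T] y m) {τ : ℝ} (hτ : 0 < τ) (p : ℕ → ℝ) :
    lseKernel T ue E S A τ p = ridge (exploreOp T ue) τ (blockSpace T E.card p)
      ((1 / (E.card : ℝ)) • ∑ m ∈ E, y m + lseLambda ue E S A • toL2 T ue) := by
  have h1 : ∀ G : L2 T, (G ∈ piecewiseConst T E.card p ∧
      ∀ G' ∈ piecewiseConst T E.card p, lseLoss T ue E S A τ G ≤ lseLoss T ue E S A τ G') ↔
      G = ridge (exploreOp T ue) τ (blockSpace T E.card p)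
      ((1 / (E.card : ℝ)) • ∑ m ∈ E, y m + lseLambda ue E S A • toL2 T ue) := by
    intro G
    rw [← eq_ridge_of_isMin (exploreOp T ue) hτ]
    simp only [lseLoss_eq hT h hy, mean_norm_sq_eq E hE, mem_piecewiseConst]
    refine and_congr_right fun _ => forall₂_congr fun G' _ => ?_
    rw [add_assoc _ (lseLambda ue E S A • toL2 T ue) (exploreOp T ue G),
      add_assoc _ (lseLambda ue E S A • toL2 T ue) (exploreOp T ue G')]
    constructor <;> intro h <;> linarith
  exact (h1 _).1 (Classical.epsilon_spec (p := fun G : L2 T => G ∈ piecewiseConst T E.card p ∧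
    ∀ G' ∈ piecewiseConst T E.card p, lseLoss T ue E S A τ G ≤ lseLoss T ue E S A τ G')
    ⟨_, (h1 _).2 rfl⟩)

end Estimator

end Liquidation

namespace Liquidation

/-! ### The estimator as a functional of the noise -/

section NoiseEstimator

variable {c : Constants} {θs : Param c.T} {ue : ℝ → ℝ}

/-- The deterministic price impact of the exploration strategy. -/
def exploreDrift (c : Constants) (θ : Param c.T) (ue : ℝ → ℝ) : L2 c.T :=
  θ.1 • toL2 c.T ue +
    integralOp c.T (fun t s => if s < t then θ.2 (t - s) else 0) (toL2 c.T ue)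

theorem exploreDrift_coe (h : MemLp ue 2 (leb c.T)) :
    exploreDrift c θs ue =ᵐ[leb c.T] fun t =>
      θs.1 * ue t + ∫ s in (0 : ℝ)..t, θs.2 (t - s) * ue s := by
  filter_upwards [integralOp_apply c.T _ (memLp_convKernel (Lp.stronglyMeasurable θs.2).measurable
    (Lp.memLp θs.2)) (toL2 c.T ue), Lp.coeFn_smul θs.1 (toL2 c.T ue), coeFn_toL2 h,
    Lp.coeFn_add (θs.1 • toL2 c.T ue)
      (integralOp c.T (fun t s => if s < t then θs.2 (t - s) else 0) (toL2 c.T ue)),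
    ae_leb_mem c.T] with t h1 h2 h3 h4 ht
  rw [exploreDrift, h4, Pi.add_apply, h2, h1, Pi.smul_apply, h3, smul_eq_mul,
    intervalIntegral_eq_integral_leb ht]
  congr 1
  refine integral_congr_ae ?_
  filter_upwards [coeFn_toL2 h] with s hs
  rw [hs]
  split_ifs <;> simp

/-- The initial time as a point of `[0,T]`. -/
def startpoint (c : Constants) : Icc (0 : ℝ) c.T := ⟨0, left_mem_Icc.2 c.T_pos.le⟩

/-- The estimator of `λ`, as a function of the noise in the exploration episodes. -/
def noiseLambda (θ : Param c.T) (ue : ℝ → ℝ) (N : ℕ)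
    (x : ℕ → Icc (0 : ℝ) c.T → ℝ) : ℝ :=
  -(1 / (N * ue 0)) * ∑ j ∈ Finset.range N, (x j (startpoint c) - θ.1 * ue 0)

/-- The least-squares estimator, as a function of the noise in the exploration episodes. -/
def noiseEstimate (θ : Param c.T) (ue : ℝ → ℝ) (τ : ℝ) (p : ℕ → ℝ) (N : ℕ)
    (x : ℕ → Icc (0 : ℝ) c.T → ℝ) : Param c.T :=
  (noiseLambda θ ue N x, ridge (exploreOp c.T ue) τ (blockSpace c.T N p)
    ((1 / (N : ℝ)) • (∑ j ∈ Finset.range N, (toL2 c.T (evalRight c (x j)) - exploreDrift c θ ue)) +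
      noiseLambda θ ue N x • toL2 c.T ue))

theorem measurable_noiseEstimate (θ : Param c.T) (ue : ℝ → ℝ) (τ : ℝ) (p : ℕ → ℝ) (N : ℕ) :
    Measurable (noiseEstimate θ ue τ p N) := by
  have h1 : Measurable (noiseLambda θ ue N) := by
    refine Measurable.const_mul (Finset.measurable_sum _ fun j _ => ?_) _
    exact ((measurable_pi_apply (startpoint c)).comp (measurable_pi_apply j)).sub_const _
  have h2 : Measurable fun x : Icc (0 : ℝ) c.T → ℝ => toL2 c.T (evalRight c x) :=
    measurable_toL2 (measurable_evalRight c)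
  have h3 : Measurable fun x : ℕ → Icc (0 : ℝ) c.T → ℝ =>
      ∑ j ∈ Finset.range N, (toL2 c.T (evalRight c (x j)) - exploreDrift c θ ue) :=
    Finset.measurable_sum _ fun j _ => (h2.comp (measurable_pi_apply j)).sub_const _
  exact h1.prodMk ((continuous_ridge _ _ _).measurable.comp
    (Measurable.add (h3.const_smul (1 / (N : ℝ))) (h1.smul_const _)))

/-- Subtracting the signal from the price leaves the noise minus the deterministic impact of `ue`,
so the data enter only through the noise paths. The enumeration `e` makes the result depend on the
order of the episodes and not on their positions. -/
theorem lse_eq_noiseEstimate (hue : MemLp ue 2 (leb c.T)) {E : Finset ℕ} {N : ℕ} (hN : 1 ≤ N)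
    {e : ℕ → ℕ} (he : Function.Injective e) (hE : E = (Finset.range N).image e)
    {S A M : ℕ → ℝ → ℝ} (hM : ∀ m ∈ E, IsCadlagOn c.T (M m))
    (hM2 : ∀ m ∈ E, MemLp (M m) 2 (leb c.T))
    (hS : ∀ m ∈ E, ∀ t ∈ Icc 0 c.T, S m t = A m t + M m t - θs.1 * ue t -
      ∫ s in (0 : ℝ)..t, θs.2 (t - s) * ue s) {τ : ℝ} (hτ : 0 < τ) (p : ℕ → ℝ) :
    lse c.T ue E S A τ p = noiseEstimate θs ue τ p N fun j t => M (e j) t := by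
  have hcard : E.card = N := by rw [hE, Finset.card_image_of_injective _ he, Finset.card_range]
  have hne : E.Nonempty := Finset.card_pos.1 (by omega)
  have hsum : ∀ {X : Type} [AddCommMonoid X] (f : ℕ → X),
      ∑ m ∈ E, f m = ∑ j ∈ Finset.range N, f (e j) := fun f => by
    rw [hE, Finset.sum_image fun a _ b _ h => he h]
  have h0 := left_mem_Icc.2 c.T_pos.le
  have hlam : lseLambda ue E S A = noiseLambda θs ue N fun j t => M (e j) t := by
    rw [lseLambda, noiseLambda, hcard, ← hsum fun m => M m (startpoint c) - θs.1 * ue 0]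
    congr 1
    refine Finset.sum_congr rfl fun m hm => ?_
    rw [hS m hm 0 h0, intervalIntegral.integral_same]
    change A m 0 + M m 0 - _ - 0 - A m 0 = M m 0 - _
    ring
  have hy : ∀ m ∈ E, (fun t => S m t - A m t) =ᵐ[leb c.T]
      (toL2 c.T (evalRight c fun t => M m t) - exploreDrift c θs ue : L2 c.T) := by
    intro m hm
    have h1 : evalRight c (fun t => M m t) =ᵐ[leb c.T] M m := by
      filter_upwards [ae_leb_mem c.T] with t ht using evalRight_eq (hM m hm) ht
    filter_upwards [Lp.coeFn_sub (toL2 c.T (evalRight c fun t => M m t)) (exploreDrift c θs ue),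
      coeFn_toL2 ((hM2 m hm).ae_eq h1.symm), h1, exploreDrift_coe (θs := θs) hue, ae_leb_mem c.T]
      with t e1 e2 e3 e4 ht
    rw [e1, Pi.sub_apply, e2, e3, e4, hS m hm t ht]
    ring
  rw [lse, lseKernel_eq hne c.T_pos.le hue hy hτ p, hlam, noiseEstimate, hcard]
  congr 4
  rw [hE, Finset.sum_image fun a _ b _ h => he h]

end NoiseEstimator

/-! ### The exploration episodes -/

section Schedule

theorem cycleEnd_zero (m₀ : ℕ) (n : ℕ → ℕ) : cycleEnd m₀ n 0 = m₀ := by simp [cycleEnd]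

theorem cycleEnd_succ (m₀ : ℕ) (n : ℕ → ℕ) (k : ℕ) :
    cycleEnd m₀ n (k + 1) = cycleEnd m₀ n k + n (k + 1) + 1 := by
  rw [cycleEnd, cycleEnd, Finset.sum_Icc_succ_top (Nat.le_add_left 1 k)]
  ring

theorem strictMono_cycleEnd (m₀ : ℕ) (n : ℕ → ℕ) : StrictMono (cycleEnd m₀ n) :=
  strictMono_nat_of_lt_succ fun k => by rw [cycleEnd_succ]; omega

/-- The `j`-th exploration episode, counted from `0`. -/
def exploreIndex (m₀ : ℕ) (n : ℕ → ℕ) (j : ℕ) : ℕ :=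
  if j < m₀ then j + 1 else cycleEnd m₀ n (j - m₀ + 1)

theorem strictMono_exploreIndex (m₀ : ℕ) (n : ℕ → ℕ) : StrictMono (exploreIndex m₀ n) := by
  refine strictMono_nat_of_lt_succ fun j => ?_
  unfold exploreIndex
  split_ifs with h1 h2
  · omega
  · have := (strictMono_cycleEnd m₀ n) (show 0 < j + 1 - m₀ + 1 by omega)
    rw [cycleEnd_zero] at this
    omega
  · omega
  · exact strictMono_cycleEnd m₀ n (by omega)

theorem one_le_exploreIndex (m₀ : ℕ) (n : ℕ → ℕ) (j : ℕ) : 1 ≤ exploreIndex m₀ n j := by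
  have h := (strictMono_exploreIndex m₀ n).monotone (Nat.zero_le j)
  refine le_trans ?_ h
  unfold exploreIndex
  split_ifs
  · omega
  · rw [cycleEnd_succ]; omega

theorem explorationEpisodes_eq (m₀ : ℕ) (n : ℕ → ℕ) (k : ℕ) :
    explorationEpisodes m₀ n k = (Finset.range (m₀ + k)).image (exploreIndex m₀ n) := by
  ext m
  simp only [explorationEpisodes, Finset.mem_union, Finset.mem_image, Finset.mem_range,
    Finset.mem_Icc]
  constructor
  · rintro (h | ⟨i, hi, rfl⟩)
    · exact ⟨m - 1, by omega, by rw [exploreIndex, if_pos (by omega)]; omega⟩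
    · refine ⟨m₀ + i - 1, by omega, ?_⟩
      rw [exploreIndex, if_neg (by omega)]
      congr 1
      omega
  · rintro ⟨j, hj, rfl⟩
    unfold exploreIndex
    split_ifs with h
    · exact Or.inl ⟨by omega, by omega⟩
    · exact Or.inr ⟨j - m₀ + 1, by omega, rfl⟩

theorem exploreIndex_le_cycleEnd {m₀ : ℕ} {n : ℕ → ℕ} {j k : ℕ} (h : j < m₀ + k) :
    exploreIndex m₀ n j ≤ cycleEnd m₀ n k := by
  unfold exploreIndex
  split_ifs with h1
  · have := (strictMono_cycleEnd m₀ n).monotone (Nat.zero_le k)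
    rw [cycleEnd_zero] at this
    omega
  · exact (strictMono_cycleEnd m₀ n).monotone (by omega)

end Schedule

/-! ### Estimates along the exploration episodes -/

section LawTransfer

variable {Ω₀ Ω : Type*} [mΩ₀ : MeasurableSpace Ω₀] [mΩ : MeasurableSpace Ω]
  {P₀ : Measure Ω₀} [IsProbabilityMeasure P₀] {P : Measure Ω} [IsProbabilityMeasure P]
  {c : Constants} {𝓕 : Filtration ℝ≥0 mΩ₀} {A₀ M₀ : ℝ → Ω₀ → ℝ} {A M u : ℕ → ℝ → Ω → ℝ}
  {θs : Param c.T} {ue : ℝ → ℝ}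

theorem obsSigma_mono {j k : ℕ} (h : j ≤ k) :
    obsSigma P θs A M u j ≤ obsSigma P θs A M u k := by
  induction h with
  | refl => exact le_rfl
  | step _ ih => exact ih.trans le_sup_left

/-- The noise paths in a sequence of episodes. -/
def noiseSeq (c : Constants) (M : ℕ → ℝ → Ω → ℝ) (e : ℕ → ℕ) (ω : Ω) :
    ℕ → Icc (0 : ℝ) c.T → ℝ := fun j => pathOf c (M (e j)) ω

theorem episodePrice_eq {m : ℕ} (hu : ∀ t ∈ Icc 0 c.T, ∀ ω, u m t ω = ue t) {t : ℝ}
    (ht : t ∈ Icc 0 c.T) (ω : Ω) :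
    episodePrice θs A M u m t ω = A m t ω + M m t ω - θs.1 * ue t -
      ∫ s in (0 : ℝ)..t, θs.2 (t - s) * ue s := by
  rw [episodePrice, price, hu t ht]
  congr 1
  refine intervalIntegral.integral_congr fun s hs => ?_
  rw [uIcc_of_le ht.1] at hs
  rw [hu s ⟨hs.1, hs.2.trans ht.2⟩]

/-- In an exploration episode the control is known, so the noise can be recovered from the observed
price and signal. -/
theorem measurable_pathOf_noise {m : ℕ} (hm : 1 ≤ m)
    (hu : ∀ t ∈ Icc 0 c.T, ∀ ω, u m t ω = ue t) :
    Measurable[obsSigma P θs A M u m] (pathOf c (M m)) := by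
  obtain ⟨m, rfl⟩ := Nat.exists_eq_add_of_le' hm
  refine @measurable_pi_lambda _ _ _ (obsSigma P θs A M u (m + 1)) _ _ fun t => ?_
  have h1 : MeasurableSpace.comap (episodePrice θs A M u (m + 1) t) inferInstance ⊔
      MeasurableSpace.comap (A (m + 1) t) inferInstance ≤ obsSigma P θs A M u (m + 1) :=
    le_trans (le_biSup (fun t => MeasurableSpace.comap (episodePrice θs A M u (m + 1) t)
      inferInstance ⊔ MeasurableSpace.comap (A (m + 1) t) inferInstance) t.2) le_sup_right
  have h2 : Measurable[obsSigma P θs A M u (m + 1)] (episodePrice θs A M u (m + 1) t) :=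
    (comap_measurable _).mono (le_sup_left.trans h1) le_rfl
  have h3 : Measurable[obsSigma P θs A M u (m + 1)] (A (m + 1) t) :=
    (comap_measurable _).mono (le_sup_right.trans h1) le_rfl
  have h4 : (fun ω => pathOf c (M (m + 1)) ω t) = fun ω =>
      episodePrice θs A M u (m + 1) t ω - A (m + 1) t ω +
        (θs.1 * ue t + ∫ s in (0 : ℝ)..t, θs.2 (t - s) * ue s) := by
    ext ω
    rw [episodePrice_eq hu t.2]
    change M (m + 1) t ω = _
    ring
  rw [h4]
  exact Measurable.add_const (Measurable.sub h2 h3) _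

variable (h₀ : IsPriceModel c.T P₀ 𝓕 A₀ M₀) (hc : AreCopies c.T P₀ A₀ M₀ P A M)

include hc in
theorem AreCopies.measurable_noiseSeq {e : ℕ → ℕ} (he1 : ∀ j, 1 ≤ e j) :
    Measurable (noiseSeq c M e) :=
  measurable_pi_lambda _ fun j => measurable_pi_lambda _ fun t => hc.meas_M _ (he1 j) t t.2

include hc in
-- The law of the noise along any injective enumeration of episodes is the same product measure, so
-- statements about the first episodes transfer to the exploration episodes.
theorem AreCopies.map_noiseSeq {e : ℕ → ℕ} (he : Function.Injective e) (he1 : ∀ j, 1 ≤ e j) :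
    P.map (noiseSeq c M e) = Measure.infinitePi fun _ => P₀.map (pathOf c M₀) := by
  have h1 : Function.Injective fun j => (⟨e j, he1 j⟩ : ℕ+) := fun i j h => he (congrArg PNat.val h)
  have h2 : iIndepFun (fun j => pathOf c (M (e j))) P :=
    (hc.indep.precomp h1).comp (fun _ (x : PairPath c) t => (x t).2) fun _ => measurable_snd_path c
  have h4 : ∀ j, Measurable (pathOf c (M (e j))) := fun j =>
    measurable_pi_lambda _ fun t => hc.meas_M _ (he1 j) t t.2
  have h3 := h2.map_fun_eq_infinitePi_map h4
  rw [show noiseSeq c M e = fun ω j => pathOf c (M (e j)) ω from rfl, h3]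
  congr 1
  ext1 j
  exact ((hc.identDistrib (he1 j)).comp (measurable_snd_path c)).map_eq

include hc in
theorem AreCopies.measure_noiseSeq_eq {e e' : ℕ → ℕ} (he : Function.Injective e)
    (he1 : ∀ j, 1 ≤ e j) (he' : Function.Injective e') (he1' : ∀ j, 1 ≤ e' j)
    {B : Set (ℕ → Icc (0 : ℝ) c.T → ℝ)} (hB : MeasurableSet B) :
    P (noiseSeq c M e ⁻¹' B) = P (noiseSeq c M e' ⁻¹' B) := by
  rw [← Measure.map_apply (hc.measurable_noiseSeq he1) hB,
    ← Measure.map_apply (hc.measurable_noiseSeq he1') hB, hc.map_noiseSeq he he1,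
    hc.map_noiseSeq he' he1']

include h₀ hc in
theorem AreCopies.ae_memLp_M : ∀ᵐ ω ∂P, ∀ m, 1 ≤ m → MemLp (fun t => M m t ω) 2 (leb c.T) := by
  rw [ae_all_iff]
  intro m
  by_cases hm : 1 ≤ m
  · filter_upwards [ae_memLp_of_prod (u := fun t ω => M m t ω - M m c.T ω)
      (hc.memLp_increment_M h₀ hm)] with ω h1 _
    convert h1.add (memLp_const_leb c.T (M m c.T ω)) using 1
    ext t
    simp
  · exact Eventually.of_forall fun ω h => absurd h hm

include h₀ hc in
theorem AreCopies.cycleEstimate_eq (hue : MemLp ue 2 (leb c.T)) {τ : ℕ → ℝ} {p : ℕ → ℕ → ℝ}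
    (hτ : ∀ N, 1 ≤ N → 0 < τ N) {m₀ : ℕ} (hm₀ : 1 ≤ m₀) {n : ℕ → ℕ}
    (hexp : ∀ k, ∀ m ∈ explorationEpisodes m₀ n k, ∀ t ∈ Icc 0 c.T, ∀ ω, u m t ω = ue t) :
    ∀ᵐ ω ∂P, ∀ k, cycleEstimate θs ue A M u τ p m₀ n k ω =
      noiseEstimate θs ue (τ (m₀ + k)) (p (m₀ + k)) (m₀ + k)
        (noiseSeq c M (exploreIndex m₀ n) ω) := by
  filter_upwards [hc.ae_memLp_M h₀] with ω hω k
  have h1 : ∀ m ∈ explorationEpisodes m₀ n k, 1 ≤ m := by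
    intro m hm
    rw [explorationEpisodes_eq, Finset.mem_image] at hm
    obtain ⟨j, _, rfl⟩ := hm
    exact one_le_exploreIndex m₀ n j
  exact lse_eq_noiseEstimate hue (by omega) (strictMono_exploreIndex m₀ n).injective
    (explorationEpisodes_eq m₀ n k) (M := fun m t => M m t ω)
    (fun m hm => hc.cadlag_M m (h1 m hm) ω) (fun m hm => hω m (h1 m hm))
    (fun m hm t ht => episodePrice_eq (hexp k m hm) ht ω) (hτ _ (by omega)) _

theorem measurable_noiseEstimate_obs {τ : ℝ} {p : ℕ → ℝ} {m₀ : ℕ} {n : ℕ → ℕ}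
    (hexp : ∀ k, ∀ m ∈ explorationEpisodes m₀ n k, ∀ t ∈ Icc 0 c.T, ∀ ω, u m t ω = ue t) {k m : ℕ}
    (hm : cycleEnd m₀ n k ≤ m) :
    Measurable[obsSigma P θs A M u m] fun ω => noiseEstimate θs ue τ p (m₀ + k)
      (noiseSeq c M (exploreIndex m₀ n) ω) := by
  classical
  -- only the first `m₀ + k` entries matter
  have h1 : (fun ω => noiseEstimate θs ue τ p (m₀ + k) (noiseSeq c M (exploreIndex m₀ n) ω)) =
      fun ω => noiseEstimate θs ue τ p (m₀ + k) fun j =>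
        if j < m₀ + k then pathOf c (M (exploreIndex m₀ n j)) ω else 0 := by
    ext1 ω
    have h2 : noiseLambda θs ue (m₀ + k) (noiseSeq c M (exploreIndex m₀ n) ω) =
        noiseLambda θs ue (m₀ + k) fun j =>
          if j < m₀ + k then pathOf c (M (exploreIndex m₀ n j)) ω else 0 := by
      unfold noiseLambda
      congr 1
      refine Finset.sum_congr rfl fun j hj => ?_
      simp only [if_pos (Finset.mem_range.1 hj)]
      rfl
    unfold noiseEstimate
    rw [h2]
    congr 4
    refine Finset.sum_congr rfl fun j hj => ?_
    simp only [if_pos (Finset.mem_range.1 hj)]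
    rfl
  rw [h1]
  refine (measurable_noiseEstimate θs ue τ p (m₀ + k)).comp
    (@measurable_pi_lambda _ _ _ (obsSigma P θs A M u m) _ _ fun j => ?_)
  by_cases hj : j < m₀ + k
  · simp only [if_pos hj]
    refine (measurable_pathOf_noise (ue := ue) (one_le_exploreIndex m₀ n j) (hexp k _ ?_)).mono
      (obsSigma_mono ((exploreIndex_le_cycleEnd hj).trans hm)) le_rfl
    rw [explorationEpisodes_eq]
    exact Finset.mem_image_of_mem _ (Finset.mem_range.2 hj)
  · simp only [if_neg hj]
    exact measurable_const

/-- The error bounds of the estimator hold along the exploration episodes. -/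
theorem AreCopies.le_measure_cycleEstimate (h₀ : IsPriceModel c.T P₀ 𝓕 A₀ M₀)
    (hc : AreCopies c.T P₀ A₀ M₀ P A M) (hue : MemLp ue 2 (leb c.T)) {τ : ℕ → ℝ} {p : ℕ → ℕ → ℝ}
    (hτ : ∀ N, 1 ≤ N → 0 < τ N) {m₀ : ℕ} (hm₀ : 1 ≤ m₀) {n : ℕ → ℕ}
    (hexp : ∀ k, ∀ m ∈ explorationEpisodes m₀ n k, ∀ t ∈ Icc 0 c.T, ∀ ω, u m t ω = ue t)
    {a b : ℕ → ℝ} {r : ℝ≥0∞} (hr : r ≤ P {ω | ∀ N : ℕ, 2 ≤ N →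
      let θN := lse c.T ue (Finset.Icc 1 N)
        (fun m t => price θs (A m) (M m) (fun s _ => ue s) t ω) (fun m t => A m t ω) (τ N) (p N)
      |θN.1 - θs.1| ≤ a N ∧ ‖θN.2 - θs.2‖ ≤ b N}) :
    r ≤ P {ω | ∀ k, 2 ≤ m₀ + k →
      |(cycleEstimate θs ue A M u τ p m₀ n k ω).1 - θs.1| ≤ a (m₀ + k) ∧
        ‖(cycleEstimate θs ue A M u τ p m₀ n k ω).2 - θs.2‖ ≤ b (m₀ + k)} := by
  -- The error bounds for all `N` at once, as one measurable event in the space of noise sequences.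
  -- Because it is simultaneous in `N`, no union bound over the cycles is needed.
  set B : Set (ℕ → Icc (0 : ℝ) c.T → ℝ) := {x | ∀ N : ℕ, 2 ≤ N →
    |(noiseEstimate θs ue (τ N) (p N) N x).1 - θs.1| ≤ a N ∧
      ‖(noiseEstimate θs ue (τ N) (p N) N x).2 - θs.2‖ ≤ b N} with hB
  have hBm : MeasurableSet B := by
    have : B = ⋂ N : ℕ, ⋂ _ : 2 ≤ N, {x | |(noiseEstimate θs ue (τ N) (p N) N x).1 - θs.1| ≤ a N} ∩
        {x | ‖(noiseEstimate θs ue (τ N) (p N) N x).2 - θs.2‖ ≤ b N} := by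
      ext x; simp [hB]
    rw [this]
    refine MeasurableSet.iInter fun N => MeasurableSet.iInter fun _ => ?_
    have h1 := measurable_noiseEstimate θs ue (τ N) (p N) N
    refine MeasurableSet.inter (measurableSet_le ?_ measurable_const)
      (measurableSet_le ?_ measurable_const)
    · exact ((measurable_fst.comp h1).sub_const _).norm
    · exact ((measurable_snd.comp h1).sub_const _).norm
  have hs : Function.Injective fun j : ℕ => j + 1 := fun i j h => Nat.succ_injective h
  refine hr.trans ?_
  calc _ ≤ P (noiseSeq c M (fun j => j + 1) ⁻¹' B) := by
        refine measure_mono_ae ?_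
        filter_upwards [hc.ae_memLp_M h₀] with ω hω h N hN
        have h1 := h N hN
        have h2 := lse_eq_noiseEstimate (θs := θs) hue (show 1 ≤ N by omega) hs
          (E := Finset.Icc 1 N) (by
            ext m
            simp only [Finset.mem_Icc, Finset.mem_image, Finset.mem_range]
            exact ⟨fun h => ⟨m - 1, by omega, by omega⟩, by rintro ⟨j, hj, rfl⟩; omega⟩)
          (S := fun m t => price θs (A m) (M m) (fun s _ => ue s) t ω) (A := fun m t => A m t ω)
          (M := fun m t => M m t ω)
          (fun m hm => hc.cadlag_M m (Finset.mem_Icc.1 hm).1 ω)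
          (fun m hm => hω m (Finset.mem_Icc.1 hm).1) (fun m _ t _ => rfl)
          (hτ N (by omega)) (p N)
        simp only at h1
        rw [h2] at h1
        exact h1
    _ = P (noiseSeq c M (exploreIndex m₀ n) ⁻¹' B) :=
        hc.measure_noiseSeq_eq hs (fun j => Nat.le_add_left 1 j)
          (strictMono_exploreIndex m₀ n).injective (one_le_exploreIndex m₀ n) hBm
    _ ≤ _ := by
        refine measure_mono_ae ?_
        filter_upwards [hc.cycleEstimate_eq (θs := θs) (p := p) h₀ hue hτ hm₀ hexp] with ω hω h k hk
        rw [hω k]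
        exact h (m₀ + k) hk

end LawTransfer

end Liquidation

namespace Liquidation

/-! ### Summation over the cycles -/

section Summation

/-- Each cycle costs at most `B` for exploitation and `D` for its closing exploration episode. The
induction treats every `j` up to the end of a cycle because episode `N` may fall inside one. The
restriction `m ≤ N` permits `g` to depend on `N`. -/
theorem sum_le_of_cycles {m₀ N : ℕ} {n : ℕ → ℕ} {r : ℕ → ℝ} {D B : ℝ} {g : ℕ → ℝ} (hD : 0 ≤ D)
    (hg : ∀ k, 0 ≤ g k) (hng : ∀ k, n (k + 1) * g k ≤ B)
    (hexp : ∀ k, ∀ m ∈ explorationEpisodes m₀ n k, r m ≤ D)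
    (hexploit : ∀ k m, cycleEnd m₀ n k < m → m ≤ cycleEnd m₀ n k + n (k + 1) → m ≤ N →
      r m ≤ g k) (K : ℕ) :
    ∀ j ≤ N, j ≤ cycleEnd m₀ n K → ∑ m ∈ Finset.Icc 1 j, r m ≤ D * m₀ + K * (B + D) := by
  have hB : 0 ≤ B := le_trans (by have := hg 0; positivity) (hng 0)
  induction K with
  | zero =>
    intro j _ hj
    rw [cycleEnd_zero] at hj
    have h1 := Finset.sum_le_card_nsmul (Finset.Icc 1 j) r D fun m hm => hexp 0 m <|
      Finset.mem_union_left _ (Finset.mem_Icc.2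
        ⟨(Finset.mem_Icc.1 hm).1, (Finset.mem_Icc.1 hm).2.trans hj⟩)
    rw [Nat.card_Icc, Nat.add_sub_cancel, nsmul_eq_mul] at h1
    have h2 : (j : ℝ) * D ≤ m₀ * D := by gcongr
    push_cast
    linarith
  | succ K ih =>
    -- the exploitation episodes of the cycle
    have h1 : ∀ j ≤ N, j ≤ cycleEnd m₀ n K + n (K + 1) →
        ∑ m ∈ Finset.Icc 1 j, r m ≤ D * m₀ + K * (B + D) + B := by
      intro j hjN hj
      rcases le_or_gt j (cycleEnd m₀ n K) with h | h
      · linarith [ih j hjN h]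
      · have h2 := ih (cycleEnd m₀ n K) (h.le.trans hjN) le_rfl
        have h3 := Finset.sum_le_card_nsmul (Finset.Ioc (cycleEnd m₀ n K) j) r (g K) fun m hm =>
          hexploit K m (Finset.mem_Ioc.1 hm).1 ((Finset.mem_Ioc.1 hm).2.trans hj)
            ((Finset.mem_Ioc.1 hm).2.trans hjN)
        rw [Nat.card_Ioc, nsmul_eq_mul] at h3
        have h4 : ((j - cycleEnd m₀ n K : ℕ) : ℝ) * g K ≤ n (K + 1) * g K := by
          have : j - cycleEnd m₀ n K ≤ n (K + 1) := by omega
          have := hg K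
          gcongr
        have h5 : ∑ m ∈ Finset.Icc 1 j, r m = ∑ m ∈ Finset.Icc 1 (cycleEnd m₀ n K), r m +
            ∑ m ∈ Finset.Ioc (cycleEnd m₀ n K) j, r m := by
          rw [← Finset.sum_union]
          · congr 1
            ext m
            simp only [Finset.mem_Icc, Finset.mem_union, Finset.mem_Ioc]
            omega
          · rw [Finset.disjoint_left]
            intro m hm hm'
            simp only [Finset.mem_Icc, Finset.mem_Ioc] at hm hm'
            omega
        linarith [hng K]
    intro j hjN hj
    rw [cycleEnd_succ] at hj
    push_cast
    rcases le_or_gt j (cycleEnd m₀ n K + n (K + 1)) with h | h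
    · linarith [h1 j hjN h]
    · obtain rfl : j = cycleEnd m₀ n K + n (K + 1) + 1 := by omega
      rw [Finset.sum_Icc_succ_top (by omega)]
      have h2 : r (cycleEnd m₀ n K + n (K + 1) + 1) ≤ D := by
        refine hexp (K + 1) _ (Finset.mem_union_right _ (Finset.mem_image.2 ⟨K + 1, ?_, ?_⟩))
        · simp
        · rw [cycleEnd_succ]
      linarith [h1 _ (by omega) le_rfl]

/-- The exploration episode closing cycle `i` compensates for the floor, so the cycle has length at
least `i^κ`. For `i ≤ K` this is at least `i K^{κ-1}` as `κ < 1`, and summing `i` gives `K(K+1)/2`.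
-/
theorem rpow_le_cycleEnd {κ : ℝ} (hκ : κ ∈ Ioo (0 : ℝ) 1) (m₀ K : ℕ) :
    (K : ℝ) ^ (1 + κ) / 2 ≤ cycleEnd m₀ (fun k => ⌊(k : ℝ) ^ κ⌋₊) K := by
  rcases Nat.eq_zero_or_pos K with rfl | hK
  · rw [Nat.cast_zero, Real.zero_rpow (by linarith [hκ.1])]
    simp
  have hK' : (0 : ℝ) < K := by exact_mod_cast hK
  have h1 : ∀ i ∈ Finset.Icc 1 K, (i : ℝ) * (K : ℝ) ^ (κ - 1) ≤ ⌊(i : ℝ) ^ κ⌋₊ + 1 := by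
    intro i hi
    rw [Finset.mem_Icc] at hi
    have hi' : (0 : ℝ) < i := by exact_mod_cast hi.1
    have h2 : (K : ℝ) ^ (κ - 1) ≤ (i : ℝ) ^ (κ - 1) :=
      Real.rpow_le_rpow_of_nonpos hi' (by exact_mod_cast hi.2) (by linarith [hκ.2])
    calc (i : ℝ) * (K : ℝ) ^ (κ - 1) ≤ i * (i : ℝ) ^ (κ - 1) := by gcongr
      _ = (i : ℝ) ^ κ := by rw [mul_comm, Real.rpow_sub_one hi'.ne']; field_simp
      _ ≤ _ := (Nat.lt_floor_add_one _).le
  have h2 := Finset.sum_le_sum h1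
  rw [← Finset.sum_mul, Finset.sum_add_distrib] at h2
  have h3 : (∑ i ∈ Finset.Icc 1 K, (i : ℝ)) = K * (K + 1) / 2 := by
    clear h1 h2 hK hK'
    induction K with
    | zero => simp
    | succ K ih => rw [Finset.sum_Icc_succ_top (by omega), ih]; push_cast; ring
  have h4 : (K : ℝ) ^ (1 + κ) = K * K * (K : ℝ) ^ (κ - 1) := by
    rw [Real.rpow_sub_one hK'.ne', Real.rpow_add hK', Real.rpow_one]
    field_simp
  have h5 : (K : ℝ) ^ (1 + κ) / 2 ≤ K * (K + 1) / 2 * (K : ℝ) ^ (κ - 1) := by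
    rw [h4]
    have : 0 ≤ (K : ℝ) * (K : ℝ) ^ (κ - 1) := by positivity
    nlinarith
  rw [h3] at h2
  refine (h5.trans h2).trans ?_
  rw [cycleEnd]
  push_cast
  simp

/-- A cycle that ends after episode `N` and whose number is of order `N^{1/(1+κ)}`. -/
theorem exists_le_cycleEnd {κ : ℝ} (hκ : κ ∈ Ioo (0 : ℝ) 1) (m₀ : ℕ) {N : ℕ} (hN : 1 ≤ N) :
    ∃ K : ℕ, N ≤ cycleEnd m₀ (fun k => ⌊(k : ℝ) ^ κ⌋₊) K ∧
      (K : ℝ) ≤ 3 * (N : ℝ) ^ (1 / (1 + κ)) := by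
  have hN' : (1 : ℝ) ≤ N := by exact_mod_cast hN
  have hκ0 := hκ.1
  -- This inverts the bound `K^{1+κ}/2`. The constant `3` is `2^{1/(1+κ)} ≤ 2` plus one for the
  -- ceiling.
  refine ⟨⌈(2 * N : ℝ) ^ (1 / (1 + κ))⌉₊, ?_, ?_⟩
  · have h1 := rpow_le_cycleEnd hκ m₀ ⌈(2 * N : ℝ) ^ (1 / (1 + κ))⌉₊
    have h2 : (2 * N : ℝ) ≤ (⌈(2 * N : ℝ) ^ (1 / (1 + κ))⌉₊ : ℝ) ^ (1 + κ) := by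
      calc (2 * N : ℝ) = ((2 * N : ℝ) ^ (1 / (1 + κ))) ^ (1 + κ) := by
            rw [← Real.rpow_mul (by positivity), one_div_mul_cancel (by positivity), Real.rpow_one]
        _ ≤ _ := by gcongr; exact Nat.le_ceil _
    have h3 : (N : ℝ) ≤ cycleEnd m₀ (fun k => ⌊(k : ℝ) ^ κ⌋₊) ⌈(2 * N : ℝ) ^ (1 / (1 + κ))⌉₊ := by
      linarith
    exact_mod_cast h3
  · have h1 : (1 : ℝ) ≤ (N : ℝ) ^ (1 / (1 + κ)) := Real.one_le_rpow hN' (by positivity)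
    have h2 : (2 : ℝ) ^ (1 / (1 + κ)) ≤ 2 := by
      conv_rhs => rw [← Real.rpow_one 2]
      exact Real.rpow_le_rpow_of_exponent_le (by norm_num) (by
        rw [div_le_one (by positivity)]; linarith)
    have h3 := (Nat.ceil_lt_add_one (show 0 ≤ (2 * N : ℝ) ^ (1 / (1 + κ)) by positivity)).le
    rw [Real.mul_rpow (by norm_num) (by positivity)] at h3
    rw [Real.mul_rpow (by norm_num) (by positivity)]
    nlinarith

/-- The rate of the estimator is uniformly small once `N` is of order `log(η⁻¹)² + 1`. -/
theorem exists_rate_le {δ : ℝ} (hδ : 0 < δ) :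
    ∃ C₀ : ℝ, 2 ≤ C₀ ∧ ∀ (l : ℝ) (N : ℕ), 0 ≤ l → C₀ * (l ^ 2 + 1) ≤ N →
      (l + Real.log N) / √(N : ℝ) ≤ δ := by
  have h1 : Tendsto (fun x : ℝ => Real.log x / x ^ (1 / 2 : ℝ)) atTop (𝓝 0) :=
    (isLittleO_log_rpow_atTop (by norm_num)).tendsto_div_nhds_zero
  obtain ⟨x₀, hx₀⟩ := eventually_atTop.1 (h1.eventually_le_const (half_pos hδ))
  -- The threshold `x₀` makes `log N / √N ≤ δ/2`, and `4/δ²` makes `l / √N ≤ δ/2`. The lower bound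
  -- `2` later gives `m₀ ≥ 2`, where the error bounds of the estimator begin.
  refine ⟨max (max 2 x₀) (4 / δ ^ 2), (le_max_left _ _).trans (le_max_left _ _), fun l N hl hN => ?_⟩
  set C₀ := max (max 2 x₀) (4 / δ ^ 2)
  have hC : 2 ≤ C₀ := (le_max_left _ _).trans (le_max_left _ _)
  have hN2 : C₀ ≤ N := le_trans (by nlinarith [sq_nonneg l]) hN
  have h2 := hx₀ N (((le_max_right _ _).trans (le_max_left _ _)).trans hN2)
  rw [← Real.sqrt_eq_rpow] at h2
  have h3 : 0 < √(N : ℝ) := Real.sqrt_pos.2 (by linarith)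
  have h4 : l / √(N : ℝ) ≤ δ / 2 := by
    rw [div_le_iff₀ h3]
    refine le_of_sq_le_sq ?_ (by positivity)
    rw [mul_pow, Real.sq_sqrt (by linarith)]
    have h5 : 4 / δ ^ 2 * l ^ 2 ≤ N := le_trans (by
      have := le_max_right (max 2 x₀) (4 / δ ^ 2)
      nlinarith [sq_nonneg l]) hN
    have h6 : l ^ 2 = (δ / 2) ^ 2 * (4 / δ ^ 2 * l ^ 2) := by field_simp; ring
    rw [h6]
    gcongr
  rw [add_div]
  linarith

/-- The true parameter has room `δ` in the bounds on `λ` and `‖G‖`; in the positivity condition the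
tolerance `ε` provides the room. -/
theorem mem_admissibleParams_of_close {c : Constants} {θs θ : Param c.T} {L ε δ : ℝ}
    (hpd : ∀ f : L2 c.T, 0 ≤ quadForm c.T θs.2 f) (h1 : L⁻¹ + δ ≤ θs.1) (h2 : θs.1 + δ ≤ L)
    (h3 : ‖θs.2‖ + δ ≤ L) (h4 : 2 * √c.T * δ ≤ ε) (h5 : ‖θ - θs‖ ≤ δ) :
    θ ∈ admissibleParams c.T L ε := by
  have h6 : |θ.1 - θs.1| ≤ δ := (norm_fst_le (θ - θs)).trans h5
  have h7 : ‖θ.2 - θs.2‖ ≤ δ := (norm_snd_le (θ - θs)).trans h5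
  rw [abs_le] at h6
  refine ⟨by linarith, by linarith, ?_, fun f => ?_⟩
  · have := norm_le_norm_add_norm_sub' θ.2 θs.2
    linarith
  · have h8 := abs_le.1 (abs_quadForm_sub_le c θ.2 θs.2 f)
    have h9 : 2 * √c.T * ‖θ.2 - θs.2‖ * ‖f‖ ^ 2 ≤ ε * ‖f‖ ^ 2 := by
      refine mul_le_mul_of_nonneg_right (le_trans ?_ h4) (sq_nonneg _)
      gcongr
    linarith [hpd f, h8.1]

/-- For `x ≤ 1` and `κ < 1` the slower rate `x^κ` of the kernel dominates. -/
theorem norm_sub_le_of_rate {T : ℝ} {θ θs : Param T} {Ctil x κ : ℝ} (hC : 0 ≤ Ctil)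
    (hκ : κ ∈ Ioo (0 : ℝ) 1) (hx0 : 0 ≤ x) (hx1 : x ≤ 1) (h1 : |θ.1 - θs.1| ≤ Ctil * x)
    (h2 : ‖θ.2 - θs.2‖ ≤ Ctil * x ^ κ) : ‖θ - θs‖ ≤ Ctil * x ^ κ := by
  refine max_le (h1.trans ?_) h2
  gcongr
  rcases hx0.eq_or_lt with rfl | hx
  · rw [Real.zero_rpow hκ.1.ne']
  · conv_lhs => rw [← Real.rpow_one x]
    exact Real.rpow_le_rpow_of_exponent_ge hx hx1 hκ.2.le

/-- The bound on the regret, from bounds on the regret of each episode. -/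
theorem sum_regret_le {κ : ℝ} (hκ : κ ∈ Ioo (0 : ℝ) 1) {D H C l : ℝ} (hD : 0 ≤ D) (hH : 0 ≤ H)
    (hC : 0 ≤ C) (hl : 0 ≤ l) {m₀ N : ℕ} (hm₀ : 1 ≤ m₀) (hm₀C : (m₀ : ℝ) ≤ C * (l ^ 2 + 1) + 1)
    (hN : 2 ≤ N) {r : ℕ → ℝ}
    (hexp : ∀ k, ∀ m ∈ explorationEpisodes m₀ (fun k => ⌊(k : ℝ) ^ κ⌋₊) k, r m ≤ D)
    (hexploit : ∀ k m, cycleEnd m₀ (fun k => ⌊(k : ℝ) ^ κ⌋₊) k < m →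
      m ≤ cycleEnd m₀ (fun k => ⌊(k : ℝ) ^ κ⌋₊) k + ⌊((k + 1 : ℕ) : ℝ) ^ κ⌋₊ →
      r m ≤ H * (((l + Real.log (m₀ + k : ℕ)) / √((m₀ + k : ℕ) : ℝ)) ^ κ) ^ 2) :
    ∑ m ∈ Finset.Icc 1 N, r m ≤
      (D * C + D * (C + 1) / (Real.log 2) ^ (2 * κ) + 3 * H + 3 * D / (Real.log 2) ^ (2 * κ) + 1) *
        ((N : ℝ) ^ (1 / (1 + κ)) * (l + Real.log N) ^ (2 * κ) + l ^ 2) := by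
  obtain ⟨K, hNK, hK⟩ := exists_le_cycleEnd hκ m₀ (show 1 ≤ N by omega)
  have hN2 : (2 : ℝ) ≤ N := by exact_mod_cast hN
  have hκ0 := hκ.1
  set b := (l + Real.log N) ^ (2 * κ) with hb
  set b₀ := (Real.log 2) ^ (2 * κ) with hb₀
  set X := (N : ℝ) ^ (1 / (1 + κ)) with hX
  have hlog2 : 0 < Real.log 2 := Real.log_pos (by norm_num)
  have hlogN : Real.log 2 ≤ Real.log N := Real.log_le_log (by norm_num) hN2
  have hb₀pos : 0 < b₀ := Real.rpow_pos_of_pos hlog2 _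
  have hbb : b₀ ≤ b := Real.rpow_le_rpow hlog2.le (by linarith) (by positivity)
  have hX1 : 1 ≤ X := Real.one_le_rpow (by linarith) (by positivity)
  -- The choice `n(k+1) ≤ (k+1)^κ` cancels the decay of `g`, so all cycles have the same
  -- exploitation budget `H b`.
  have hkey := sum_le_of_cycles (N := N) (B := H * b) (g := fun k => H * b / ((k + 1 : ℕ) : ℝ) ^ κ)
    (n := fun k => ⌊(k : ℝ) ^ κ⌋₊) (r := r) hD (fun k => by positivity) (fun k => ?_) hexp
    (fun k m h1 h2 h3 => (hexploit k m h1 h2).trans ?_) K N le_rfl hNK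
  -- As `N ≥ 2`, the factors `b / b₀` and `X` are at least one, so constant costs are absorbed into
  -- the leading term. Only the part `D C l²` of the initial exploration remains separate.
  · have h1 : D ≤ D * (b / b₀) := le_mul_of_one_le_right hD ((one_le_div hb₀pos).2 hbb)
    have h2 : (K : ℝ) * (H * b + D) ≤ 3 * X * (H * b + D * (b / b₀)) := by gcongr
    have h3 : D * m₀ ≤ D * C * l ^ 2 + D * (C + 1) := by nlinarith
    have h4 : D * (C + 1) ≤ X * (D * (b / b₀)) * (C + 1) := by
      refine mul_le_mul_of_nonneg_right (h1.trans ?_) (by linarith)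
      exact le_mul_of_one_le_left (by positivity) hX1
    have h5 : (D * C + D * (C + 1) / b₀ + 3 * H + 3 * D / b₀ + 1) * (X * b + l ^ 2) =
        (D * C * l ^ 2 + X * (D * (b / b₀)) * (C + 1) + 3 * X * (H * b + D * (b / b₀))) +
        ((D * C + 1) * (X * b) + (D * (C + 1) / b₀ + 3 * H + 3 * D / b₀ + 1) * l ^ 2) := by
      field_simp
      ring
    have h6 : 0 ≤ (D * C + 1) * (X * b) +
        (D * (C + 1) / b₀ + 3 * H + 3 * D / b₀ + 1) * l ^ 2 := by positivity
    linarith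
  · have h1 : (⌊((k + 1 : ℕ) : ℝ) ^ κ⌋₊ : ℝ) ≤ ((k + 1 : ℕ) : ℝ) ^ κ := Nat.floor_le (by positivity)
    have h2 : (0 : ℝ) < ((k + 1 : ℕ) : ℝ) ^ κ := by positivity
    rw [mul_div_assoc', div_le_iff₀ h2]
    nlinarith [show 0 ≤ H * b by positivity]
  -- At least `m₀ + k` episodes precede the exploitation episode `m ≤ N`, so its logarithm is at
  -- most `log N`. As `m₀ ≥ 1`, the denominator is at least `(k+1)^κ`.
  · have h4 : m₀ + k ≤ N := by
      have : m₀ + k ≤ cycleEnd m₀ (fun k => ⌊(k : ℝ) ^ κ⌋₊) k := by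
        rw [cycleEnd, add_right_comm]
        exact Nat.le_add_right _ _
      exact (this.trans h1.le).trans h3
    have h5 : (1 : ℝ) ≤ (m₀ + k : ℕ) := by exact_mod_cast (show 1 ≤ m₀ + k by omega)
    have h6 : 0 ≤ l + Real.log (m₀ + k : ℕ) := add_nonneg hl (Real.log_nonneg h5)
    rw [← Real.rpow_natCast, ← Real.rpow_mul (by positivity), Real.div_rpow h6 (by positivity),
      mul_div_assoc, Real.sqrt_eq_rpow, ← Real.rpow_mul (by positivity)]
    have e1 : κ * (2 : ℕ) = 2 * κ := by push_cast; ring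
    have e2 : 1 / 2 * (2 * κ) = κ := by ring
    have h7 : ((k + 1 : ℕ) : ℝ) ≤ (m₀ + k : ℕ) := by exact_mod_cast (show k + 1 ≤ m₀ + k by omega)
    have h8 : ((m₀ + k : ℕ) : ℝ) ≤ N := by exact_mod_cast h4
    have h9 : (0 : ℝ) < (k + 1 : ℕ) := by positivity
    rw [e1, e2, hb]
    generalize ((m₀ + k : ℕ) : ℝ) = y at *
    generalize ((k + 1 : ℕ) : ℝ) = z at *
    gcongr

end Summation

end Liquidation

end

/-! ### The regret bound -/

theorem mainTheorem3 {Ω₀ Ω : Type*} [mΩ₀ : MeasurableSpace Ω₀] [MeasurableSpace Ω]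
    (P₀ : Measure Ω₀) [IsProbabilityMeasure P₀] (P : Measure Ω) [IsProbabilityMeasure P]
    (c : Constants)
    -- the unaffected price and the true price impact parameter
    (𝓕 : Filtration ℝ≥0 mΩ₀) (A₀ M₀ : ℝ → Ω₀ → ℝ) (hmodel : IsPriceModel c.T P₀ 𝓕 A₀ M₀)
    (θs : Param c.T) (hpd : ∀ f : L2 c.T, 0 ≤ quadForm c.T θs.2 f)
    (L : ℝ) (hL : 0 < L) (hlam : L⁻¹ < θs.1 ∧ θs.1 < L) (hG : ‖θs.2‖ < L)
    (ε : ℝ) (hε : ε ∈ Ioo 0 (L⁻¹ / 2))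
    -- the optimal strategy for the true parameter
    (us : ℝ → Ω₀ → ℝ) (hus : IsControl c.T P₀ (withSignal (nullSigma P₀) A₀) us)
    (hgreedy : IsGreedyOn c P₀ (withSignal (nullSigma P₀) A₀) A₀ (fun _ => θs) univ us)
    -- the copies of signal and noise in the learning episodes
    (A M : ℕ → ℝ → Ω → ℝ) (hcopies : AreCopies c.T P₀ A₀ M₀ P A M)
    -- the exploration strategy and the parameters of the least-squares estimator
    (ue : ℝ → ℝ) (hue : IsExploration c.T ue)
    (τ : ℝ → ℕ → ℝ) (hτ : ∀ η ∈ Ioo (0 : ℝ) 1, ∀ N, 1 ≤ N → 0 < τ η N)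
    (p : ℝ → ℕ → ℕ → ℝ) (hp : ∀ η ∈ Ioo (0 : ℝ) 1, ∀ N, 1 ≤ N → IsPartition c.T N (p η N))
    -- the high-probability error bound for the least-squares estimator
    (κ : ℝ) (hκ : κ ∈ Ioo (0 : ℝ) 1) (Ctil : ℝ) (hCtil : 0 < Ctil)
    (hlse : ∀ η ∈ Ioo (0 : ℝ) 1, ENNReal.ofReal (1 - η) ≤ P {ω | ∀ N : ℕ, 2 ≤ N →
      let θN := lse c.T ue (Finset.Icc 1 N)
        (fun m t => price θs (A m) (M m) (fun s _ => ue s) t ω) (fun m t => A m t ω) (τ η N) (p η N)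
      |θN.1 - θs.1| ≤ Ctil * ((Real.log η⁻¹ + Real.log N) / √(N : ℝ)) ∧
        ‖θN.2 - θs.2‖ ≤ Ctil * ((Real.log η⁻¹ + Real.log N) / √(N : ℝ)) ^ κ}) :
    ∃ C₀ : ℝ, 0 < C₀ ∧ ∀ C : ℝ, C₀ ≤ C → ∃ C' : ℝ, 0 < C' ∧ ∀ η ∈ Ioo (0 : ℝ) 1,
      ∀ u : ℕ → ℝ → Ω → ℝ,
        IsPhasedRun c P θs L ε ue A M (τ η) (p η)
          ⌈C * (Real.log η⁻¹ ^ 2 + 1)⌉₊ (fun k => ⌊(k : ℝ) ^ κ⌋₊) u →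
        ENNReal.ofReal (1 - η) ≤ P {ω | ∀ N : ℕ, 2 ≤ N →
          regret c P θs A M u (∫ ω₀, payoff c θs A₀ M₀ us ω₀ ∂P₀) N ω ≤
            C' * ((N : ℝ) ^ (1 / (1 + κ)) * (Real.log η⁻¹ + Real.log N) ^ (2 * κ)
              + Real.log η⁻¹ ^ 2)} := by
  have hue2 : MemLp ue 2 (leb c.T) := hue.memLp c.T_pos.le
  have hLε : 0 < 2 * L⁻¹ - ε := by linarith [hε.2, inv_pos.2 hL]
  -- The radius of a ball around the true parameter that stays inside `Ξ_ε`.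
  obtain ⟨δ, hδ, hδ1, hδ2, hδ3, hδ4⟩ : ∃ δ > 0, L⁻¹ + δ ≤ θs.1 ∧ θs.1 + δ ≤ L ∧
      ‖θs.2‖ + δ ≤ L ∧ 2 * √c.T * δ ≤ ε := by
    have hT : 0 < 2 * √c.T := mul_pos two_pos (Real.sqrt_pos.2 c.T_pos)
    refine ⟨min (min (θs.1 - L⁻¹) (L - θs.1)) (min (L - ‖θs.2‖) (ε / (2 * √c.T))), ?_, ?_, ?_, ?_, ?_⟩
    · exact lt_min (lt_min (by linarith [hlam.1]) (by linarith [hlam.2]))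
        (lt_min (by linarith) (div_pos hε.1 hT))
    · linarith [(min_le_left (min (θs.1 - L⁻¹) (L - θs.1))
        (min (L - ‖θs.2‖) (ε / (2 * √c.T)))).trans (min_le_left _ _)]
    · linarith [(min_le_left (min (θs.1 - L⁻¹) (L - θs.1))
        (min (L - ‖θs.2‖) (ε / (2 * √c.T)))).trans (min_le_right _ _)]
    · linarith [(min_le_right (min (θs.1 - L⁻¹) (L - θs.1))
        (min (L - ‖θs.2‖) (ε / (2 * √c.T)))).trans (min_le_left _ _)]
    · rw [← le_div_iff₀' hT]
      exact (min_le_right _ _).trans (min_le_right _ _)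
  have hθs : θs ∈ admissibleParams c.T L ε :=
    mem_admissibleParams_of_close hpd hδ1 hδ2 hδ3 hδ4 (by simpa using hδ.le)
  -- The second threshold is where `Ctil x^κ = δ`, which keeps the estimates in the ball. The bound
  -- `x ≤ 1` is used in `norm_sub_le_of_rate`.
  have hx : 0 < min 1 ((δ / Ctil) ^ (1 / κ)) :=
    lt_min one_pos (Real.rpow_pos_of_pos (div_pos hδ hCtil) _)
  obtain ⟨C₀, hC₀, hrate⟩ := exists_rate_le hx
  refine ⟨C₀, by linarith, fun C hC => ?_⟩
  set Jopt := ∫ ω₀, payoff c θs A₀ M₀ us ω₀ ∂P₀ with hJopt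
  set Jexp := ∫ ω, payoffPath c θs (pairPath c A₀ M₀ ω) (toL2 c.T ue) ∂P₀ with hJexp
  set V := gapConst c L ε (∫ ω, ‖increment c (pathOf c A₀ ω) + driftVec c‖ ^ 2 ∂P₀) with hV
  set D := |Jopt - Jexp| with hD
  set H := |V| * Ctil ^ 2 with hH
  have hlog2 : 0 < Real.log 2 := Real.log_pos one_lt_two
  refine ⟨D * C + D * (C + 1) / (Real.log 2) ^ (2 * κ) + 3 * H +
    3 * D / (Real.log 2) ^ (2 * κ) + 1, by have : 0 < C := by linarith
                                           positivity, fun η hη u hrun => ?_⟩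
  set l := Real.log η⁻¹ with hl
  have hl0 : 0 ≤ l := Real.log_nonneg ((one_le_inv₀ hη.1).2 hη.2.le)
  set m₀ := ⌈C * (l ^ 2 + 1)⌉₊ with hm₀
  set n : ℕ → ℕ := fun k => ⌊(k : ℝ) ^ κ⌋₊ with hn
  have hm₀C : C * (l ^ 2 + 1) ≤ m₀ := Nat.le_ceil _
  have hm₀2 : 2 ≤ m₀ := by
    have : (2 : ℝ) ≤ m₀ := le_trans (by nlinarith [sq_nonneg l]) hm₀C
    exact_mod_cast this
  have hest := hcopies.cycleEstimate_eq (θs := θs) (p := p η) hmodel hue2 (hτ η hη)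
    (show 1 ≤ m₀ by omega) hrun.explore
  have hexploit : ∀ᵐ ω ∂P, ∀ k m, cycleEnd m₀ n k < m → m ≤ cycleEnd m₀ n k + n (k + 1) →
      cycleEstimate θs ue A M u (τ η) (p η) m₀ n k ω ∈ admissibleParams c.T L ε →
      Jopt - (P[payoff c θs (A m) (M m) (u m) | obsSigma P θs A M u (m - 1)]) ω ≤
        V * ‖cycleEstimate θs ue A M u (τ η) (p η) m₀ n k ω - θs‖ ^ 2 := by
    refine ae_all_iff.2 fun k => ae_all_iff.2 fun m => ?_
    by_cases h1 : cycleEnd m₀ n k < m ∧ m ≤ cycleEnd m₀ n k + n (k + 1)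
    -- The estimate is replaced by its almost surely equal version `noiseEstimate`, which is
    -- measurable for the information before the episode.
    · have hg : IsGreedyOn c P (episodeSigma P θs A M u m) (A m)
          (fun ω => noiseEstimate θs ue (τ η (m₀ + k)) (p η (m₀ + k)) (m₀ + k)
            (noiseSeq c M (exploreIndex m₀ n) ω))
          {ω | noiseEstimate θs ue (τ η (m₀ + k)) (p η (m₀ + k)) (m₀ + k)
            (noiseSeq c M (exploreIndex m₀ n) ω) ∈ admissibleParams c.T L ε} (u m) := by
        filter_upwards [hrun.exploit (k + 1) (Nat.le_add_left 1 k) m h1.1 h1.2] with t ht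
        filter_upwards [ht, hest] with ω h2 h3
        rw [Nat.add_sub_cancel, h3 k] at h2
        exact h2
      filter_upwards [hest, hcopies.exploitation_gap hmodel hrun.control (show 1 ≤ m by omega) hL
        hε.1.le hLε hθs hus
        (measurable_noiseEstimate_obs hrun.explore (show cycleEnd m₀ n k ≤ m - 1 by omega)) hg]
        with ω h2 h3 _ _
      rw [h2 k]
      exact h3
    · exact Eventually.of_forall fun ω h2 h3 => absurd ⟨h2, h3⟩ h1
  have hexplore : ∀ᵐ ω ∂P, ∀ k m, m ∈ explorationEpisodes m₀ n k →
      (P[payoff c θs (A m) (M m) (u m) | obsSigma P θs A M u (m - 1)]) ω = Jexp := by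
    refine ae_all_iff.2 fun k => ae_all_iff.2 fun m => ?_
    by_cases h1 : m ∈ explorationEpisodes m₀ n k
    · have h2 : 1 ≤ m := by
        rw [explorationEpisodes_eq, Finset.mem_image] at h1
        obtain ⟨j, _, rfl⟩ := h1
        exact one_le_exploreIndex m₀ n j
      filter_upwards [hcopies.condExp_exploration hmodel hrun.control h2 hue2
        (hrun.explore k m h1)] with ω h3 _ using h3
    · exact Eventually.of_forall fun ω h2 => absurd h2 h1
  -- Probability is lost only in the error bound of the estimator. The two bounds on the conditional
  -- payoffs hold almost surely for all episodes.
  refine (hcopies.le_measure_cycleEstimate hmodel hue2 (hτ η hη) (show 1 ≤ m₀ by omega)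
    hrun.explore (hlse η hη)).trans (measure_mono_ae ?_)
  filter_upwards [hexploit, hexplore] with ω h1 h2 h3 N hN
  refine sum_regret_le hκ (abs_nonneg _) (by positivity) (by linarith) hl0 (by omega)
    (Nat.ceil_lt_add_one (by have : 0 < C := by linarith
                             positivity)).le hN (fun k m hm => ?_) fun k m hm hm' => ?_
  · rw [h2 k m hm]
    exact le_abs_self _
  · set x := (l + Real.log (m₀ + k : ℕ)) / √((m₀ + k : ℕ) : ℝ) with hxdef
    have hmk : (m₀ : ℝ) ≤ (m₀ + k : ℕ) := by exact_mod_cast Nat.le_add_right m₀ k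
    have hx0 : 0 ≤ x := div_nonneg (add_nonneg hl0 (Real.log_natCast_nonneg _)) (Real.sqrt_nonneg _)
    have hx1 : x ≤ min 1 ((δ / Ctil) ^ (1 / κ)) :=
      hrate l (m₀ + k) hl0 (le_trans (by gcongr) (hm₀C.trans hmk))
    have h4 := h3 k (by omega)
    have h5 := norm_sub_le_of_rate hCtil.le hκ hx0 (hx1.trans (min_le_left _ _)) h4.1 h4.2
    have h6 : Ctil * x ^ κ ≤ δ := by
      rw [← le_div_iff₀' hCtil]
      calc x ^ κ ≤ ((δ / Ctil) ^ (1 / κ)) ^ κ :=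
            Real.rpow_le_rpow hx0 (hx1.trans (min_le_right _ _)) hκ.1.le
        _ = δ / Ctil := by
            rw [← Real.rpow_mul (by positivity), one_div_mul_cancel hκ.1.ne', Real.rpow_one]
    refine (h1 k m hm hm' (mem_admissibleParams_of_close hpd hδ1 hδ2 hδ3 hδ4 (h5.trans h6))).trans ?_
    calc V * ‖cycleEstimate θs ue A M u (τ η) (p η) m₀ n k ω - θs‖ ^ 2
        ≤ |V| * (Ctil * x ^ κ) ^ 2 := by
          gcongr
          exact le_abs_self V
      _ = H * (x ^ κ) ^ 2 := by rw [hH]; ring
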